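/- Setting. Fix integers \(2\le s_1<\dots<s_N\), put \(s=\gcd(s_1,\dots,s_N)\), and for \(\zeta\in\mathbb C^N\) let \(F(y,x;\zeta)=y-1-\sum_{n}\zeta_n x^{s_n}y^{s_n}\). Let \(U(\cdot;\zeta)\) be the unique analytic germ at \(x=0\) with \(U(0;\zeta)=1\) and \(F(U(x;\zeta),x;\zeta)=0\) (the Taylor branch); let \(\rho_*(\zeta)\) be the radius of the largest disk about \(0\) on which it is analytic, and write \(U(x;\zeta)^p=\sum_{m\ge0}R_p(m;\zeta)x^{ms}\). The boundary is *dominant* with representative \(x_*\) if the singular points of the branch on \(|x|=\rho_*(\zeta)\) are exactly the points \(e^{2\pi ij/s}x_*\), \(0\le j<s\). The representative is *simple* with branch value \(\lambda\) if \(U(x;\zeta)\to\lambda\) as \(x\to x_*\) in \(|x|<\rho_*(\zeta)\) and \(F=\partial_yF=0\ne\partial_y^2F\) at \((\lambda,x_*;\zeta)\). Let \(\mathcal C\) be the set of \(\zeta\) with \(\rho_*(\zeta)=1\) and dominant boundary; \(\zeta_c\in\mathcal C\) is a simple critical point if its representative is simple. Hypotheses. Let \(\varepsilon\mapsto\zeta(\varepsilon)\),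 \(0\le\varepsilon\le\varepsilon_1\), be a \(C^1\) path with \(\zeta(0)=\zeta_c\in\mathcal C\) a simple critical point and \(\rho_*(\varepsilon):=\rho_*(\zeta(\varepsilon))>1\) for \(\varepsilon>0\). Assume that for every \(\varepsilon\) the boundary is dominant with a simple representative \(x_*(\varepsilon)\), of branch value \(\lambda(\varepsilon)\), where \(x_*\) is \(C^1\) in \(\varepsilon\), and that \(\frac{d}{d\varepsilon}\rho_*(\varepsilon)|_{\varepsilon=0}\ne0\) (transversality). Write \(x_{*,c}=x_*(0)\), \(\lambda_c=\lambda(0)\), \(\rho(\varepsilon)=(1+\rho_*(\varepsilon))/2\), \(z_*(\varepsilon)=x_*(\varepsilon)^s\) and \(\delta_z=1-z/z_*(\varepsilon)\). Assume uniform square-root continuation: there are \(\varepsilon_0,\eta_0,C_0,c_0>0\), \(\phi\in(0,\pi/2)\) and \(M<\infty\) such that for \(0<\varepsilon<\varepsilon_0\) the germ \(\widehat U(z;\varepsilon)\) defined by \(\widehat U(x^s;\varepsilon)=U(x;\zeta(\varepsilon))\) continues to a function holomorphic in \[\Omega_\varepsilon=\{|z|<|z_*(\varepsilon)|+\eta_0/2,\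 z\ne z_*(\varepsilon),\ |\arg(z/z_*(\varepsilon)-1)|>\phi\}\] and continuous on its closure, with \(\overline{D(0,\rho(\varepsilon)^s)}\subset\Omega_\varepsilon\), with \(|\widehat U|\le M\) on \(\partial\Omega_\varepsilon\), and with \[\Bigl|\widehat U(z;\varepsilon)-\lambda(\varepsilon)-s^{-1/2}\kappa(\varepsilon)\delta_z^{1/2}-c(\varepsilon)\delta_z-d(\varepsilon)\delta_z^{3/2}\Bigr|\le C_0|\delta_z|^2\] for \(z\in\Omega_\varepsilon\), \(|\delta_z|<\eta_0\) (principal powers), where \(|\lambda(\varepsilon)|,|\kappa(\varepsilon)|\ge c_0\) and \(|\lambda|+|\kappa|+|c|+|d|\le C_0\). Weighted realization. Fix \(\beta>0\) and \(\alpha>\max\{M_0,L_0\}\), where for all small \(\varepsilon>0\) one has \(|U(x;\zeta(\varepsilon))|\le M_0\) on \(|x|=\rho(\varepsilon)\) and \(|\lambda(\varepsilon)|\le L_0\). Fix \(q\in\{1,\dots,s\}\), put \(p_j=q+js\), \(w_j=p_j^{3/2+\beta}\alpha^{p_j}\), and let \(v^{(p_k)}_j=p_jp_k^{-1/2}R_{p_k}(j-k;\zeta(\varepsilon))\)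 for \(j\ge k\), and \(0\) for \(j<k\). Let \(\widetilde V^{(q)}(\varepsilon)\) be the operator on \(\ell^2(\mathbb N_0)\) whose \(k\)-th column is \(v^{(p_k)}/w_k\), and \(\widetilde G^{(q)}(\varepsilon)=\widetilde V^{(q)}(\varepsilon)^*\widetilde V^{(q)}(\varepsilon)\) the renormalized Gram block. For a bounded self-adjoint operator \(A\) and \(k\ge1\) let \(\mu_k(A)=\inf_{\dim E=k-1}\sup_{u\perp E,\|u\|=1}\langle u,Au\rangle\), and put \(\mu^{(q)}_k(\varepsilon)=\mu_k(\widetilde G^{(q)}(\varepsilon))\). Finally let \(\eta(\varepsilon)=(\rho(\varepsilon)\rho_*(\varepsilon))^{-2s}\) and \(L(\varepsilon)=\sum_{m\ge0}\eta(\varepsilon)^m/(m+1)\). Theorem. As \(\varepsilon\downarrow0\), \(L(\varepsilon)=\log\frac1{\rho_*(\varepsilon)-1}+O(1)\). For all sufficiently small \(\varepsilon>0\) the operator \(\widetilde V^{(q)}(\varepsilon)\) is bounded, and there are vectors \(\widetilde d^{(q)}(\varepsilon)\in\ell^2(\mathbb N_0)\) such that \(\widetilde G^{(q)}(\varepsilon)-L(\varepsilon)\,\widetilde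 d^{(q)}(\varepsilon)\otimes\widetilde d^{(q)}(\varepsilon)\) is bounded in operator norm uniformly in \(\varepsilon\) and \(\widetilde d^{(q)}(\varepsilon)\to\widetilde d^{(q)}_c\) in \(\ell^2(\mathbb N_0)\), where \(\kappa_c=\lim_{\varepsilon\downarrow0}\kappa(\varepsilon)\) exists and \[\widetilde d_c^{(q)}(j)=e^{-ij\phi_c}\frac{s}{\sqrt{p_j}}\,\frac{\overline{A^{(c)}_{p_j}}}{w_j},\qquad A_p^{(c)}=-\frac{s^{-1/2}}{2\sqrt\pi}\,p\,\kappa_c\lambda_c^{p-1},\qquad \phi_c=\arg x_{*,c}^s .\] With \(\Gamma^{(q)}:=\|\widetilde d_c^{(q)}\|^2\) one has \(\Gamma^{(q)}>0\), \[\mu_1^{(q)}(\varepsilon)=\Gamma^{(q)}L(\varepsilon)+O(1),\qquad \frac{\mu_1^{(q)}(\varepsilon)}{L(\varepsilon)}\to\Gamma^{(q)},\] and for every \(k\ge2\) the level \(\mu_k^{(q)}(\varepsilon)\) is bounded for all sufficiently small \(\varepsilon>0\). -/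

import Mathlib

open Filter Topology Asymptotics
open scoped ENNReal

noncomputable section

namespace TodaLeaf

/-! ## The inverse-map equation and its Taylor branch -/

/-- The symmetry index `s = gcd(s₁, …, s_N)` of a leaf with exponents `e n = s_{n+1}`. -/
def symIndex {N : ℕ} (e : Fin N → ℕ) : ℕ := Finset.univ.gcd e

/-- The polynomial `F(y, x; ζ) = y - 1 - ∑ ζₙ x^{sₙ} y^{sₙ}`. -/
def charF {N : ℕ} (e : Fin N → ℕ) (ζ : Fin N → ℂ) (y x : ℂ) : ℂ :=
  y - 1 - ∑ n, ζ n * x ^ e n * y ^ e n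

/-- The map `W ↦ 1 + ∑ ζₙ X^{sₙ} W^{sₙ}` on formal power series. -/
def inverseStep {N : ℕ} (e : Fin N → ℕ) (ζ : Fin N → ℂ) (W : PowerSeries ℂ) : PowerSeries ℂ :=
  1 + ∑ n, PowerSeries.C (ζ n) * PowerSeries.X ^ e n * W ^ e n

/-- The Taylor series at `x = 0` of the Taylor branch `U(·; ζ)`, i.e. the unique solution of
`U = 1 + ∑ ζₙ x^{sₙ} U^{sₙ}`; its `k`-th coefficient is read off from the `k`-th iterate of
`inverseStep`.  See `taylorSeries_eq` and `taylorSeries_unique`. -/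
def taylorSeries {N : ℕ} (e : Fin N → ℕ) (ζ : Fin N → ℂ) : PowerSeries ℂ :=
  PowerSeries.mk fun k => PowerSeries.coeff k ((inverseStep e ζ)^[k] 1)

theorem inverseStep_contract {N : ℕ} (e : Fin N → ℕ) (he : ∀ n, 1 ≤ e n) (ζ : Fin N → ℂ) (k : ℕ)
    (W W' : PowerSeries ℂ) (h : (PowerSeries.X : PowerSeries ℂ) ^ k ∣ W - W') :
    (PowerSeries.X : PowerSeries ℂ) ^ (k + 1) ∣ inverseStep e ζ W - inverseStep e ζ W' := by
  unfold inverseStep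
  rw [add_sub_add_left_eq_sub, ← Finset.sum_sub_distrib]
  refine Finset.dvd_sum fun n _ => ?_
  rw [← mul_sub, pow_succ']
  refine mul_dvd_mul ?_ (h.trans (sub_dvd_pow_sub_pow W W' (e n)))
  exact Dvd.dvd.mul_left (dvd_pow_self _ (by have := he n; omega)) _

theorem iterate_stable {N : ℕ} (e : Fin N → ℕ) (he : ∀ n, 1 ≤ e n) (ζ : Fin N → ℂ)
    (W : PowerSeries ℂ) (hW : (PowerSeries.X : PowerSeries ℂ) ∣ W - 1) (k : ℕ) :
    (PowerSeries.X : PowerSeries ℂ) ^ (k + 1) ∣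
      (inverseStep e ζ)^[k] W - (inverseStep e ζ)^[k] 1 := by
  induction k with
  | zero => simpa using hW
  | succ k ih =>
    rw [Function.iterate_succ_apply', Function.iterate_succ_apply']
    exact inverseStep_contract e he ζ _ _ _ ih

theorem inverseStep_one {N : ℕ} (e : Fin N → ℕ) (he : ∀ n, 1 ≤ e n) (ζ : Fin N → ℂ)
    (W : PowerSeries ℂ) : (PowerSeries.X : PowerSeries ℂ) ∣ inverseStep e ζ W - 1 := by
  unfold inverseStep
  rw [add_sub_cancel_left]
  refine Finset.dvd_sum fun n _ => ?_
  exact Dvd.dvd.mul_right (Dvd.dvd.mul_left (dvd_pow_self _ (by have := he n; omega)) _) _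

theorem taylorSeries_approx {N : ℕ} (e : Fin N → ℕ) (he : ∀ n, 1 ≤ e n) (ζ : Fin N → ℂ) (k : ℕ) :
    (PowerSeries.X : PowerSeries ℂ) ^ (k + 1) ∣
      taylorSeries e ζ - (inverseStep e ζ)^[k] 1 := by
  have key : ∀ i d, PowerSeries.coeff i ((inverseStep e ζ)^[i + d] 1)
      = PowerSeries.coeff i ((inverseStep e ζ)^[i] 1) := by
    intro i d
    induction d with
    | zero => rfl
    | succ d ih =>
      have h := iterate_stable e he ζ (inverseStep e ζ 1) (inverseStep_one e he ζ 1) (i + d)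
      rw [PowerSeries.X_pow_dvd_iff] at h
      have h2 := h i (by omega)
      rw [map_sub, sub_eq_zero, ← Function.iterate_succ_apply] at h2
      rw [← ih, ← h2]
      rfl
  rw [PowerSeries.X_pow_dvd_iff]
  intro i hi
  obtain ⟨d, rfl⟩ := Nat.exists_eq_add_of_le (Nat.lt_succ_iff.mp hi)
  rw [map_sub, sub_eq_zero, taylorSeries, PowerSeries.coeff_mk, key]

/-- The Taylor series solves the inverse-map equation. -/
theorem taylorSeries_eq {N : ℕ} (e : Fin N → ℕ) (he : ∀ n, 1 ≤ e n) (ζ : Fin N → ℂ) :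
    taylorSeries e ζ = 1 + ∑ n, PowerSeries.C (ζ n) * PowerSeries.X ^ e n
      * taylorSeries e ζ ^ e n := by
  change taylorSeries e ζ = inverseStep e ζ (taylorSeries e ζ)
  ext k
  have h1 := taylorSeries_approx e he ζ (k + 1)
  have h2 := inverseStep_contract e he ζ _ _ _ (taylorSeries_approx e he ζ k)
  rw [← Function.iterate_succ_apply' (inverseStep e ζ)] at h2
  have h3 := dvd_sub h1 h2
  rw [sub_sub_sub_cancel_right, PowerSeries.X_pow_dvd_iff] at h3
  have h4 := h3 k (by omega)
  rwa [map_sub, sub_eq_zero] at h4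

/-- The inverse-map equation has only one formal solution. -/
theorem taylorSeries_unique {N : ℕ} (e : Fin N → ℕ) (he : ∀ n, 1 ≤ e n) (ζ : Fin N → ℂ)
    (W : PowerSeries ℂ)
    (hW : W = 1 + ∑ n, PowerSeries.C (ζ n) * PowerSeries.X ^ e n * W ^ e n) :
    W = taylorSeries e ζ := by
  have hall : ∀ k, (PowerSeries.X : PowerSeries ℂ) ^ k ∣ W - taylorSeries e ζ := by
    intro k
    induction k with
    | zero => simp
    | succ k ih =>
      have h := inverseStep_contract e he ζ _ _ _ ih
      have h1 : inverseStep e ζ W = W := hW.symm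
      have h2 : inverseStep e ζ (taylorSeries e ζ) = taylorSeries e ζ :=
        (taylorSeries_eq e he ζ).symm
      rwa [h1, h2] at h
  ext k
  have h := hall (k + 1)
  rw [PowerSeries.X_pow_dvd_iff] at h
  have h4 := h k (by omega)
  rwa [map_sub, sub_eq_zero] at h4

/-- The radius of analyticity `ρ_*(ζ)` of the Taylor branch: the radius of convergence of its
Taylor series at `0`, i.e. the radius of the largest disk about `0` on which it is analytic. -/
def rhoStar {N : ℕ} (e : Fin N → ℕ) (ζ : Fin N → ℂ) : ℝ≥0∞ :=
  (FormalMultilinearSeries.ofScalars ℂ fun k => PowerSeries.coeff k (taylorSeries e ζ)).radius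

/-- The open disk `|x| < ρ_*(ζ)`. -/
def analyticDisk {N : ℕ} (e : Fin N → ℕ) (ζ : Fin N → ℂ) : Set ℂ := {x | ‖x‖ₑ < rhoStar e ζ}

/-- The Taylor branch `U(x; ζ)` as a function; it is used only on `analyticDisk`. -/
def branchU {N : ℕ} (e : Fin N → ℕ) (ζ : Fin N → ℂ) (x : ℂ) : ℂ :=
  ∑' k, PowerSeries.coeff k (taylorSeries e ζ) * x ^ k

/-- The coefficient `R_p(m; ζ) = [x^{ms}] U(x; ζ)^p`. -/
def coeffR {N : ℕ} (e : Fin N → ℕ) (ζ : Fin N → ℂ) (p m : ℕ) : ℂ :=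
  PowerSeries.coeff (m * symIndex e) (taylorSeries e ζ ^ p)

/-! ## Dominant orbits, critical points, transversal paths -/

/-- `x₀` on the circle `|x| = ρ_*(ζ)` is a singular point of the Taylor branch: the branch on the
disk has no analytic extension to a neighbourhood of `x₀`. -/
def IsSingularPoint {N : ℕ} (e : Fin N → ℕ) (ζ : Fin N → ℂ) (x₀ : ℂ) : Prop :=
  ‖x₀‖ₑ = rhoStar e ζ ∧
    ¬ ∃ g : ℂ → ℂ, AnalyticAt ℂ g x₀ ∧ ∀ᶠ x in 𝓝[analyticDisk e ζ] x₀, g x = branchU e ζ x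

/-- The analytic boundary is dominant modulo the `s`-symmetry, with representative `xs`: the
singular points on `|x| = ρ_*(ζ)` are exactly the points of the orbit `e^{2πij/s} xs`. -/
def IsDominantOrbit {N : ℕ} (e : Fin N → ℕ) (ζ : Fin N → ℂ) (xs : ℂ) : Prop :=
  ‖xs‖ₑ = rhoStar e ζ ∧
    {x | IsSingularPoint e ζ x} =
      {x | ∃ j < symIndex e, x = Complex.exp (2 * Real.pi * Complex.I * j / symIndex e) * xs}

/-- `xs` is a simple branch point of the Taylor sheet with finite branch value `lam`. -/
def IsSimpleBranchPoint {N : ℕ} (e : Fin N → ℕ) (ζ : Fin N → ℂ) (xs lam : ℂ) : Prop :=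
  Tendsto (branchU e ζ) (𝓝[analyticDisk e ζ] xs) (𝓝 lam) ∧
    charF e ζ lam xs = 0 ∧
    deriv (fun y => charF e ζ y xs) lam = 0 ∧
    iteratedDeriv 2 (fun y => charF e ζ y xs) lam ≠ 0

/-- The analytic critical locus `𝒞`. -/
def criticalLocus {N : ℕ} (e : Fin N → ℕ) : Set (Fin N → ℂ) :=
  {ζ | rhoStar e ζ = 1 ∧ ∃ xs, IsDominantOrbit e ζ xs}

/-- `ζc ∈ 𝒞` is a simple critical point, with representative `xc` and branch value `lamc`. -/
def IsSimpleCritical {N : ℕ} (e : Fin N → ℕ) (ζc : Fin N → ℂ) (xc lamc : ℂ) : Prop :=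
  ζc ∈ criticalLocus e ∧ IsDominantOrbit e ζc xc ∧ IsSimpleBranchPoint e ζc xc lamc

/-- Scalar transversality at `ε = 0`: the representative `xs ε` continues `C¹`-smoothly and
`ε ↦ ρ_*(ζ(ε))` has a nonzero (one-sided) derivative at `0`. -/
def IsTransversal {N : ℕ} (e : Fin N → ℕ) (ζ : ℝ → Fin N → ℂ) (xs : ℝ → ℂ) (ε₁ : ℝ) : Prop :=
  ContDiffOn ℝ 1 xs (Set.Icc 0 ε₁) ∧
    ∃ v : ℝ, v ≠ 0 ∧ HasDerivWithinAt (fun ε => (rhoStar e (ζ ε)).toReal) v (Set.Ici 0) 0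

/-! ## Uniform square-root continuation -/

/-- The indented disk with vertex `ξ`, half-angle `φ` and thickness `η`. -/
def indentedDisk (ξ : ℂ) (φ η : ℝ) : Set ℂ :=
  {z | ‖z‖ < ‖ξ‖ + η ∧ z ≠ ξ ∧ φ < |Complex.arg (z / ξ - 1)|}

/-- The midpoint cutoff `ρ = (1 + ρ_*) / 2`. -/
def rhoMid {N : ℕ} (e : Fin N → ℕ) (ζ : Fin N → ℂ) : ℝ := (1 + (rhoStar e ζ).toReal) / 2

/-- The uniform square-root continuation condition.  `Uhat ε` is the Taylor sheet in the variable
`z = x^s`, `lam ε` its branch value and `s^{-1/2} kap ε` its square-root coefficient at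
`z_*(ε) = (xs ε)^s`; powers of `1 - z / z_*(ε)` are principal. -/
def UniformSqrtContinuation {N : ℕ} (e : Fin N → ℕ) (ζ : ℝ → Fin N → ℂ) (xs lam kap : ℝ → ℂ) :
    Prop :=
  ∃ (Uhat : ℝ → ℂ → ℂ) (c d : ℝ → ℂ) (ε₀ φ η₀ M C₀ c₀ : ℝ),
    0 < ε₀ ∧ 0 < φ ∧ φ < Real.pi / 2 ∧ 0 < η₀ ∧ 0 < C₀ ∧ 0 < c₀ ∧
    ∀ ε, 0 < ε → ε < ε₀ →
      -- continuation to the indented disk, with a uniform bound on its boundary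
      (∀ᶠ x in 𝓝 (0 : ℂ), Uhat ε (x ^ symIndex e) = branchU e (ζ ε) x) ∧
      DiffContOnCl ℂ (Uhat ε) (indentedDisk (xs ε ^ symIndex e) φ (η₀ / 2)) ∧
      Metric.closedBall 0 (rhoMid e (ζ ε) ^ symIndex e) ⊆
        indentedDisk (xs ε ^ symIndex e) φ (η₀ / 2) ∧
      (∀ z ∈ frontier (indentedDisk (xs ε ^ symIndex e) φ (η₀ / 2)), ‖Uhat ε z‖ ≤ M) ∧
      -- uniform Puiseux expansion to order 3/2
      (∀ z ∈ indentedDisk (xs ε ^ symIndex e) φ (η₀ / 2), ∀ δ : ℂ,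
        δ = 1 - z / xs ε ^ symIndex e → ‖δ‖ < η₀ →
        ‖Uhat ε z - (lam ε + ((Real.sqrt (symIndex e))⁻¹ : ℝ) * kap ε * δ ^ (1 / 2 : ℂ)
          + c ε * δ + d ε * δ ^ (3 / 2 : ℂ))‖ ≤ C₀ * ‖δ‖ ^ 2) ∧
      c₀ ≤ ‖lam ε‖ ∧ c₀ ≤ ‖kap ε‖ ∧ ‖lam ε‖ + ‖kap ε‖ + ‖c ε‖ + ‖d ε‖ ≤ C₀

/-- The standing hypotheses on a path `ζ(ε)`, `0 ≤ ε ≤ ε₁`, with dominant representative `xs ε`,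
branch value `lam ε` and square-root coefficient `kap ε`. -/
structure StandingHypotheses {N : ℕ} (e : Fin N → ℕ) (ζ : ℝ → Fin N → ℂ) (xs lam kap : ℝ → ℂ)
    (ε₁ : ℝ) : Prop where
  pos : 0 < ε₁
  path_C1 : ContDiffOn ℝ 1 ζ (Set.Icc 0 ε₁)
  simple_critical : IsSimpleCritical e (ζ 0) (xs 0) (lam 0)
  subcritical : ∀ ε, 0 < ε → ε ≤ ε₁ → 1 < rhoStar e (ζ ε)
  dominant : ∀ ε, 0 < ε → ε ≤ ε₁ → IsDominantOrbit e (ζ ε) (xs ε)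
  simple_branch : ∀ ε, 0 < ε → ε ≤ ε₁ → IsSimpleBranchPoint e (ζ ε) (xs ε) (lam ε)
  transversal : IsTransversal e ζ xs ε₁
  uniform : UniformSqrtContinuation e ζ xs lam kap

/-! ## Logarithmic scale, weights, renormalized Gram blocks, min–max levels -/

/-- `η = (ρ ρ_*)^{-2s}` with the midpoint cutoff `ρ`. -/
def etaScale {N : ℕ} (e : Fin N → ℕ) (ζ : Fin N → ℂ) : ℝ :=
  ((rhoMid e ζ * (rhoStar e ζ).toReal) ^ (2 * symIndex e))⁻¹

/-- The logarithmic scale `L = ∑ η^m / (m + 1)`. -/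
def logScale {N : ℕ} (e : Fin N → ℕ) (ζ : Fin N → ℂ) : ℝ :=
  ∑' m : ℕ, etaScale e ζ ^ m / (m + 1)

/-- `α` is an admissible exponential weight: `α > max {M₀, L₀}` for some `M₀`, `L₀` bounding, for
all small `ε > 0`, the Taylor branch on the midpoint circle and the branch value. -/
def IsAdmissibleWeight {N : ℕ} (e : Fin N → ℕ) (ζ : ℝ → Fin N → ℂ) (lam : ℝ → ℂ) (α : ℝ) : Prop :=
  ∃ ε₀ M₀ L₀ : ℝ, 0 < ε₀ ∧ max M₀ L₀ < α ∧ ∀ ε, 0 < ε → ε < ε₀ →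
    (∀ x : ℂ, ‖x‖ = rhoMid e (ζ ε) → ‖branchU e (ζ ε) x‖ ≤ M₀) ∧ ‖lam ε‖ ≤ L₀

/-- `p_j = q + j s`. -/
def blockIndex {N : ℕ} (e : Fin N → ℕ) (q j : ℕ) : ℕ := q + j * symIndex e

/-- The weight `w_j = p_j^{3/2 + β} α^{p_j}`. -/
def weight {N : ℕ} (e : Fin N → ℕ) (q : ℕ) (α β : ℝ) (j : ℕ) : ℝ :=
  (blockIndex e q j : ℝ) ^ (3 / 2 + β) * α ^ blockIndex e q j

/-- The Gram vector entry `v^{(p_k)}_j = p_j p_k^{-1/2} R_{p_k}(j - k; ζ)` for `j ≥ k`, and `0`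
otherwise. -/
def gramVector {N : ℕ} (e : Fin N → ℕ) (ζ : Fin N → ℂ) (q k j : ℕ) : ℂ :=
  if k ≤ j then
    (((blockIndex e q j : ℝ) / Real.sqrt (blockIndex e q k) : ℝ) : ℂ)
      * coeffR e ζ (blockIndex e q k) (j - k)
  else 0

/-- The Hilbert space `ℓ²(ℕ₀)`. -/
abbrev Ell2 : Type := lp (fun _ : ℕ => ℂ) 2

/-- The bounded operator `V` on `ℓ²(ℕ₀)` extends the renormalized synthesis map
`Ṽ^{(q)}(ζ) = V^{(q)}(ζ) 𝒲⁻¹`: its `k`-th column is `v^{(p_k)}(ζ) / w_k`. -/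
def IsSynthesis {N : ℕ} (e : Fin N → ℕ) (ζ : Fin N → ℂ) (q : ℕ) (α β : ℝ) (V : Ell2 →L[ℂ] Ell2) :
    Prop :=
  ∀ k j : ℕ, (V (lp.single 2 k (1 : ℂ)) : ℕ → ℂ) j
    = gramVector e ζ q k j / (weight e q α β k : ℂ)

/-- The renormalized Gram block `Ṽ* Ṽ`. -/
def gramBlock (V : Ell2 →L[ℂ] Ell2) : Ell2 →L[ℂ] Ell2 := ContinuousLinearMap.adjoint V ∘L V

/-- The `k`-th Courant–Fischer level (`k ≥ 1`) of a bounded operator. -/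
def minmaxLevel (A : Ell2 →L[ℂ] Ell2) (k : ℕ) : ℝ :=
  ⨅ L : {L : Submodule ℂ Ell2 // FiniteDimensional ℂ L ∧ Module.finrank ℂ L = k - 1},
    ⨆ u : {u : Ell2 // u ∈ L.1ᗮ ∧ ‖u‖ = 1}, (inner ℂ u.1 (A u.1)).re

/-- The critical transfer amplitude `A_p^{(c)} = -(s^{-1/2} / (2 √π)) p κ_c λ_c^{p-1}`. -/
def critAmplitude (s : ℕ) (kapc lamc : ℂ) (p : ℕ) : ℂ :=
  -(((Real.sqrt s)⁻¹ / (2 * Real.sqrt Real.pi) : ℝ) : ℂ) * p * kapc * lamc ^ (p - 1)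

/-- The entries `e^{-ijφ_c} (s / √p_j) conj(A_{p_j}^{(c)}) / w_j` of the limiting spike, where
`φ_c` is the argument of `z_{*,c} = xc^s`. -/
def spikeEntry {N : ℕ} (e : Fin N → ℕ) (q : ℕ) (α β : ℝ) (xc lamc kapc : ℂ) (j : ℕ) : ℂ :=
  Complex.exp (-(Complex.I * j * Complex.arg (xc ^ symIndex e)))
    * ((symIndex e / Real.sqrt (blockIndex e q j) : ℝ) : ℂ)
    * (starRingEnd ℂ) (critAmplitude (symIndex e) kapc lamc (blockIndex e q j))
    / (weight e q α β j : ℂ)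

end TodaLeaf

end

open TodaLeaf

/-!
The Gram block is a rank-one operator of size `L` plus a bounded one because the synthesis matrix
is, up to a Hilbert–Schmidt error, a product `a_j b_k`.

*Coefficient asymptotics, uniform in the path and in the power.*  In the variable `z = x ^ s` the
branch has one singularity `ξ = xs ^ s` of square-root type near the unit circle, so
`R_p(m) = p λ^{p-1} κ s^{-1/2} [z^m] (1 - z/ξ)^{1/2} + O((p + 1) A^p / (m + 1)²)` for any `A` above
the bounds for the branch on the midpoint circle and for `λ` (`exists_transfer_constant`).  The
power `p` costs only `A^p` since `(a₀ + a₁ t + a₂ t² + a₃ t³)^p`, truncated at order three in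
`t = (1 - z/ξ)^{1/2}`, is dominated coefficientwise by the same power of a polynomial with values
at most `A` (`exists_cubic_truncation`).  What is left after subtracting the truncation is
`O(|z - ξ|²)`, holomorphic on disks of radius proportional to `|z - ξ|` about each point of the
closed unit disk; its second derivative is therefore bounded there, and its Taylor coefficients
are `O(m⁻²)`.  No contour integral around the singularity is needed.

*Rank-one structure.*  Wallis' product gives
`[z^m] (1 - z)^{1/2} = -(m + 1)^{-3/2} / (2 √π) + O(m⁻²)`, and with `A = σ² α`, `σ < 1`, the
weights turn the estimate into
`Ṽ_{jk} = ξ^{-j} (j + 1)^{-1/2} b_k + O((k + 1)² σ^k / (j + 1))` (`gramVector_approx`).  The vector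
`a_j = ξ^{-j} (j + 1)^{-1/2}` has `‖a‖² = ∑ |ξ|^{-2j} / (j + 1) = L + O(1)`, and the error `E` is
bounded together with `E* a`, because `∑ (j + 1)^{-3/2}` converges.  Hence
`Ṽ* Ṽ = ‖a‖² d ⊗ d + O(1)` with `d = b̄` (`exists_operator_of_approx`).

*Rates.*  Replacing `‖d‖²` by its limit in `μ₁ = ‖d‖² L + O(1)` requires `(‖d‖² - ‖d_c‖²) L = O(1)`,
which follows from `d - d_c = O(ε)` and `L = O(log (1/ε))`, the latter by transversality.  The rate
for `d` comes from rates for `λ` and `κ`.  Uniformity of the expansion and continuity of the Taylor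
coefficients in `ζ` show that `λ` and `κ` converge; `∂_y F = 0` at the branch point, with
`∂_y² F ≠ 0`, then gives `λ(ε) - λ(0) = O(ε)` (`isBigO_branchValue`), and comparing the terms
of order `δ_z` in `F(U(x), x) = 0` expresses `κ²` through `x ∂_x F` and `∂_y² F` there
(`BranchData.sqrtCoeff_sq`), so that `κ` has a linear rate as well (`exists_limits`).

*Levels.*  The min–max levels of an operator within `K` of `L d ⊗ d` follow by testing against `d`
for `k = 1` and against a subspace containing `d` for `k ≥ 2`.
-/

/-! ### The logarithmic scale -/

/-- The power series `∑ tᵐ / (m + 1) = -log (1 - t) / t`. -/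
noncomputable def logSeries (t : ℝ) : ℝ := ∑' m : ℕ, t ^ m / (m + 1)

theorem summable_logSeries {t : ℝ} (h0 : 0 ≤ t) (h1 : t < 1) :
    Summable fun m : ℕ => t ^ m / ((m : ℝ) + 1) := by
  refine Summable.of_nonneg_of_le (fun m => by positivity) (fun m => ?_)
    (summable_geometric_of_lt_one h0 h1)
  exact div_le_self (by positivity) (by linarith [(Nat.cast_nonneg m : (0 : ℝ) ≤ m)])

/-- Multiplying by `1 - t` sums the series: `(1 - t) ∑ tᵐ / (m + 1) ≤ (1 - t) ∑ tᵐ = 1`. -/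
theorem logSeries_add_log {t : ℝ} (h0 : 0 ≤ t) (h1 : t < 1) :
    0 ≤ logSeries t + Real.log (1 - t) ∧ logSeries t + Real.log (1 - t) ≤ 1 := by
  have hs := summable_logSeries h0 h1
  have hlog : t * logSeries t = -Real.log (1 - t) := by
    rw [← (Real.hasSum_pow_div_log_of_abs_lt_one (by rwa [abs_of_nonneg h0])).tsum_eq, logSeries,
      ← tsum_mul_left]
    exact tsum_congr fun m => by ring
  have hle : logSeries t ≤ (1 - t)⁻¹ := by
    rw [← tsum_geometric_of_lt_one h0 h1]
    refine hs.tsum_le_tsum (fun m => ?_) (summable_geometric_of_lt_one h0 h1)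
    exact div_le_self (by positivity) (by linarith [(Nat.cast_nonneg m : (0 : ℝ) ≤ m)])
  have hnn : 0 ≤ logSeries t := tsum_nonneg fun m => by positivity
  have e : logSeries t + Real.log (1 - t) = (1 - t) * logSeries t := by linarith
  rw [e]
  refine ⟨mul_nonneg (by linarith) hnn, ?_⟩
  calc (1 - t) * logSeries t ≤ (1 - t) * (1 - t)⁻¹ := by gcongr
    _ = 1 := mul_inv_cancel₀ (by linarith)

theorem logSeries_inv_pow {n : ℕ} (hn : 1 ≤ n) {y : ℝ} (hy : 1 < y) (hy4 : y ≤ 4) :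
    |logSeries ((y ^ n)⁻¹) + Real.log (y - 1)| ≤ 1 + Real.log 4 + Real.log n := by
  have hy0 : 0 < y := by linarith
  have hyn : 1 < y ^ n := one_lt_pow₀ hy (by omega)
  have ht0 : 0 ≤ (y ^ n)⁻¹ := by positivity
  have ht1 : (y ^ n)⁻¹ < 1 := inv_lt_one_of_one_lt₀ hyn
  have hn' : (1 : ℝ) ≤ n := by exact_mod_cast hn
  obtain ⟨h1, h2⟩ := logSeries_add_log ht0 ht1
  set t := (y ^ n)⁻¹ with ht
  have hlo : (y - 1) / 4 ≤ 1 - t := by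
    have : t ≤ y⁻¹ := by
      rw [ht]; exact inv_anti₀ hy0 (le_self_pow₀ hy.le (by omega))
    have h3 : (y - 1) / 4 ≤ 1 - y⁻¹ := by
      have : 1 - y⁻¹ = (y - 1) / y := by field_simp
      rw [this]
      exact div_le_div_of_nonneg_left (by linarith) hy0 hy4
    linarith
  have hhi : 1 - t ≤ n * (y - 1) := by
    have hb := one_add_mul_le_pow (a := y⁻¹ - 1) (by have : 0 < y⁻¹ := by positivity
                                                     linarith) n
    have e : (1 + (y⁻¹ - 1)) ^ n = t := by rw [ht, ← inv_pow]; ring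
    rw [e] at hb
    have h3 : 1 - y⁻¹ ≤ y - 1 := by
      have : 1 - y⁻¹ = (y - 1) / y := by field_simp
      rw [this]
      exact div_le_self (by linarith) hy.le
    nlinarith
  have l1 := Real.log_le_log (by linarith) hlo
  have l2 := Real.log_le_log (by linarith) hhi
  rw [Real.log_div (by linarith) (by norm_num)] at l1
  rw [Real.log_mul (by linarith) (by linarith)] at l2
  have := Real.log_nonneg hn'
  have := Real.log_nonneg (show (1 : ℝ) ≤ 4 by norm_num)
  rw [abs_le]
  constructor <;> linarith

/-! ### Rank-one perturbations on `ℓ²` -/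

theorem norm_coord_le (x : Ell2) (k : ℕ) : ‖(x : ℕ → ℂ) k‖ ≤ ‖x‖ :=
  lp.norm_apply_le_norm (by norm_num) x k

theorem inner_single_left (x : Ell2) (k : ℕ) :
    inner ℂ (lp.single 2 k (1 : ℂ) : Ell2) x = (x : ℕ → ℂ) k := by
  rw [lp.inner_single_left]
  simp

/-- A sequence of absolutely summable columns is the matrix of a bounded operator. -/
theorem exists_operator_of_summable_columns (col : ℕ → Ell2) {B : ℕ → ℝ}
    (hB : ∀ k, ‖col k‖ ≤ B k) (hs : Summable B) :
    ∃ E : Ell2 →L[ℂ] Ell2, (∀ k, E (lp.single 2 k (1 : ℂ)) = col k) ∧ ‖E‖ ≤ ∑' k, B k ∧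
      ∀ x : Ell2, HasSum (fun k => (x : ℕ → ℂ) k • col k) (E x) := by
  let T : ℕ → (Ell2 →L[ℂ] Ell2) := fun k =>
    InnerProductSpace.rankOne ℂ (col k) (lp.single 2 k (1 : ℂ) : Ell2)
  have hT : ∀ k, ‖T k‖ ≤ B k := fun k => by
    simp only [T, InnerProductSpace.norm_rankOne]
    rw [lp.norm_single (by norm_num)]
    simpa using hB k
  have hTs : Summable T := Summable.of_norm_bounded hs hT
  have key : ∀ x : Ell2, HasSum (fun k => (x : ℕ → ℂ) k • col k) ((∑' k, T k) x) := by
    intro x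
    have e : ∀ k, T k x = (x : ℕ → ℂ) k • col k := fun k => by
      simp only [T, InnerProductSpace.rankOne_apply, inner_single_left]
    have h := hTs.hasSum.mapL (ContinuousLinearMap.apply ℂ Ell2 x)
    simp only [ContinuousLinearMap.apply_apply, e] at h
    exact h
  refine ⟨∑' k, T k, fun k => ?_, ?_, key⟩
  · refine (key _).unique ?_
    convert hasSum_single k ?_ using 1
    · simp
    · intro j hj
      simp [lp.single_apply, hj]
  · exact tsum_of_norm_bounded hs.hasSum hT

/-- Expanding `(a ⊗ d + E)* (a ⊗ d + E)`, every term except `‖a‖² d ⊗ d` is controlled by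
`‖d‖`, `‖E‖` and `‖E* a‖`; the norm of `a` itself does not enter. -/
theorem gramBlock_rankOne_add (a d : Ell2) (E : Ell2 →L[ℂ] Ell2) (L : ℝ) {K₁ K₂ K₃ K₄ : ℝ}
    (h1 : |‖a‖ ^ 2 - L| ≤ K₁) (h2 : ‖d‖ ≤ K₂) (h3 : ‖E‖ ≤ K₃)
    (h4 : ‖ContinuousLinearMap.adjoint E a‖ ≤ K₄) :
    ‖gramBlock (InnerProductSpace.rankOne ℂ a d + E)
      - (L : ℂ) • InnerProductSpace.rankOne ℂ d d‖ ≤ K₁ * K₂ ^ 2 + 2 * (K₂ * K₄) + K₃ ^ 2 := by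
  set b := ContinuousLinearMap.adjoint E a with hb
  have e : gramBlock (InnerProductSpace.rankOne ℂ a d + E)
      - (L : ℂ) • InnerProductSpace.rankOne ℂ d d
      = (((‖a‖ ^ 2 - L : ℝ) : ℂ) • InnerProductSpace.rankOne ℂ d d
        + InnerProductSpace.rankOne ℂ d b + InnerProductSpace.rankOne ℂ b d)
        + ContinuousLinearMap.adjoint E ∘L E := by
    unfold gramBlock
    rw [map_add, InnerProductSpace.adjoint_rankOne, ContinuousLinearMap.add_comp,
      ContinuousLinearMap.comp_add, ContinuousLinearMap.comp_add,
      InnerProductSpace.rankOne_comp_rankOne, InnerProductSpace.rankOne_comp,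
      InnerProductSpace.comp_rankOne, inner_self_eq_norm_sq_to_K]
    push_cast
    rw [sub_smul]
    simp only [Complex.coe_algebraMap]
    abel
  rw [e]
  have hK2 : 0 ≤ K₂ := (norm_nonneg _).trans h2
  have hK1 : 0 ≤ K₁ := (abs_nonneg _).trans h1
  have n1 : ‖((‖a‖ ^ 2 - L : ℝ) : ℂ) • InnerProductSpace.rankOne ℂ d d‖ ≤ K₁ * K₂ ^ 2 := by
    rw [norm_smul, InnerProductSpace.norm_rankOne, Complex.norm_real, Real.norm_eq_abs, ← sq]
    gcongr
  have n2 : ‖InnerProductSpace.rankOne ℂ d b‖ ≤ K₂ * K₄ := by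
    rw [InnerProductSpace.norm_rankOne]; gcongr
  have n3 : ‖InnerProductSpace.rankOne ℂ b d‖ ≤ K₂ * K₄ := by
    rw [InnerProductSpace.norm_rankOne, mul_comm]; gcongr
  have n4 : ‖ContinuousLinearMap.adjoint E ∘L E‖ ≤ K₃ ^ 2 := by
    rw [ContinuousLinearMap.norm_adjoint_comp_self, ← sq]; gcongr
  calc _ ≤ ‖_‖ + ‖_‖ + ‖_‖ + ‖_‖ := norm_add₄_le
    _ ≤ K₁ * K₂ ^ 2 + K₂ * K₄ + K₂ * K₄ + K₃ ^ 2 := by gcongr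
    _ = _ := by ring

theorem norm_adjoint_apply_le {E : Ell2 →L[ℂ] Ell2} {col : ℕ → Ell2}
    (hE : ∀ x : Ell2, HasSum (fun k => (x : ℕ → ℂ) k • col k) (E x)) (a : Ell2) {B : ℕ → ℝ}
    (hB : ∀ k, ‖inner ℂ a (col k)‖ ≤ B k) (hs : Summable B) :
    ‖ContinuousLinearMap.adjoint E a‖ ≤ ∑' k, B k := by
  have hBn : 0 ≤ ∑' k, B k := tsum_nonneg fun k => (norm_nonneg _).trans (hB k)
  set b := ContinuousLinearMap.adjoint E a with hb
  have h1 : HasSum (fun k => inner ℂ a ((b : ℕ → ℂ) k • col k)) (inner ℂ a (E b)) :=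
    (innerSL ℂ a).hasSum (hE b)
  have h2 : ‖inner ℂ a (E b)‖ ≤ ‖b‖ * ∑' k, B k := by
    rw [← h1.tsum_eq, ← tsum_mul_left]
    refine tsum_of_norm_bounded (hs.mul_left _).hasSum fun k => ?_
    rw [inner_smul_right, norm_mul]
    exact mul_le_mul (norm_coord_le b k) (hB k) (norm_nonneg _) (norm_nonneg _)
  rw [← ContinuousLinearMap.adjoint_inner_left, ← hb, inner_self_eq_norm_sq_to_K] at h2
  have h3 : ‖b‖ ^ 2 ≤ ‖b‖ * ∑' k, B k := by simpa using h2
  by_contra! hlt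
  have : 0 < ‖b‖ := hBn.trans_lt hlt
  nlinarith

/-! ### Courant–Fischer levels -/

theorem re_inner_gramBlock (V : Ell2 →L[ℂ] Ell2) (u : Ell2) :
    (inner ℂ u (gramBlock V u)).re = ‖V u‖ ^ 2 := by
  have : inner ℂ u (gramBlock V u) = inner ℂ (V u) (V u) := by
    simp only [gramBlock, ContinuousLinearMap.comp_apply]
    exact ContinuousLinearMap.adjoint_inner_right V u (V u)
  rw [this, inner_self_eq_norm_sq_to_K]
  norm_cast

theorem minmaxLevel_gramBlock_nonneg (V : Ell2 →L[ℂ] Ell2) (k : ℕ) :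
    0 ≤ minmaxLevel (gramBlock V) k :=
  Real.iInf_nonneg fun _ => Real.iSup_nonneg fun u => by rw [re_inner_gramBlock]; positivity

theorem minmaxLevel_gramBlock_le (V : Ell2 →L[ℂ] Ell2) (k : ℕ) (W : Submodule ℂ Ell2)
    (hfd : FiniteDimensional ℂ W) (hW : Module.finrank ℂ W = k - 1) {K : ℝ} (hK : 0 ≤ K)
    (h : ∀ u ∈ Wᗮ, ‖u‖ = 1 → (inner ℂ u (gramBlock V u)).re ≤ K) :
    minmaxLevel (gramBlock V) k ≤ K := by
  refine (ciInf_le ⟨0, ?_⟩ ⟨W, hfd, hW⟩).trans (Real.iSup_le (fun u => h _ u.2.1 u.2.2) hK)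
  rintro _ ⟨W', rfl⟩
  exact Real.iSup_nonneg fun u => by rw [re_inner_gramBlock]; positivity

theorem le_minmaxLevel_one (A : Ell2 →L[ℂ] Ell2) {u : Ell2} (hu : ‖u‖ = 1) :
    (inner ℂ u (A u)).re ≤ minmaxLevel A 1 := by
  have : Nonempty {L : Submodule ℂ Ell2 // FiniteDimensional ℂ L ∧ Module.finrank ℂ L = 1 - 1} :=
    ⟨⟨⊥, inferInstance, by simp⟩⟩
  refine le_ciInf fun W => ?_
  have hW : W.1 = ⊥ := by
    have := W.2.1
    exact Submodule.finrank_eq_zero.mp (by simpa using W.2.2)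
  refine le_ciSup (f := fun u : {u : Ell2 // u ∈ W.1ᗮ ∧ ‖u‖ = 1} => (inner ℂ u.1 (A u.1)).re)
    ⟨‖A‖, ?_⟩ ⟨u, by rw [hW]; simp, hu⟩
  rintro _ ⟨v, rfl⟩
  calc (inner ℂ v.1 (A v.1)).re ≤ ‖inner ℂ v.1 (A v.1)‖ := Complex.re_le_norm _
    _ ≤ ‖v.1‖ * ‖A v.1‖ := norm_inner_le_norm _ _
    _ ≤ ‖v.1‖ * (‖A‖ * ‖v.1‖) := by gcongr; exact A.le_opNorm _
    _ = ‖A‖ := by rw [v.2.2]; ring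

theorem not_finiteDimensional_ell2 : ¬ FiniteDimensional ℂ Ell2 := by
  intro h
  have hli : LinearIndependent ℂ (fun k : ℕ => (lp.single 2 k (1 : ℂ) : Ell2)) := by
    have ho : Orthonormal ℂ (fun k : ℕ => (lp.single 2 k (1 : ℂ) : Ell2)) := by
      rw [orthonormal_iff_ite]
      intro i j
      rw [inner_single_left]
      simp [lp.single_apply, Pi.single_apply]
    exact ho.linearIndependent
  have := hli.finite
  exact not_finite ℕ

/-- Every nonzero vector of `ℓ²` lies in a subspace of each prescribed positive dimension. -/
theorem exists_submodule_finrank (d : Ell2) (hd : d ≠ 0) (n : ℕ) :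
    ∃ W : Submodule ℂ Ell2, FiniteDimensional ℂ W ∧ Module.finrank ℂ W = n + 1 ∧ d ∈ W := by
  induction n with
  | zero =>
    exact ⟨ℂ ∙ d, inferInstance, finrank_span_singleton hd, Submodule.mem_span_singleton_self d⟩
  | succ n ih =>
    obtain ⟨W, hfd, hr, hdW⟩ := ih
    have hne : W ≠ ⊤ := by
      rintro rfl
      exact not_finiteDimensional_ell2 (Module.finite_def.mpr (by
        have := (Submodule.fg_top (⊤ : Submodule ℂ Ell2)).mp (Module.finite_def.mp hfd)
        exact this))
    obtain ⟨v, hv⟩ : ∃ v, v ∉ W := by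
      by_contra! hall
      exact hne (Submodule.eq_top_iff'.mpr hall)
    have hdis : W ⊓ (ℂ ∙ v) = ⊥ := by
      rw [← disjoint_iff, Submodule.disjoint_span_singleton']
      · exact hv
      · rintro rfl; exact hv (zero_mem _)
    refine ⟨W ⊔ (ℂ ∙ v), inferInstance, ?_, Submodule.mem_sup_left hdW⟩
    have h1 := Submodule.finrank_sup_add_finrank_inf_eq W (ℂ ∙ v)
    rw [hdis, finrank_bot, finrank_span_singleton (by rintro rfl; exact hv (zero_mem _)), hr] at h1
    omega

/-- The quadratic form of a Gram block close to `L d ⊗ d`. -/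
theorem re_inner_gramBlock_approx (V : Ell2 →L[ℂ] Ell2) (d : Ell2) {L K : ℝ}
    (h : ‖gramBlock V - (L : ℂ) • InnerProductSpace.rankOne ℂ d d‖ ≤ K) {u : Ell2}
    (hu : ‖u‖ = 1) :
    |(inner ℂ u (gramBlock V u)).re - L * ‖inner ℂ d u‖ ^ 2| ≤ K := by
  set D := gramBlock V - (L : ℂ) • InnerProductSpace.rankOne ℂ d d with hD
  have e : gramBlock V u = D u + (L : ℂ) • (inner ℂ d u • d) := by
    have : ((L : ℂ) • InnerProductSpace.rankOne ℂ d d) u = (L : ℂ) • (inner ℂ d u • d) := rfl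
    rw [hD, sub_apply, this, sub_add_cancel]
  have e2 : (inner ℂ u (gramBlock V u)).re - L * ‖inner ℂ d u‖ ^ 2 = (inner ℂ u (D u)).re := by
    rw [e, inner_add_right, inner_smul_right, inner_smul_right, ← inner_conj_symm u d,
      Complex.mul_conj, Complex.normSq_eq_norm_sq]
    rw [← Complex.ofReal_mul, Complex.add_re, Complex.ofReal_re]
    ring
  rw [e2]
  calc |(inner ℂ u (D u)).re| ≤ ‖inner ℂ u (D u)‖ := Complex.abs_re_le_norm _
    _ ≤ ‖u‖ * ‖D u‖ := norm_inner_le_norm _ _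
    _ ≤ ‖u‖ * (‖D‖ * ‖u‖) := by gcongr; exact D.le_opNorm _
    _ ≤ K := by rw [hu]; linarith

theorem minmaxLevel_one_approx (V : Ell2 →L[ℂ] Ell2) (d : Ell2) (hd : d ≠ 0) {L K : ℝ}
    (hL : 0 ≤ L)
    (h : ‖gramBlock V - (L : ℂ) • InnerProductSpace.rankOne ℂ d d‖ ≤ K) :
    |minmaxLevel (gramBlock V) 1 - ‖d‖ ^ 2 * L| ≤ K := by
  have hK : 0 ≤ K := (norm_nonneg _).trans h
  have hup : minmaxLevel (gramBlock V) 1 ≤ ‖d‖ ^ 2 * L + K := by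
    refine minmaxLevel_gramBlock_le V 1 ⊥ inferInstance (by simp) (by positivity) fun u _ hu => ?_
    have h1 := (abs_le.mp (re_inner_gramBlock_approx V d h hu)).2
    have h2 : ‖inner ℂ d u‖ ≤ ‖d‖ := by simpa [hu] using norm_inner_le_norm (𝕜 := ℂ) d u
    have h3 : L * ‖inner ℂ d u‖ ^ 2 ≤ L * ‖d‖ ^ 2 := by gcongr
    linarith
  have hd0 : ‖d‖ ≠ 0 := norm_ne_zero_iff.mpr hd
  have hu : ‖((‖d‖⁻¹ : ℝ) : ℂ) • d‖ = 1 := by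
    rw [norm_smul, Complex.norm_real, Real.norm_eq_abs, abs_of_nonneg (by positivity)]
    field_simp
  have h1 := (abs_le.mp (re_inner_gramBlock_approx V d h hu)).1
  have h2 := le_minmaxLevel_one (gramBlock V) hu
  have h3 : ‖inner ℂ d (((‖d‖⁻¹ : ℝ) : ℂ) • d)‖ = ‖d‖ := by
    rw [inner_smul_right, inner_self_eq_norm_sq_to_K, norm_mul, Complex.norm_real, norm_pow]
    simp
    field_simp
  rw [h3] at h1
  rw [abs_le]
  constructor <;> linarith

theorem minmaxLevel_gramBlock_bounded (V : Ell2 →L[ℂ] Ell2) (d : Ell2) (hd : d ≠ 0) {L K : ℝ}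
    (h : ‖gramBlock V - (L : ℂ) • InnerProductSpace.rankOne ℂ d d‖ ≤ K) {k : ℕ} (hk : 2 ≤ k) :
    |minmaxLevel (gramBlock V) k| ≤ K := by
  have hK : 0 ≤ K := (norm_nonneg _).trans h
  rw [abs_of_nonneg (minmaxLevel_gramBlock_nonneg V k)]
  obtain ⟨W, hfd, hr, hdW⟩ := exists_submodule_finrank d hd (k - 2)
  refine minmaxLevel_gramBlock_le V k W hfd (by omega) hK fun u hu hu1 => ?_
  have h1 := (abs_le.mp (re_inner_gramBlock_approx V d h hu1)).2
  rw [(Submodule.mem_orthogonal W u).mp hu d hdW] at h1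
  simpa using h1

/-! ### Binomial coefficients of `(1 - w)^{1/2}` and `(1 - w)^{3/2}` -/

/-- The `m`-th Taylor coefficient of `(1 - w) ^ a` at `w = 0`. -/
noncomputable def binomCoeff (a : ℝ) : ℕ → ℝ
  | 0 => 1
  | m + 1 => binomCoeff a m * ((m - a) / (m + 1))

theorem ring_choose_succ (a : ℂ) (m : ℕ) :
    Ring.choose a (m + 1) * (m + 1) = Ring.choose a m * (a - m) := by
  have h1 := Ring.descPochhammer_eq_factorial_smul_choose a m
  have h2 := Ring.descPochhammer_eq_factorial_smul_choose a (m + 1)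
  rw [descPochhammer_succ_right, Polynomial.smeval_mul, h1, Nat.factorial_succ] at h2
  simp only [Polynomial.smeval_sub, Polynomial.smeval_X, Polynomial.smeval_natCast, nsmul_eq_mul,
    pow_one, pow_zero, mul_one] at h2
  have : (m.factorial : ℂ) ≠ 0 := by exact_mod_cast m.factorial_ne_zero
  push_cast at h2
  apply mul_left_cancel₀ this
  linear_combination -h2

theorem ring_choose_eq_binomCoeff (a : ℝ) (m : ℕ) :
    Ring.choose (a : ℂ) m * (-1) ^ m = binomCoeff a m := by
  induction m with
  | zero => simp [binomCoeff]
  | succ m ih =>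
    have h := ring_choose_succ a m
    have hm : (m : ℂ) + 1 ≠ 0 := by exact_mod_cast m.succ_ne_zero
    rw [binomCoeff]
    push_cast
    rw [← ih, mul_div_assoc', eq_div_iff hm]
    linear_combination (-1) ^ (m + 1) * h

theorem hasSum_one_sub_cpow (a : ℝ) {w : ℂ} (hw : ‖w‖ < 1) :
    HasSum (fun m => (binomCoeff a m : ℂ) * w ^ m) ((1 - w) ^ (a : ℂ)) := by
  have h := (Complex.one_add_cpow_hasFPowerSeriesOnBall_zero (a := (a : ℂ))).hasSum (y := -w)
    (by rw [← ENNReal.ofReal_one, Metric.eball_ofReal]; simpa using hw)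
  rw [zero_add, ← sub_eq_add_neg] at h
  have e : ∀ m, (binomialSeries ℂ (a : ℂ) m) (fun _ => -w) = (binomCoeff a m : ℂ) * w ^ m := by
    intro m
    rw [binomialSeries_apply, ← ring_choose_eq_binomCoeff]
    simp [neg_pow w m]
    ring
  simpa only [e] using h

/-- The central binomial coefficient divided by `4 ^ m`. -/
noncomputable def centralRatio : ℕ → ℝ
  | 0 => 1
  | m + 1 => centralRatio m * ((2 * m + 1) / (2 * m + 2))

theorem centralRatio_pos (m : ℕ) : 0 < centralRatio m := by
  induction m with
  | zero => simp [centralRatio]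
  | succ m ih => rw [centralRatio]; positivity

theorem centralRatio_le_one (m : ℕ) : centralRatio m ≤ 1 := by
  induction m with
  | zero => simp [centralRatio]
  | succ m ih =>
    rw [centralRatio]
    refine mul_le_one₀ ih (by positivity) ?_
    rw [div_le_one (by positivity)]
    linarith

theorem centralRatio_sq_mul_wallis (m : ℕ) :
    centralRatio m ^ 2 * (Real.Wallis.W m * (2 * m + 1)) = 1 := by
  induction m with
  | zero => simp [centralRatio, Real.Wallis.W]
  | succ m ih =>
    rw [centralRatio, Real.Wallis.W_succ]
    push_cast
    have e : (centralRatio m * ((2 * m + 1) / (2 * m + 2))) ^ 2 * (Real.Wallis.W m *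
      ((2 * m + 2) / (2 * m + 1) * ((2 * m + 2) / (2 * m + 3))) * (2 * (m + 1) + 1))
      = centralRatio m ^ 2 * (Real.Wallis.W m * (2 * m + 1)) := by
      field_simp
      ring
    rw [e, ih]

/-- Wallis' bounds give the central binomial coefficient up to a relative error `O(1 / m)`. -/
theorem centralRatio_approx (m : ℕ) :
    |centralRatio m - (Real.sqrt Real.pi * Real.sqrt (m + 1))⁻¹| ≤ 2 / (m + 1) := by
  set v := (Real.sqrt Real.pi * Real.sqrt (m + 1))⁻¹ with hv
  have hv0 : 0 < v := by have := Real.pi_pos; positivity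
  have hpi := Real.pi_pos
  have hpi3 := Real.pi_gt_three
  have hv2 : v ^ 2 = 1 / (Real.pi * (m + 1)) := by
    rw [hv, inv_pow, mul_pow, Real.sq_sqrt hpi.le, Real.sq_sqrt (by positivity), one_div]
  have hW := Real.Wallis.W_pos m
  have hc := centralRatio_pos m
  have e := centralRatio_sq_mul_wallis m
  have h1 := Real.Wallis.W_le m
  have h2 := Real.Wallis.le_W m
  set c := centralRatio m
  set W := Real.Wallis.W m
  have hc2 : c ^ 2 = 1 / (W * (2 * m + 1)) := by
    rw [eq_div_iff (by positivity)]; exact e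
  have hlo : v ^ 2 ≤ c ^ 2 := by
    rw [hv2, hc2]
    apply one_div_le_one_div_of_le (by positivity)
    nlinarith [(Nat.cast_nonneg m : (0 : ℝ) ≤ m)]
  have hhi : c ^ 2 - v ^ 2 ≤ 2 / (m + 1) ^ 2 := by
    have h3 : c ^ 2 ≤ 1 / ((2 * m + 1) / (2 * m + 2) * (Real.pi / 2) * (2 * m + 1)) := by
      rw [hc2]
      apply one_div_le_one_div_of_le (by positivity)
      gcongr
    have h4 : 1 / ((2 * (m : ℝ) + 1) / (2 * m + 2) * (Real.pi / 2) * (2 * m + 1))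
        - 1 / (Real.pi * (m + 1)) = (4 * m + 3) / (Real.pi * (2 * m + 1) ^ 2 * (m + 1)) := by
      field_simp
      ring
    have h5 : (4 * (m : ℝ) + 3) / (Real.pi * (2 * m + 1) ^ 2 * (m + 1)) ≤ 2 / (m + 1) ^ 2 := by
      rw [div_le_div_iff₀ (by positivity) (by positivity)]
      have h6 : 3 * ((2 * (m : ℝ) + 1) ^ 2 * (m + 1)) ≤ Real.pi * (2 * m + 1) ^ 2 * (m + 1) := by
        rw [← mul_assoc]; gcongr
      have hm : (0 : ℝ) ≤ m := Nat.cast_nonneg m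
      nlinarith [mul_nonneg hm hm, mul_nonneg hm (mul_nonneg hm hm)]
    rw [hv2]
    linarith
  have hle : v ≤ c := le_of_sq_le_sq hlo hc.le
  rw [abs_of_nonneg (by linarith)]
  refine le_of_sq_le_sq ?_ (by positivity)
  have h7 : (c - v) ^ 2 ≤ c ^ 2 - v ^ 2 := by nlinarith
  refine (h7.trans hhi).trans ?_
  rw [div_pow]
  gcongr
  norm_num

theorem binomCoeff_half (m : ℕ) :
    binomCoeff (1 / 2) m * (2 * m - 1) = -centralRatio m := by
  induction m with
  | zero => simp [binomCoeff, centralRatio]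
  | succ m ih =>
    rw [binomCoeff, centralRatio, ← neg_mul, ← ih]
    push_cast
    field_simp
    ring

theorem abs_two_mul_sub_one (m : ℕ) : ((m : ℝ) + 1) / 2 ≤ |2 * (m : ℝ) - 1| := by
  rcases m with _ | m
  · norm_num
  · push_cast
    rw [abs_of_nonneg (by linarith [(Nat.cast_nonneg m : (0 : ℝ) ≤ m)])]
    linarith [(Nat.cast_nonneg m : (0 : ℝ) ≤ m)]

theorem two_mul_sub_one_ne_zero (m : ℕ) : 2 * (m : ℝ) - 1 ≠ 0 := by
  have h := abs_two_mul_sub_one m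
  intro h0
  rw [h0, abs_zero] at h
  have : (0 : ℝ) < ((m : ℝ) + 1) / 2 := by positivity
  linarith

theorem abs_binomCoeff_half_le (m : ℕ) : |binomCoeff (1 / 2) m| ≤ 2 / (m + 1) := by
  have h : binomCoeff (1 / 2) m = -centralRatio m / (2 * m - 1) :=
    eq_div_of_mul_eq (two_mul_sub_one_ne_zero m) (binomCoeff_half m)
  rw [h, abs_div, abs_neg, abs_of_pos (centralRatio_pos m)]
  calc centralRatio m / |2 * (m : ℝ) - 1| ≤ 1 / (((m : ℝ) + 1) / 2) := by
        gcongr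
        · exact centralRatio_le_one m
        · exact abs_two_mul_sub_one m
    _ = 2 / (m + 1) := by field_simp

/-- The Taylor coefficients of `(1 - w)^{1/2}` are `-m^{-3/2} / (2 √π)` to leading order. -/
theorem binomCoeff_half_approx (m : ℕ) :
    |binomCoeff (1 / 2) m + (2 * Real.sqrt Real.pi)⁻¹ * ((m + 1) * Real.sqrt (m + 1))⁻¹|
      ≤ 7 / (m + 1) ^ 2 := by
  have hne := two_mul_sub_one_ne_zero m
  have hab := abs_two_mul_sub_one m
  have hb : binomCoeff (1 / 2) m = -centralRatio m / (2 * m - 1) :=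
    eq_div_of_mul_eq hne (binomCoeff_half m)
  have happ := centralRatio_approx m
  have hpi := Real.pi_pos
  have hs : 1 ≤ Real.sqrt Real.pi := Real.one_le_sqrt.mpr (by linarith [Real.pi_gt_three])
  have hs1 : 1 ≤ Real.sqrt ((m : ℝ) + 1) :=
    Real.one_le_sqrt.mpr (by linarith [(Nat.cast_nonneg m : (0 : ℝ) ≤ m)])
  set v := (Real.sqrt Real.pi * Real.sqrt (m + 1))⁻¹ with hv
  have hv0 : 0 < v := by positivity
  have hv1 : v ≤ 1 := inv_le_one_of_one_le₀ (by nlinarith)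
  have hm : (0 : ℝ) < (m : ℝ) + 1 := by positivity
  have e : binomCoeff (1 / 2) m + (2 * Real.sqrt Real.pi)⁻¹ * ((m + 1) * Real.sqrt (m + 1))⁻¹
      = -((centralRatio m - v) / (2 * m - 1)) - 3 * v / ((2 * m - 1) * (2 * (m + 1))) := by
    have e2 : (2 * Real.sqrt Real.pi)⁻¹ * (((m : ℝ) + 1) * Real.sqrt (m + 1))⁻¹
        = v / (2 * (m + 1)) := by
      rw [hv]; field_simp
    rw [e2, hb]
    field_simp
    ring
  rw [e]
  have t1 : |(centralRatio m - v) / (2 * m - 1)| ≤ 4 / (m + 1) ^ 2 := by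
    rw [abs_div]
    calc _ ≤ (2 / ((m : ℝ) + 1)) / (((m : ℝ) + 1) / 2) := by gcongr
      _ = 4 / (m + 1) ^ 2 := by field_simp; norm_num
  have t2 : |3 * v / ((2 * m - 1) * (2 * (m + 1)))| ≤ 3 / (m + 1) ^ 2 := by
    rw [abs_div, abs_mul (2 * (m : ℝ) - 1), abs_of_pos (by positivity : 0 < 2 * ((m : ℝ) + 1)),
      abs_of_pos (by positivity : 0 < 3 * v)]
    calc _ ≤ 3 * 1 / ((((m : ℝ) + 1) / 2) * (2 * (m + 1))) := by gcongr
      _ = 3 / (m + 1) ^ 2 := by field_simp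
  calc _ ≤ |-((centralRatio m - v) / (2 * m - 1))| + |3 * v / ((2 * m - 1) * (2 * (m + 1)))| :=
        abs_sub _ _
    _ ≤ 4 / (m + 1) ^ 2 + 3 / (m + 1) ^ 2 := by rw [abs_neg]; gcongr
    _ = 7 / (m + 1) ^ 2 := by ring

theorem binomCoeff_three_halves (m : ℕ) :
    binomCoeff (3 / 2) m * (3 - 2 * m) = 3 * binomCoeff (1 / 2) m := by
  induction m with
  | zero => simp [binomCoeff]
  | succ m ih =>
    have : binomCoeff (3 / 2) (m + 1) * (3 - 2 * ((m + 1 : ℕ) : ℝ))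
        = (binomCoeff (3 / 2) m * (3 - 2 * m)) * ((m - 1 / 2) / (m + 1)) := by
      rw [binomCoeff]; push_cast; ring
    rw [this, ih, binomCoeff]
    ring

theorem abs_binomCoeff_three_halves_le (m : ℕ) : |binomCoeff (3 / 2) m| ≤ 18 / (m + 1) ^ 2 := by
  have h3 : ((m : ℝ) + 1) / 3 ≤ |3 - 2 * (m : ℝ)| := by
    rcases m with _ | _ | m
    · norm_num
    · norm_num
    · push_cast
      have : (0 : ℝ) ≤ m := Nat.cast_nonneg m
      rw [abs_of_nonpos (by linarith)]
      linarith
  have h := congrArg abs (binomCoeff_three_halves m)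
  rw [abs_mul, abs_mul, abs_of_pos (by norm_num : (0 : ℝ) < 3)] at h
  have h1 := abs_binomCoeff_half_le m
  have h2 : |binomCoeff (3 / 2) m| * (((m : ℝ) + 1) / 3) ≤ 3 * (2 / (m + 1)) := by
    calc _ ≤ |binomCoeff (3 / 2) m| * |3 - 2 * (m : ℝ)| := by gcongr
      _ ≤ _ := by rw [h]; gcongr
  rw [← le_div_iff₀ (by positivity)] at h2
  refine h2.trans (le_of_eq ?_)
  field_simp
  norm_num

/-! ### Taylor coefficients and Cauchy estimates -/

theorem hasFPowerSeriesAt_of_hasSum {f : ℂ → ℂ} {c : ℕ → ℂ}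
    (h : ∀ᶠ z in 𝓝 (0 : ℂ), HasSum (fun m => c m * z ^ m) (f z)) :
    HasFPowerSeriesAt f (FormalMultilinearSeries.ofScalars ℂ c) 0 := by
  rw [hasFPowerSeriesAt_iff]
  filter_upwards [h] with z hz
  simpa only [zero_add, FormalMultilinearSeries.coeff_ofScalars, smul_eq_mul, mul_comm] using hz

theorem eq_of_eventually_hasSum {f : ℂ → ℂ} {c c' : ℕ → ℂ}
    (h : ∀ᶠ z in 𝓝 (0 : ℂ), HasSum (fun m => c m * z ^ m) (f z))
    (h' : ∀ᶠ z in 𝓝 (0 : ℂ), HasSum (fun m => c' m * z ^ m) (f z)) : c = c' := by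
  have e := (hasFPowerSeriesAt_of_hasSum h).eq_formalMultilinearSeries
    (hasFPowerSeriesAt_of_hasSum h')
  ext m
  have := congrArg (fun p => FormalMultilinearSeries.coeff p m) e
  simpa [FormalMultilinearSeries.coeff_ofScalars] using this

theorem exists_hasSum_of_analyticAt {f : ℂ → ℂ} (h : AnalyticAt ℂ f 0) :
    ∃ c : ℕ → ℂ, ∀ᶠ z in 𝓝 (0 : ℂ), HasSum (fun m => c m * z ^ m) (f z) := by
  obtain ⟨p, hp⟩ := h
  refine ⟨p.coeff, ?_⟩
  rw [hasFPowerSeriesAt_iff] at hp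
  filter_upwards [hp] with z hz
  simpa only [zero_add, smul_eq_mul, mul_comm] using hz

theorem coeff_eq_iteratedDeriv {f : ℂ → ℂ} {c : ℕ → ℂ}
    (h : ∀ᶠ z in 𝓝 (0 : ℂ), HasSum (fun m => c m * z ^ m) (f z)) (m : ℕ) :
    c m = iteratedDeriv m f 0 / m.factorial := by
  have hf := hasFPowerSeriesAt_of_hasSum h
  have e := hf.eq_formalMultilinearSeries hf.analyticAt.hasFPowerSeriesAt
  have := congrArg (fun p => FormalMultilinearSeries.coeff p m) e
  simpa [FormalMultilinearSeries.coeff_ofScalars] using this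

theorem norm_coeff_le {f : ℂ → ℂ} {c : ℕ → ℂ}
    (h : ∀ᶠ z in 𝓝 (0 : ℂ), HasSum (fun m => c m * z ^ m) (f z)) {C : ℝ}
    (hd : ∀ z : ℂ, ‖z‖ ≤ 1 → AnalyticAt ℂ f z) (hC : ∀ z : ℂ, ‖z‖ ≤ 1 → ‖f z‖ ≤ C) (m : ℕ) :
    ‖c m‖ ≤ C := by
  have hdc : DiffContOnCl ℂ f (Metric.ball 0 1) := by
    refine DifferentiableOn.diffContOnCl fun z hz => ?_
    rw [closure_ball _ one_ne_zero] at hz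
    exact (hd z (by simpa using hz)).differentiableAt.differentiableWithinAt
  have hb := Complex.norm_iteratedDeriv_le_of_forall_mem_sphere_norm_le (C := C) m one_pos hdc
    (fun z hz => hC z (by simp at hz; exact hz.le))
  have hm : (0 : ℝ) < m.factorial := by exact_mod_cast m.factorial_pos
  rw [coeff_eq_iteratedDeriv h m, norm_div, Complex.norm_natCast, div_le_iff₀ hm]
  simpa [mul_comm] using hb

/-- A bound for `f''` on the closed unit disk gives decay of order two for the Taylor
coefficients. -/
theorem norm_coeff_le_of_deriv_two {f : ℂ → ℂ} {c : ℕ → ℂ}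
    (h : ∀ᶠ z in 𝓝 (0 : ℂ), HasSum (fun m => c m * z ^ m) (f z)) {C : ℝ}
    (hd : ∀ z : ℂ, ‖z‖ ≤ 1 → AnalyticAt ℂ f z) (hC : ∀ z : ℂ, ‖z‖ ≤ 1 → ‖f z‖ ≤ C)
    (hC2 : ∀ z : ℂ, ‖z‖ ≤ 1 → ‖iteratedDeriv 2 f z‖ ≤ C) (m : ℕ) :
    ‖c m‖ ≤ 6 * C / (m + 1) ^ 2 := by
  have hC0 : 0 ≤ C := (norm_nonneg _).trans (hC 0 (by simp))
  have hsmall := norm_coeff_le h hd hC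
  rcases m with _ | _ | m
  · refine (hsmall 0).trans ?_
    norm_num; linarith
  · refine (hsmall 1).trans ?_
    norm_num; linarith
  · have hd2 : ∀ z : ℂ, ‖z‖ ≤ 1 → AnalyticAt ℂ (iteratedDeriv 2 f) z := fun z hz =>
      iteratedDeriv_eq_iterate (n := 2) (f := f) ▸ (hd z hz).deriv.deriv
    obtain ⟨c2, hc2⟩ := exists_hasSum_of_analyticAt (hd2 0 (by simp))
    have hb := norm_coeff_le hc2 hd2 hC2 m
    rw [coeff_eq_iteratedDeriv hc2 m] at hb
    have e : iteratedDeriv m (iteratedDeriv 2 f) = iteratedDeriv (m + 2) f := by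
      simp only [iteratedDeriv_eq_iterate, Function.iterate_add_apply]
    have hm : (0 : ℝ) < m.factorial := by exact_mod_cast m.factorial_pos
    rw [e, norm_div, Complex.norm_natCast, div_le_iff₀ hm] at hb
    rw [coeff_eq_iteratedDeriv h, norm_div, Complex.norm_natCast]
    have hf : ((m + 1 + 1).factorial : ℝ) = (m + 2) * (m + 1) * m.factorial := by
      rw [Nat.factorial_succ, Nat.factorial_succ]; push_cast; ring
    rw [hf, div_le_iff₀ (by positivity)]
    refine hb.trans ?_
    have h6 : (1 : ℝ) ≤ 6 / (((m + 1 + 1 : ℕ) : ℝ) + 1) ^ 2 * ((m + 2) * (m + 1)) := by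
      push_cast
      rw [div_mul_eq_mul_div, le_div_iff₀ (by positivity)]
      nlinarith [(Nat.cast_nonneg m : (0 : ℝ) ≤ m)]
    calc C * m.factorial = C * m.factorial * 1 := by ring
      _ ≤ C * m.factorial * (6 / (((m + 1 + 1 : ℕ) : ℝ) + 1) ^ 2 * ((m + 2) * (m + 1))) := by
        gcongr
      _ = _ := by ring

/-! ### Powers of a cubic polynomial -/

theorem norm_coeff_pow_le {P : Polynomial ℂ} {Q : Polynomial ℝ}
    (h : ∀ n, ‖P.coeff n‖ ≤ Q.coeff n) (p n : ℕ) : ‖(P ^ p).coeff n‖ ≤ (Q ^ p).coeff n := by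
  induction p generalizing n with
  | zero =>
    simp only [pow_zero, Polynomial.coeff_one]
    split_ifs <;> simp
  | succ p ih =>
    rw [pow_succ, pow_succ, Polynomial.coeff_mul, Polynomial.coeff_mul]
    refine (norm_sum_le _ _).trans (Finset.sum_le_sum fun x _ => ?_)
    rw [norm_mul]
    exact mul_le_mul (ih _) (h _) (norm_nonneg _) ((norm_nonneg _).trans (ih _))

/-- The Taylor polynomial of degree three of `(a₀ + a₁ t + a₂ t² + a₃ t³) ^ p` at `t = 0`, with
bounds read off from the majorant polynomial with coefficients `‖aᵢ‖`. -/
theorem exists_cubic_truncation {a₀ a₁ a₂ a₃ : ℂ} {r A : ℝ} (hr : 0 < r)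
    (hA : ‖a₀‖ + ‖a₁‖ * r + ‖a₂‖ * r ^ 2 + ‖a₃‖ * r ^ 3 ≤ A) (p : ℕ) :
    ∃ c : ℕ → ℂ, c 1 = p * a₀ ^ (p - 1) * a₁ ∧ (∀ n, ‖c n‖ * r ^ n ≤ A ^ p) ∧
      ∀ t : ℂ, ‖t‖ ≤ r → ‖(a₀ + a₁ * t + a₂ * t ^ 2 + a₃ * t ^ 3) ^ p
        - ∑ n ∈ Finset.range 4, c n * t ^ n‖ ≤ A ^ p * (‖t‖ / r) ^ 4 := by
  let P : Polynomial ℂ := Polynomial.C a₀ + Polynomial.C a₁ * Polynomial.X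
    + Polynomial.C a₂ * Polynomial.X ^ 2 + Polynomial.C a₃ * Polynomial.X ^ 3
  let Q : Polynomial ℝ := Polynomial.C ‖a₀‖ + Polynomial.C ‖a₁‖ * Polynomial.X
    + Polynomial.C ‖a₂‖ * Polynomial.X ^ 2 + Polynomial.C ‖a₃‖ * Polynomial.X ^ 3
  have hPQ : ∀ n, ‖P.coeff n‖ ≤ Q.coeff n := by
    intro n
    simp only [P, Q, Polynomial.coeff_add, Polynomial.coeff_C, Polynomial.coeff_C_mul,
      Polynomial.coeff_X, Polynomial.coeff_X_pow]
    refine (norm_add_le _ _).trans (add_le_add ((norm_add_le _ _).trans (add_le_add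
      ((norm_add_le _ _).trans (add_le_add ?_ ?_)) ?_)) ?_) <;> split_ifs <;> simp
  have hPe : ∀ t, P.eval t = a₀ + a₁ * t + a₂ * t ^ 2 + a₃ * t ^ 3 := fun t => by simp [P]
  have hQe : Q.eval r ≤ A := by simpa [Q] using hA
  have hQ0 : 0 ≤ Q.eval r := by simp only [Q, Polynomial.eval_add, Polynomial.eval_mul,
    Polynomial.eval_C, Polynomial.eval_X, Polynomial.eval_pow]; positivity
  have hcoef := norm_coeff_pow_le hPQ p
  obtain ⟨D, hD1, hD2, hD4⟩ : ∃ D, (P ^ p).natDegree < D ∧ (Q ^ p).natDegree < D ∧ 4 ≤ D :=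
    ⟨(P ^ p).natDegree + (Q ^ p).natDegree + 4, by omega, by omega, by omega⟩
  have hsum : ∑ n ∈ Finset.range D, (Q ^ p).coeff n * r ^ n ≤ A ^ p := by
    rw [← Polynomial.eval_eq_sum_range' hD2, Polynomial.eval_pow]
    gcongr
  have hterm : ∀ n, ‖(P ^ p).coeff n‖ * r ^ n ≤ A ^ p := by
    intro n
    by_cases hn : n < D
    · refine le_trans ?_ hsum
      refine le_trans ?_ (Finset.single_le_sum (f := fun n => (Q ^ p).coeff n * r ^ n)
        (fun i _ => mul_nonneg ((norm_nonneg _).trans (hcoef i)) (by positivity))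
        (Finset.mem_range.mpr hn))
      exact mul_le_mul_of_nonneg_right (hcoef n) (by positivity)
    · rw [Polynomial.coeff_eq_zero_of_natDegree_lt (by omega)]
      simp only [norm_zero, zero_mul]
      exact pow_nonneg (hQ0.trans hQe) _
  refine ⟨(P ^ p).coeff, ?_, hterm, ?_⟩
  · have h1 := Polynomial.coeff_derivative (P ^ p) 0
    rw [Polynomial.derivative_pow, Polynomial.coeff_zero_eq_eval_zero] at h1
    simp [P] at h1
    exact h1.symm
  · intro t ht
    rw [← hPe, ← Polynomial.eval_pow, Polynomial.eval_eq_sum_range' hD1,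
      ← Finset.sum_range_add_sum_Ico _ hD4, add_sub_cancel_left]
    have hq : ‖t‖ / r ≤ 1 := (div_le_one hr).mpr ht
    have hq0 : 0 ≤ ‖t‖ / r := by positivity
    calc ‖∑ n ∈ Finset.Ico 4 D, (P ^ p).coeff n * t ^ n‖
        ≤ ∑ n ∈ Finset.Ico 4 D, (Q ^ p).coeff n * r ^ n * (‖t‖ / r) ^ 4 := by
          refine (norm_sum_le _ _).trans (Finset.sum_le_sum fun n hn => ?_)
          rw [norm_mul, norm_pow]
          have e : ‖t‖ ^ n = r ^ n * (‖t‖ / r) ^ n := by rw [← mul_pow]; field_simp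
          rw [e, ← mul_assoc]
          have h0 : 0 ≤ (Q ^ p).coeff n := (norm_nonneg _).trans (hcoef n)
          have h1 : (‖t‖ / r) ^ n ≤ (‖t‖ / r) ^ 4 :=
            pow_le_pow_of_le_one hq0 hq (Finset.mem_Ico.mp hn).1
          gcongr
          exact hcoef n
      _ ≤ (∑ n ∈ Finset.range D, (Q ^ p).coeff n * r ^ n) * (‖t‖ / r) ^ 4 := by
          rw [← Finset.sum_mul]
          refine mul_le_mul_of_nonneg_right (Finset.sum_le_sum_of_subset_of_nonneg ?_
            fun i _ _ => mul_nonneg ((norm_nonneg _).trans (hcoef i)) (by positivity))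
            (by positivity)
          intro i hi
          exact Finset.mem_range.mpr (Finset.mem_Ico.mp hi).2
      _ ≤ A ^ p * (‖t‖ / r) ^ 4 := by gcongr

theorem norm_pow_sub_pow_mul_le {x y : ℂ} {A : ℝ} (hx : ‖x‖ ≤ A) (hy : ‖y‖ ≤ A) (p : ℕ) :
    ‖x ^ p - y ^ p‖ * A ≤ p * A ^ p * ‖x - y‖ := by
  have hA : 0 ≤ A := (norm_nonneg _).trans hx
  induction p with
  | zero => simp
  | succ p ih =>
    have e : x ^ (p + 1) - y ^ (p + 1) = x ^ p * (x - y) + (x ^ p - y ^ p) * y := by ring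
    calc ‖x ^ (p + 1) - y ^ (p + 1)‖ * A
        ≤ (‖x‖ ^ p * ‖x - y‖ + ‖x ^ p - y ^ p‖ * ‖y‖) * A := by
          gcongr
          rw [e, ← norm_pow, ← norm_mul, ← norm_mul]
          exact norm_add_le _ _
      _ ≤ (A ^ p * ‖x - y‖ + ‖x ^ p - y ^ p‖ * A) * A := by gcongr
      _ ≤ (A ^ p * ‖x - y‖ + p * A ^ p * ‖x - y‖) * A := by gcongr
      _ = (p + 1 : ℕ) * A ^ (p + 1) * ‖x - y‖ := by push_cast; ring

/-- If `u = a₀ + a₁ t + a₂ t² + a₃ t³ + O(t⁴)` for small `t`, then the truncation of the `p`-th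
power of the cubic approximates `u ^ p` up to `O(p Aᵖ t⁴)`, for all `t`, as long as `‖u‖ ≤ A`. -/
theorem norm_pow_sub_truncation_le {a₀ a₁ a₂ a₃ : ℂ} {r A C : ℝ} (hr : 0 < r) (hA0 : 0 < A)
    (hC : 0 ≤ C)
    (hA : ‖a₀‖ + ‖a₁‖ * r + ‖a₂‖ * r ^ 2 + ‖a₃‖ * r ^ 3 ≤ A) {p : ℕ} {c : ℕ → ℂ}
    (hc : ∀ n, ‖c n‖ * r ^ n ≤ A ^ p)
    (ht : ∀ t : ℂ, ‖t‖ ≤ r → ‖(a₀ + a₁ * t + a₂ * t ^ 2 + a₃ * t ^ 3) ^ p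
        - ∑ n ∈ Finset.range 4, c n * t ^ n‖ ≤ A ^ p * (‖t‖ / r) ^ 4)
    {u t : ℂ} (hu : ‖u‖ ≤ A)
    (hnear : ‖t‖ < r → ‖u - (a₀ + a₁ * t + a₂ * t ^ 2 + a₃ * t ^ 3)‖ ≤ C * ‖t‖ ^ 4) :
    ‖u ^ p - ∑ n ∈ Finset.range 4, c n * t ^ n‖
      ≤ (5 / r ^ 4 + C / A) * ((p + 1) * A ^ p) * ‖t‖ ^ 4 := by
  have hAp : 0 < A ^ p := pow_pos hA0 p
  have hp : (0 : ℝ) ≤ p := Nat.cast_nonneg p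
  by_cases htr : ‖t‖ < r
  · set y := a₀ + a₁ * t + a₂ * t ^ 2 + a₃ * t ^ 3 with hy
    have hyA : ‖y‖ ≤ A := by
      refine le_trans ?_ hA
      calc ‖y‖ ≤ ‖a₀‖ + ‖a₁ * t‖ + ‖a₂ * t ^ 2‖ + ‖a₃ * t ^ 3‖ := norm_add₄_le
        _ ≤ _ := by
          simp only [norm_mul, norm_pow]
          gcongr
    have h1 := norm_pow_sub_pow_mul_le hu hyA p
    have h2 : ‖u ^ p - y ^ p‖ ≤ p * A ^ p * (C * ‖t‖ ^ 4) / A := by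
      rw [le_div_iff₀ hA0]
      refine h1.trans ?_
      gcongr
      exact hnear htr
    have h3 := ht t htr.le
    calc ‖u ^ p - ∑ n ∈ Finset.range 4, c n * t ^ n‖
        ≤ ‖u ^ p - y ^ p‖ + ‖y ^ p - ∑ n ∈ Finset.range 4, c n * t ^ n‖ :=
          norm_sub_le_norm_sub_add_norm_sub _ _ _
      _ ≤ p * A ^ p * (C * ‖t‖ ^ 4) / A + A ^ p * (‖t‖ / r) ^ 4 := add_le_add h2 h3
      _ = (1 / r ^ 4 * 1 + C / A * p) * A ^ p * ‖t‖ ^ 4 := by rw [div_pow]; ring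
      _ ≤ (5 / r ^ 4 * (p + 1) + C / A * (p + 1)) * A ^ p * ‖t‖ ^ 4 := by
          gcongr
          · norm_num
          · linarith
          · linarith
      _ = _ := by ring
  · have hq : 1 ≤ ‖t‖ / r := (one_le_div hr).mpr (not_lt.mp htr)
    have hn : ∀ n ∈ Finset.range 4, ‖c n * t ^ n‖ ≤ A ^ p * (‖t‖ / r) ^ 4 := by
      intro n hn
      have e : ‖c n * t ^ n‖ = ‖c n‖ * r ^ n * (‖t‖ / r) ^ n := by
        rw [norm_mul, norm_pow, mul_assoc, ← mul_pow]; field_simp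
      rw [e]
      have : (‖t‖ / r) ^ n ≤ (‖t‖ / r) ^ 4 :=
        pow_le_pow_right₀ hq (Finset.mem_range.mp hn).le
      exact mul_le_mul (hc n) this (by positivity) hAp.le
    have h0 : ‖u ^ p‖ ≤ A ^ p * (‖t‖ / r) ^ 4 := by
      rw [norm_pow]
      calc ‖u‖ ^ p ≤ A ^ p * 1 := by rw [mul_one]; gcongr
        _ ≤ _ := by gcongr; exact one_le_pow₀ hq
    calc ‖u ^ p - ∑ n ∈ Finset.range 4, c n * t ^ n‖
        ≤ ‖u ^ p‖ + ∑ n ∈ Finset.range 4, ‖c n * t ^ n‖ :=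
          (norm_sub_le _ _).trans (by gcongr; exact norm_sum_le _ _)
      _ ≤ A ^ p * (‖t‖ / r) ^ 4 + 4 * (A ^ p * (‖t‖ / r) ^ 4) := by
          gcongr
          simpa using Finset.sum_le_sum hn
      _ = (5 / r ^ 4 * 1 + 0) * A ^ p * ‖t‖ ^ 4 := by rw [div_pow]; ring
      _ ≤ (5 / r ^ 4 * (p + 1) + C / A * (p + 1)) * A ^ p * ‖t‖ ^ 4 := by
          gcongr
          · linarith
          · positivity
      _ = _ := by ring

/-! ### Geometry of the indented disk -/

theorem mem_indentedDisk_of_re_lt {ξ w : ℂ} {φ η : ℝ} (hφ : φ ≤ Real.pi)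
    (hw : ‖w‖ < ‖ξ‖ + η) (hne : w ≠ ξ)
    (h : (w / ξ - 1).re < Real.cos φ * ‖w / ξ - 1‖) : w ∈ indentedDisk ξ φ η := by
  refine ⟨hw, hne, ?_⟩
  by_contra! hle
  have h1 := Real.cos_le_cos_of_nonneg_of_le_pi (abs_nonneg _) hφ hle
  rw [Real.cos_abs] at h1
  have h2 : ‖w / ξ - 1‖ * Real.cos (w / ξ - 1).arg = (w / ξ - 1).re := Complex.norm_mul_cos_arg _
  nlinarith [norm_nonneg (w / ξ - 1)]

theorem mem_indentedDisk_of_norm_lt {ξ w : ℂ} {φ η : ℝ} (hφ : φ ≤ Real.pi / 2) (hη : 0 ≤ η)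
    (hw : ‖w‖ < ‖ξ‖) (hφ0 : 0 ≤ φ) : w ∈ indentedDisk ξ φ η := by
  have hξ : 0 < ‖ξ‖ := (norm_nonneg _).trans_lt hw
  refine mem_indentedDisk_of_re_lt (by linarith [Real.pi_pos]) (by linarith)
    (by rintro rfl; exact lt_irrefl _ hw) ?_
  have h1 : (w / ξ).re < 1 := by
    refine (Complex.re_le_norm _).trans_lt ?_
    rw [norm_div]
    exact (div_lt_one hξ).mpr hw
  have h2 : 0 ≤ Real.cos φ := Real.cos_nonneg_of_mem_Icc ⟨by linarith, hφ⟩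
  have h3 : (w / ξ - 1).re < 0 := by simp; linarith
  have := mul_nonneg h2 (norm_nonneg (w / ξ - 1))
  linarith

theorem one_sub_div_mem_slitPlane {ξ w : ℂ} {φ η : ℝ} (hφ : 0 ≤ φ) (h : w ∈ indentedDisk ξ φ η) :
    1 - w / ξ ∈ Complex.slitPlane := by
  have harg := h.2.2
  rw [Complex.mem_slitPlane_iff]
  by_contra! hcon
  have h0 : (w / ξ - 1).arg = 0 := by
    rw [Complex.arg_eq_zero_iff]
    have h1 := hcon.1
    have h2 := hcon.2
    simp only [Complex.sub_re, Complex.one_re, Complex.sub_im, Complex.one_im] at h1 h2 ⊢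
    exact ⟨by linarith, by linarith⟩
  rw [h0, abs_zero] at harg
  linarith

/-- The indented disk contains, around each point `z` of the closed unit disk, a ball of radius
comparable to the distance from `z` to the vertex. -/
theorem ball_subset_indentedDisk {ξ z : ℂ} {φ η r : ℝ} (hφ0 : 0 ≤ φ) (hφ : φ ≤ Real.pi / 2)
    (hξ : 1 < ‖ξ‖) (hξ2 : ‖ξ‖ ≤ 2) (hr : 0 < r) (hr2 : r ≤ 1 / 2) (hrη : 3 * r ≤ η)
    (hrφ : 2 * r ≤ Real.cos φ) (hz : ‖z‖ ≤ 1) :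
    Metric.ball z (r * ‖z - ξ‖) ⊆ indentedDisk ξ φ η := by
  intro w hw
  rw [mem_ball_iff_norm] at hw
  have hξ0 : ξ ≠ 0 := by rintro rfl; simp at hξ; linarith
  have hξn : 0 < ‖ξ‖ := by linarith
  have hd : 0 < ‖z - ξ‖ := by
    rw [norm_pos_iff, sub_ne_zero]; rintro rfl; linarith
  have hd3 : ‖z - ξ‖ ≤ 3 := (norm_sub_le _ _).trans (by linarith)
  have hwξ : (1 - r) * ‖z - ξ‖ < ‖w - ξ‖ := by
    have : ‖z - ξ‖ ≤ ‖w - z‖ + ‖w - ξ‖ := by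
      have := norm_sub_le (w - ξ) (w - z)
      rw [sub_sub_sub_cancel_left] at this
      linarith
    linarith
  refine mem_indentedDisk_of_re_lt (by linarith [Real.pi_pos]) ?_ ?_ ?_
  · have h1 : ‖w‖ ≤ ‖w - z‖ + ‖z‖ := by simpa using norm_add_le (w - z) z
    nlinarith
  · rintro rfl
    rw [sub_self, norm_zero] at hwξ
    nlinarith
  · have e : w / ξ - 1 = (w - ξ) / ξ := by field_simp
    have e2 : (w / ξ - 1).re = (z / ξ).re - 1 + ((w - z) / ξ).re := by
      rw [← Complex.one_re, ← Complex.sub_re, ← Complex.add_re]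
      congr 1
      field_simp
      ring
    have h1 : (z / ξ).re < 1 := by
      refine (Complex.re_le_norm _).trans_lt ?_
      rw [norm_div]
      exact (div_lt_one hξn).mpr (by linarith)
    have h2 : ((w - z) / ξ).re ≤ ‖w - z‖ / ‖ξ‖ := by
      rw [← norm_div]; exact Complex.re_le_norm _
    have h3 : ‖w - z‖ / ‖ξ‖ ≤ Real.cos φ * (‖w - ξ‖ / ‖ξ‖) := by
      rw [← mul_div_assoc]
      gcongr
      have k1 : 2 * r * ‖w - ξ‖ ≤ Real.cos φ * ‖w - ξ‖ := by gcongr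
      have k2 : 2 * r * ((1 - r) * ‖z - ξ‖) ≤ 2 * r * ‖w - ξ‖ := by gcongr
      nlinarith [mul_pos hr hd]
    rw [e2, e, norm_div]
    linarith

/-! ### Transfer of the square-root singularity to the Taylor coefficients -/

theorem norm_one_sub_div {ξ w : ℂ} (hξ : ξ ≠ 0) : ‖1 - w / ξ‖ = ‖w - ξ‖ / ‖ξ‖ := by
  rw [← norm_div, ← norm_neg]
  congr 1
  field_simp
  ring

theorem cpow_half_mul (δ : ℂ) (n : ℕ) : δ ^ ((n / 2 : ℝ) : ℂ) = (δ ^ (1 / 2 : ℂ)) ^ n := by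
  rw [← Complex.cpow_nat_mul]
  congr 1
  push_cast
  ring

theorem norm_cpow_half_sq (δ : ℂ) : ‖δ ^ (1 / 2 : ℂ)‖ ^ 2 = ‖δ‖ := by
  rw [← norm_pow, ← Complex.cpow_nat_mul]
  norm_num

theorem abs_binomCoeff_zero_le (m : ℕ) : |binomCoeff 0 m| ≤ 18 / (m + 1) ^ 2 := by
  have h : ∀ m, binomCoeff 0 (m + 1) = 0 := by
    intro m
    induction m with
    | zero => simp [binomCoeff]
    | succ m ih => rw [binomCoeff, ih, zero_mul]
  rcases m with _ | m
  · simp [binomCoeff]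
  · rw [h]; simp; positivity

theorem abs_binomCoeff_one_le (m : ℕ) : |binomCoeff 1 m| ≤ 18 / (m + 1) ^ 2 := by
  have h : ∀ m, binomCoeff 1 (m + 2) = 0 := by
    intro m
    induction m with
    | zero => simp [binomCoeff]
    | succ m ih => rw [binomCoeff, ih, zero_mul]
  rcases m with _ | _ | m
  · simp [binomCoeff]
  · simp [binomCoeff]; norm_num
  · rw [h]; simp; positivity

/-- On the balls of radius `r ‖z - ξ‖` around points of the closed unit disk, a function bounded
by `M` on the indented disk exceeds its bound on the unit disk only slightly when `r` is small:
a scale-invariant Schwarz estimate. -/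
theorem norm_le_on_ball {F : ℂ → ℂ} {ξ z : ℂ} {φ η M M₀ A r r' : ℝ}
    (hd : DiffContOnCl ℂ F (indentedDisk ξ φ η))
    (hM : ∀ w ∈ indentedDisk ξ φ η, ‖F w‖ ≤ M) (hr : 0 < r) (hr' : r' ≤ r)
    (hA : M₀ + 2 * M * (r' / r) ≤ A)
    (hsub : Metric.ball z (r * ‖z - ξ‖) ⊆ indentedDisk ξ φ η) (hzξ : 0 < ‖z - ξ‖)
    (hz : ‖F z‖ ≤ M₀) {w : ℂ} (hw : w ∈ Metric.ball z (r' * ‖z - ξ‖)) : ‖F w‖ ≤ A := by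
  have hR : 0 < r * ‖z - ξ‖ := by positivity
  have hw' : w ∈ Metric.ball z (r * ‖z - ξ‖) := Metric.ball_subset_ball (by gcongr) hw
  have hzM : ‖F z‖ ≤ M := hM z (hsub (Metric.mem_ball_self hR))
  have hM0 : 0 ≤ M := (norm_nonneg _).trans hzM
  have h := Complex.dist_le_div_mul_dist_of_mapsTo_ball (R₂ := 2 * M)
    (hd.differentiableOn.mono hsub) (fun y hy => by
      rw [mem_closedBall_iff_norm]
      exact (norm_sub_le _ _).trans (by linarith [hM y (hsub hy)])) hw'
  rw [Metric.mem_ball] at hw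
  have h2 : 2 * M / (r * ‖z - ξ‖) * dist w z ≤ 2 * M * (r' / r) := by
    calc _ ≤ 2 * M / (r * ‖z - ξ‖) * (r' * ‖z - ξ‖) := by gcongr
      _ = _ := by field_simp
  rw [dist_eq_norm] at h
  have h3 : ‖F w‖ ≤ ‖F w - F z‖ + ‖F z‖ := by simpa using norm_add_le (F w - F z) (F z)
  linarith

/-- A function analytic near the closed unit disk which is `O(‖z - ξ‖²)` on the balls
`ball z (r ‖z - ξ‖)`, `‖z‖ ≤ 1`, has Taylor coefficients `O(m⁻²)`. -/
theorem norm_coeff_le_of_quadratic_bound {f : ℂ → ℂ} {c : ℕ → ℂ} {ξ : ℂ} {r B : ℝ}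
    (hξ : 1 < ‖ξ‖) (hξ2 : ‖ξ‖ ≤ 2) (hr : 0 < r)
    (h : ∀ᶠ z in 𝓝 (0 : ℂ), HasSum (fun m => c m * z ^ m) (f z))
    (hd : ∀ z : ℂ, ‖z‖ ≤ 1 → DifferentiableOn ℂ f (Metric.ball z (r * ‖z - ξ‖)))
    (hf : ∀ z : ℂ, ‖z‖ ≤ 1 → ∀ w ∈ Metric.ball z (r * ‖z - ξ‖), ‖f w‖ ≤ B * ‖z - ξ‖ ^ 2)
    (m : ℕ) : ‖c m‖ ≤ 6 * ((9 + 8 / r ^ 2) * B) / (m + 1) ^ 2 := by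
  have hpos : ∀ z : ℂ, ‖z‖ ≤ 1 → 0 < ‖z - ξ‖ := fun z hz => by
    rw [norm_pos_iff, sub_ne_zero]; rintro rfl; linarith
  have hB : 0 ≤ B := by
    have h0 := hf 0 (by simp) 0 (Metric.mem_ball_self (mul_pos hr (hpos 0 (by simp))))
    have h1 := hpos 0 (by simp)
    by_contra! hneg
    have := norm_nonneg (f 0)
    nlinarith [pow_pos h1 2]
  refine norm_coeff_le_of_deriv_two h (fun z hz => ?_) (fun z hz => ?_) (fun z hz => ?_) m
  · exact (hd z hz).analyticAt (Metric.ball_mem_nhds _ (mul_pos hr (hpos z hz)))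
  · have h3 : ‖z - ξ‖ ≤ 3 := (norm_sub_le _ _).trans (by linarith)
    calc ‖f z‖ ≤ B * ‖z - ξ‖ ^ 2 := hf z hz z (Metric.mem_ball_self (mul_pos hr (hpos z hz)))
      _ ≤ B * 3 ^ 2 := by gcongr
      _ ≤ (9 + 8 / r ^ 2) * B := by
        have : 0 ≤ 8 / r ^ 2 * B := by positivity
        linarith
  · have hp := hpos z hz
    have hR : 0 < r * ‖z - ξ‖ / 2 := by positivity
    have hcl : Metric.closedBall z (r * ‖z - ξ‖ / 2) ⊆ Metric.ball z (r * ‖z - ξ‖) :=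
      Metric.closedBall_subset_ball (by linarith)
    have hdc : DiffContOnCl ℂ f (Metric.ball z (r * ‖z - ξ‖ / 2)) := by
      refine DifferentiableOn.diffContOnCl ?_
      rw [closure_ball _ hR.ne']
      exact (hd z hz).mono hcl
    have hb := Complex.norm_iteratedDeriv_le_of_forall_mem_sphere_norm_le 2 hR hdc
      (fun w hw => hf z hz w (hcl (Metric.sphere_subset_closedBall hw)))
    refine hb.trans ?_
    have e : (Nat.factorial 2 : ℝ) * (B * ‖z - ξ‖ ^ 2) / (r * ‖z - ξ‖ / 2) ^ 2
        = 8 / r ^ 2 * B := by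
      norm_num [Nat.factorial]
      field_simp
      ring
    rw [e]
    nlinarith

/-- Uniform coefficient asymptotics for powers of a function with a square-root singularity at
`ξ`, where `‖ξ‖ ↓ 1` is allowed and the constant grows only like `p Aᵖ` for any `A` exceeding the
bounds `M₀` on the unit disk and `L₀` of the branch value. -/
theorem exists_transfer_constant {φ η₀ M M₀ L₀ A C₀ : ℝ} (hφ : 0 < φ) (hφ2 : φ < Real.pi / 2)
    (hη : 0 < η₀) (hC : 0 < C₀) (hM₀ : M₀ < A) (hL₀ : L₀ < A) (hA0 : 0 < A) :
    ∃ K : ℝ, 0 < K ∧ ∀ (ξ : ℂ) (F : ℂ → ℂ) (a₀ a₁ a₂ a₃ : ℂ), 1 < ‖ξ‖ → ‖ξ‖ ≤ 2 →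
      DiffContOnCl ℂ F (indentedDisk ξ φ (η₀ / 2)) →
      (∀ w ∈ frontier (indentedDisk ξ φ (η₀ / 2)), ‖F w‖ ≤ M) →
      (∀ z : ℂ, ‖z‖ ≤ 1 → ‖F z‖ ≤ M₀) →
      (∀ w ∈ indentedDisk ξ φ (η₀ / 2), ∀ δ : ℂ, δ = 1 - w / ξ → ‖δ‖ < η₀ →
        ‖F w - (a₀ + a₁ * δ ^ (1 / 2 : ℂ) + a₂ * δ + a₃ * δ ^ (3 / 2 : ℂ))‖ ≤ C₀ * ‖δ‖ ^ 2) →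
      ‖a₀‖ ≤ L₀ → ‖a₁‖ ≤ C₀ → ‖a₂‖ ≤ C₀ → ‖a₃‖ ≤ C₀ →
      ∀ (p : ℕ) (R : ℕ → ℂ), (∀ᶠ z in 𝓝 (0 : ℂ), HasSum (fun m => R m * z ^ m) (F z ^ p)) →
        ∀ m, ‖R m - p * a₀ ^ (p - 1) * a₁ * binomCoeff (1 / 2) m * (ξ⁻¹) ^ m‖
          ≤ K * ((p + 1) * A ^ p) / (m + 1) ^ 2 := by
  -- the radius of the disk in the local variable `t = δ ^ (1 / 2)`
  obtain ⟨ρ, hρ0, hρ1, hρη, hρA⟩ : ∃ ρ : ℝ, 0 < ρ ∧ ρ ≤ 1 ∧ ρ ≤ η₀ ∧ L₀ + 3 * C₀ * ρ ≤ A := by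
    refine ⟨min 1 (min η₀ ((A - L₀) / (3 * C₀))), ?_, min_le_left _ _,
      (min_le_right _ _).trans (min_le_left _ _), ?_⟩
    · have : 0 < A - L₀ := by linarith
      positivity
    · have h : min 1 (min η₀ ((A - L₀) / (3 * C₀))) ≤ (A - L₀) / (3 * C₀) :=
        (min_le_right _ _).trans (min_le_right _ _)
      rw [le_div_iff₀ (by positivity)] at h
      linarith
  have hcos : 0 < Real.cos φ := Real.cos_pos_of_mem_Ioo ⟨by linarith, hφ2⟩
  obtain ⟨r, hr0, hr2, hrη, hrφ⟩ : ∃ r : ℝ, 0 < r ∧ r ≤ 1 / 2 ∧ 3 * r ≤ η₀ / 2 ∧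
      2 * r ≤ Real.cos φ := by
    refine ⟨min (1 / 2) (min (η₀ / 6) (Real.cos φ / 2)), by positivity, min_le_left _ _, ?_, ?_⟩
    · have := (min_le_right (1 / 2) (min (η₀ / 6) (Real.cos φ / 2))).trans (min_le_left _ _)
      linarith
    · have := (min_le_right (1 / 2) (min (η₀ / 6) (Real.cos φ / 2))).trans (min_le_right _ _)
      linarith
  obtain ⟨r', hr'0, hr'r, hr'A⟩ : ∃ r' : ℝ, 0 < r' ∧ r' ≤ r ∧ M₀ + 2 * |M| * (r' / r) ≤ A := by
    have hAM : 0 < A - M₀ := by linarith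
    refine ⟨r * min 1 ((A - M₀) / (2 * |M| + 1)), by positivity, ?_, ?_⟩
    · exact mul_le_of_le_one_right hr0.le (min_le_left _ _)
    · rw [mul_div_cancel_left₀ _ hr0.ne']
      have h1 : min 1 ((A - M₀) / (2 * |M| + 1)) ≤ (A - M₀) / (2 * |M| + 1) := min_le_right _ _
      rw [le_div_iff₀ (by positivity)] at h1
      have h2 : 0 < min 1 ((A - M₀) / (2 * |M| + 1)) := by positivity
      linarith
  set K₀ : ℝ := 5 / ρ ^ 4 + C₀ / A with hK₀
  have hK₀pos : 0 < K₀ := by positivity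
  refine ⟨6 * ((9 + 8 / r' ^ 2) * (4 * K₀)) + 3 * (18 / ρ ^ 3), by positivity, ?_⟩
  intro ξ F a₀ a₁ a₂ a₃ hξ hξ2 hd hfr hM0 hexp ha0 ha1 ha2 ha3 p R hR m
  have hξ0 : ξ ≠ 0 := by rintro rfl; simp at hξ; linarith
  have hξn : 0 < ‖ξ‖ := by linarith
  have hbdd : Bornology.IsBounded (indentedDisk ξ φ (η₀ / 2)) :=
    (Metric.isBounded_ball (x := (0 : ℂ)) (r := ‖ξ‖ + η₀ / 2)).subset
      fun z hz => by simpa using hz.1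
  have hMΩ : ∀ w ∈ indentedDisk ξ φ (η₀ / 2), ‖F w‖ ≤ |M| := fun w hw =>
    (Complex.norm_le_of_forall_mem_frontier_norm_le hbdd hd hfr (subset_closure hw)).trans
      (le_abs_self M)
  have hAsum : ‖a₀‖ + ‖a₁‖ * ρ + ‖a₂‖ * ρ ^ 2 + ‖a₃‖ * ρ ^ 3 ≤ A := by
    have h2 : ρ ^ 2 ≤ ρ := by nlinarith
    have h3 : ρ ^ 3 ≤ ρ := by
      calc ρ ^ 3 = ρ ^ 2 * ρ := by ring
        _ ≤ 1 * ρ := by gcongr; exact pow_le_one₀ hρ0.le hρ1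
        _ = ρ := one_mul ρ
    have : ‖a₀‖ + ‖a₁‖ * ρ + ‖a₂‖ * ρ ^ 2 + ‖a₃‖ * ρ ^ 3 ≤ L₀ + C₀ * ρ + C₀ * ρ + C₀ * ρ := by
      gcongr
    linarith
  obtain ⟨c, hc1, hcb, hct⟩ := exists_cubic_truncation hρ0 hAsum p
  have hAp : 0 < A ^ p := pow_pos hA0 p
  -- subtracting the singular part leaves a remainder of order `δ²`
  set f : ℂ → ℂ := fun w => F w ^ p
    - ∑ n ∈ Finset.range 4, c n * (1 - w / ξ) ^ ((n / 2 : ℝ) : ℂ) with hfdef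
  have hball : ∀ z : ℂ, ‖z‖ ≤ 1 → Metric.ball z (r * ‖z - ξ‖) ⊆ indentedDisk ξ φ (η₀ / 2) :=
    fun z hz => ball_subset_indentedDisk hφ.le hφ2.le hξ hξ2 hr0 hr2 hrη hrφ hz
  have hball' : ∀ z : ℂ, ‖z‖ ≤ 1 → Metric.ball z (r' * ‖z - ξ‖) ⊆ indentedDisk ξ φ (η₀ / 2) :=
    fun z hz => (Metric.ball_subset_ball (by gcongr)).trans (hball z hz)
  have hfd : ∀ z : ℂ, ‖z‖ ≤ 1 → DifferentiableOn ℂ f (Metric.ball z (r' * ‖z - ξ‖)) := by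
    intro z hz
    refine ((hd.differentiableOn.mono (hball' z hz)).pow p).sub
      (DifferentiableOn.fun_sum fun n _ => DifferentiableOn.const_mul ?_ _)
    refine DifferentiableOn.cpow_const (by fun_prop) fun w hw => ?_
    exact one_sub_div_mem_slitPlane hφ.le (hball' z hz hw)
  have hfb : ∀ z : ℂ, ‖z‖ ≤ 1 → ∀ w ∈ Metric.ball z (r' * ‖z - ξ‖),
      ‖f w‖ ≤ 4 * K₀ * ((p + 1) * A ^ p) * ‖z - ξ‖ ^ 2 := by
    intro z hz w hw
    have hzξ : 0 < ‖z - ξ‖ := by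
      rw [norm_pos_iff, sub_ne_zero]; rintro rfl; linarith
    have hwA : ‖F w‖ ≤ A := norm_le_on_ball hd hMΩ hr0 hr'r hr'A (hball z hz) hzξ (hM0 z hz) hw
    have hwΩ := hball' z hz hw
    set δ : ℂ := 1 - w / ξ with hδ
    have hnear : ‖δ ^ (1 / 2 : ℂ)‖ < ρ → ‖F w - (a₀ + a₁ * δ ^ (1 / 2 : ℂ)
        + a₂ * (δ ^ (1 / 2 : ℂ)) ^ 2 + a₃ * (δ ^ (1 / 2 : ℂ)) ^ 3)‖
        ≤ C₀ * ‖δ ^ (1 / 2 : ℂ)‖ ^ 4 := by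
      intro hlt
      have h1 : ‖δ‖ < η₀ := by
        rw [← norm_cpow_half_sq]
        have := norm_nonneg (δ ^ (1 / 2 : ℂ))
        nlinarith
      have h2 := hexp w hwΩ δ hδ h1
      have e2 : (δ ^ (1 / 2 : ℂ)) ^ 2 = δ := by
        rw [← Complex.cpow_nat_mul]; norm_num
      have e3 : (δ ^ (1 / 2 : ℂ)) ^ 3 = δ ^ (3 / 2 : ℂ) := by
        rw [← Complex.cpow_nat_mul]; norm_num
      have e4 : ‖δ ^ (1 / 2 : ℂ)‖ ^ 4 = ‖δ‖ ^ 2 := by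
        rw [← norm_cpow_half_sq δ]; ring
      rw [e2, e3, e4]
      exact h2
    have h1 := norm_pow_sub_truncation_le hρ0 hA0 hC.le hAsum hcb hct hwA hnear
    have e1 : f w = F w ^ p - ∑ n ∈ Finset.range 4, c n * (δ ^ (1 / 2 : ℂ)) ^ n := by
      simp only [hfdef, cpow_half_mul, hδ]
    have e4 : ‖δ ^ (1 / 2 : ℂ)‖ ^ 4 = ‖δ‖ ^ 2 := by
      rw [← norm_cpow_half_sq δ]; ring
    rw [e1]
    refine h1.trans ?_
    rw [e4]
    have hδn : ‖δ‖ ≤ 2 * ‖z - ξ‖ := by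
      rw [hδ, norm_one_sub_div hξ0]
      have h5 : ‖w - ξ‖ / ‖ξ‖ ≤ ‖w - ξ‖ := div_le_self (norm_nonneg _) hξ.le
      rw [mem_ball_iff_norm] at hw
      have h6 : ‖w - ξ‖ ≤ ‖w - z‖ + ‖z - ξ‖ := norm_sub_le_norm_sub_add_norm_sub _ _ _
      have h7 : r' * ‖z - ξ‖ ≤ 1 * ‖z - ξ‖ := by gcongr; linarith
      linarith
    calc (5 / ρ ^ 4 + C₀ / A) * ((p + 1) * A ^ p) * ‖δ‖ ^ 2
        ≤ K₀ * ((p + 1) * A ^ p) * (2 * ‖z - ξ‖) ^ 2 := by rw [hK₀]; gcongr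
      _ = _ := by ring
  have hfs : ∀ᶠ z in 𝓝 (0 : ℂ), HasSum (fun m => (R m - ∑ n ∈ Finset.range 4,
      c n * binomCoeff (n / 2) m * (ξ⁻¹) ^ m) * z ^ m) (f z) := by
    have hlt : ∀ᶠ z in 𝓝 (0 : ℂ), ‖z / ξ‖ < 1 := by
      have : Tendsto (fun z : ℂ => ‖z / ξ‖) (𝓝 0) (𝓝 ‖(0 : ℂ) / ξ‖) :=
        (Continuous.tendsto (by fun_prop) 0)
      rw [zero_div, norm_zero] at this
      exact this.eventually_lt_const one_pos
    filter_upwards [hR, hlt] with z hz hz1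
    have h := hz.sub (hasSum_sum (s := Finset.range 4) fun n _ =>
      (hasSum_one_sub_cpow (n / 2) hz1).mul_left (c n))
    refine h.congr_fun fun m => ?_
    rw [sub_mul, Finset.sum_mul]
    congr 1
    refine Finset.sum_congr rfl fun n _ => ?_
    rw [div_pow z ξ m, inv_pow]
    ring
  have hmain := norm_coeff_le_of_quadratic_bound hξ hξ2 hr'0 hfs hfd hfb m
  have hinv : ‖(ξ⁻¹) ^ m‖ ≤ 1 := by
    rw [norm_pow, norm_inv]
    exact pow_le_one₀ (by positivity) (inv_le_one_of_one_le₀ hξ.le)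
  have hcn : ∀ n : ℕ, n ≤ 3 → ‖c n‖ ≤ A ^ p / ρ ^ 3 := by
    intro n hn
    rw [le_div_iff₀ (by positivity)]
    refine le_trans ?_ (hcb n)
    gcongr ‖c n‖ * ?_
    exact pow_le_pow_of_le_one hρ0.le hρ1 hn
  have hbound : ∀ n : ℕ, n ≤ 3 → |binomCoeff (n / 2) m| ≤ 18 / (m + 1) ^ 2 →
      ‖c n * binomCoeff (n / 2) m * (ξ⁻¹) ^ m‖ ≤ 18 / ρ ^ 3 * A ^ p / (m + 1) ^ 2 := by
    intro n hn hb
    rw [norm_mul, norm_mul, Complex.norm_real, Real.norm_eq_abs]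
    calc _ ≤ A ^ p / ρ ^ 3 * (18 / (m + 1) ^ 2) * 1 := by
          gcongr
          exact hcn n hn
      _ = _ := by ring
  have b0 := hbound 0 (by norm_num) (by simpa using abs_binomCoeff_zero_le m)
  have b2 := hbound 2 (by norm_num) (by simpa using abs_binomCoeff_one_le m)
  have b3 := hbound 3 (by norm_num) (by simpa using abs_binomCoeff_three_halves_le m)
  set T : ℕ → ℂ := fun n => c n * binomCoeff (n / 2) m * (ξ⁻¹) ^ m with hT
  have e : R m - p * a₀ ^ (p - 1) * a₁ * binomCoeff (1 / 2) m * (ξ⁻¹) ^ m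
      = (R m - ∑ n ∈ Finset.range 4, T n) + T 0 + T 2 + T 3 := by
    simp only [Finset.sum_range_succ, Finset.sum_range_zero]
    have : T 1 = p * a₀ ^ (p - 1) * a₁ * binomCoeff (1 / 2) m * (ξ⁻¹) ^ m := by
      simp only [hT, hc1, Nat.cast_one]
    rw [← this]
    ring
  rw [e]
  have hp1 : A ^ p ≤ (p + 1) * A ^ p := by
    have : (0 : ℝ) ≤ p * A ^ p := by positivity
    linarith
  calc _ ≤ ‖R m - ∑ n ∈ Finset.range 4, T n‖ + ‖T 0‖ + ‖T 2‖ + ‖T 3‖ := norm_add₄_le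
    _ ≤ 6 * ((9 + 8 / r' ^ 2) * (4 * K₀ * ((p + 1) * A ^ p))) / (m + 1) ^ 2
        + 18 / ρ ^ 3 * ((p + 1) * A ^ p) / (m + 1) ^ 2
        + 18 / ρ ^ 3 * ((p + 1) * A ^ p) / (m + 1) ^ 2
        + 18 / ρ ^ 3 * ((p + 1) * A ^ p) / (m + 1) ^ 2 := by
      have hb' : 18 / ρ ^ 3 * A ^ p / ((m : ℝ) + 1) ^ 2
          ≤ 18 / ρ ^ 3 * ((p + 1) * A ^ p) / (m + 1) ^ 2 := by gcongr
      exact add_le_add (add_le_add (add_le_add hmain (b0.trans hb')) (b2.trans hb')) (b3.trans hb')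
    _ = _ := by ring

/-! ### Evaluation of the Taylor branch -/

/-- The power series `W` converges absolutely at `x`, with value `y`. -/
def AbsEval (W : PowerSeries ℂ) (x y : ℂ) : Prop :=
  (Summable fun k => ‖PowerSeries.coeff k W * x ^ k‖) ∧
    ∑' k, PowerSeries.coeff k W * x ^ k = y

namespace AbsEval

variable {W W' : PowerSeries ℂ} {x y y' : ℂ}

theorem hasSum (h : AbsEval W x y) : HasSum (fun k => PowerSeries.coeff k W * x ^ k) y :=
  h.2 ▸ h.1.of_norm.hasSum

theorem unique (h : AbsEval W x y) (h' : AbsEval W x y') : y = y' := h.2.symm.trans h'.2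

theorem add (h : AbsEval W x y) (h' : AbsEval W' x y') : AbsEval (W + W') x (y + y') := by
  have e : ∀ k, PowerSeries.coeff k (W + W') * x ^ k
      = PowerSeries.coeff k W * x ^ k + PowerSeries.coeff k W' * x ^ k := fun k => by
    rw [map_add, add_mul]
  refine ⟨?_, ?_⟩
  · simp only [e]
    exact Summable.of_nonneg_of_le (fun k => norm_nonneg _) (fun k => norm_add_le _ _)
      (h.1.add h'.1)
  · simp only [e]
    rw [h.1.of_norm.tsum_add h'.1.of_norm, h.2, h'.2]

theorem mul (h : AbsEval W x y) (h' : AbsEval W' x y') : AbsEval (W * W') x (y * y') := by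
  have e : ∀ k, PowerSeries.coeff k (W * W') * x ^ k
      = ∑ kl ∈ Finset.HasAntidiagonal.antidiagonal k, (PowerSeries.coeff kl.1 W * x ^ kl.1)
        * (PowerSeries.coeff kl.2 W' * x ^ kl.2) := fun k => by
    rw [PowerSeries.coeff_mul, Finset.sum_mul]
    refine Finset.sum_congr rfl fun kl hkl => ?_
    rw [← Finset.HasAntidiagonal.mem_antidiagonal.mp hkl, pow_add]
    ring
  refine ⟨?_, ?_⟩
  · simp only [e]
    exact summable_norm_sum_mul_antidiagonal_of_summable_norm (f := fun k => PowerSeries.coeff k W * x ^ k)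
      (g := fun k => PowerSeries.coeff k W' * x ^ k) h.1 h'.1
  · simp only [e]
    have h1 := tsum_mul_tsum_eq_tsum_sum_antidiagonal_of_summable_norm (f := fun k => PowerSeries.coeff k W * x ^ k)
      (g := fun k => PowerSeries.coeff k W' * x ^ k) h.1 h'.1
    rw [h.2, h'.2] at h1
    exact h1.symm

theorem C_mul_X_pow (a x : ℂ) (n : ℕ) :
    AbsEval (PowerSeries.C a * PowerSeries.X ^ n) x (a * x ^ n) := by
  have e : ∀ k, k ≠ n →
      PowerSeries.coeff k (PowerSeries.C a * PowerSeries.X ^ n) * x ^ k = 0 := fun k hk => by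
    rw [PowerSeries.coeff_C_mul, PowerSeries.coeff_X_pow, if_neg hk]
    simp
  refine ⟨summable_of_ne_finset_zero (s := {n}) fun k hk => ?_, ?_⟩
  · rw [e k (by simpa using hk), norm_zero]
  · rw [tsum_eq_single n e, PowerSeries.coeff_C_mul, PowerSeries.coeff_X_pow, if_pos rfl, mul_one]

theorem one (x : ℂ) : AbsEval 1 x 1 := by simpa using C_mul_X_pow 1 x 0

theorem pow (h : AbsEval W x y) (p : ℕ) : AbsEval (W ^ p) x (y ^ p) := by
  induction p with
  | zero => simpa using one x
  | succ p ih => rw [pow_succ, pow_succ]; exact ih.mul h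

theorem sum {ι : Type*} (s : Finset ι) {W : ι → PowerSeries ℂ} {y : ι → ℂ}
    (h : ∀ i ∈ s, AbsEval (W i) x (y i)) : AbsEval (∑ i ∈ s, W i) x (∑ i ∈ s, y i) := by
  classical
  induction s using Finset.induction_on with
  | empty => simpa using C_mul_X_pow 0 x 0
  | insert i s hi ih =>
    rw [Finset.sum_insert hi, Finset.sum_insert hi]
    exact (h i (Finset.mem_insert_self i s)).add
      (ih fun j hj => h j (Finset.mem_insert_of_mem hj))

end AbsEval

theorem absEval_branchU {N : ℕ} (e : Fin N → ℕ) (ζ : Fin N → ℂ) {x : ℂ}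
    (hx : ‖x‖ₑ < rhoStar e ζ) : AbsEval (taylorSeries e ζ) x (branchU e ζ x) := by
  refine ⟨?_, rfl⟩
  have h := FormalMultilinearSeries.summable_norm_apply
    (FormalMultilinearSeries.ofScalars ℂ fun k => PowerSeries.coeff k (taylorSeries e ζ)) (x := x)
    (by simpa [rhoStar] using hx)
  simpa [FormalMultilinearSeries.ofScalars_apply_eq, mul_comm] using h

theorem charF_branchU {N : ℕ} {e : Fin N → ℕ} (he : ∀ n, 1 ≤ e n) (ζ : Fin N → ℂ) {x : ℂ}
    (hx : ‖x‖ₑ < rhoStar e ζ) : charF e ζ (branchU e ζ x) x = 0 := by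
  have h := absEval_branchU e ζ hx
  have h2 : AbsEval (taylorSeries e ζ) x (1 + ∑ n, ζ n * x ^ e n * branchU e ζ x ^ e n) := by
    have h3 := (AbsEval.one x).add (AbsEval.sum Finset.univ fun n _ =>
      (AbsEval.C_mul_X_pow (ζ n) x (e n)).mul (h.pow (e n)))
    rwa [← taylorSeries_eq e he ζ] at h3
  have h4 := h.unique h2
  unfold charF
  linear_combination h4

theorem enorm_lt_enorm_iff {x y : ℂ} : ‖x‖ₑ < ‖y‖ₑ ↔ ‖x‖ < ‖y‖ := by
  rw [enorm_eq_nnnorm, enorm_eq_nnnorm, ENNReal.coe_lt_coe, ← NNReal.coe_lt_coe]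
  rfl

theorem analyticOnNhd_branchU {N : ℕ} (e : Fin N → ℕ) (ζ : Fin N → ℂ) {xs : ℂ} (hxs : 0 < ‖xs‖)
    (h : ‖xs‖ₑ = rhoStar e ζ) : AnalyticOnNhd ℂ (branchU e ζ) (Metric.ball 0 ‖xs‖) := by
  set p := FormalMultilinearSeries.ofScalars ℂ fun k => PowerSeries.coeff k (taylorSeries e ζ)
    with hp
  have hrad : p.radius = ‖xs‖ₑ := h.symm
  have hpos : 0 < p.radius := by rw [hrad]; simpa using hxs
  have h1 := (p.hasFPowerSeriesOnBall hpos).analyticOnNhd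
  have e1 : p.sum = branchU e ζ := by
    ext x
    simp [FormalMultilinearSeries.sum, hp, branchU, mul_comm]
  rw [e1, hrad] at h1
  refine h1.mono fun x hx => ?_
  rw [mem_ball_zero_iff] at hx
  simpa using enorm_lt_enorm_iff.mpr hx

/-! ### The branch in the variable `z = x ^ s` -/

theorem branchU_eq_of_eventually {N : ℕ} {e : Fin N → ℕ} {ζ : Fin N → ℂ} {xs : ℂ} {F : ℂ → ℂ}
    (hs : 1 ≤ symIndex e) (hxs : 0 < ‖xs‖) (h : ‖xs‖ₑ = rhoStar e ζ)
    (hF : DifferentiableOn ℂ F (Metric.ball 0 (‖xs‖ ^ symIndex e)))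
    (hrep : ∀ᶠ x in 𝓝 (0 : ℂ), F (x ^ symIndex e) = branchU e ζ x) {x : ℂ} (hx : ‖x‖ < ‖xs‖) :
    F (x ^ symIndex e) = branchU e ζ x := by
  have h1 : AnalyticOnNhd ℂ (fun x => F (x ^ symIndex e)) (Metric.ball 0 ‖xs‖) := by
    have hd : DifferentiableOn ℂ (fun x => F (x ^ symIndex e)) (Metric.ball 0 ‖xs‖) := by
      refine hF.comp (by fun_prop) fun x hx => ?_
      rw [mem_ball_zero_iff] at hx ⊢
      rw [norm_pow]
      exact pow_lt_pow_left₀ hx (norm_nonneg _) (by omega)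
    exact hd.analyticOnNhd Metric.isOpen_ball
  exact h1.eqOn_of_preconnected_of_eventuallyEq (analyticOnNhd_branchU e ζ hxs h)
    (convex_ball (0 : ℂ) ‖xs‖).isPreconnected (Metric.mem_ball_self hxs) hrep
    (mem_ball_zero_iff.mpr hx)

/-- The Taylor coefficients of the `p`-th power of the branch in the variable `z = x ^ s` are the
numbers `R_p(m)`. -/
theorem hasSum_coeffR {N : ℕ} {e : Fin N → ℕ} {ζ : Fin N → ℂ} {F : ℂ → ℂ}
    (hs : 1 ≤ symIndex e) (hpos : 0 < rhoStar e ζ) (hF : AnalyticAt ℂ F 0)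
    (hrep : ∀ᶠ x in 𝓝 (0 : ℂ), F (x ^ symIndex e) = branchU e ζ x) (p : ℕ) :
    ∀ᶠ z in 𝓝 (0 : ℂ), HasSum (fun m => coeffR e ζ p m * z ^ m) (F z ^ p) := by
  set s := symIndex e with hsdef
  obtain ⟨B, hB⟩ := exists_hasSum_of_analyticAt (hF.pow p)
  have htend : Tendsto (fun x : ℂ => x ^ s) (𝓝 0) (𝓝 0) := by
    have : Tendsto (fun x : ℂ => x ^ s) (𝓝 0) (𝓝 (0 ^ s)) := (continuous_pow s).tendsto 0
    rwa [zero_pow (by omega)] at this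
  have h1 : ∀ᶠ x in 𝓝 (0 : ℂ),
      HasSum (fun k => (if s ∣ k then B (k / s) else 0) * x ^ k) (branchU e ζ x ^ p) := by
    filter_upwards [htend.eventually hB, hrep] with x hx hx2
    rw [← hx2]
    have hinj : Function.Injective fun m : ℕ => s * m := fun a b hab =>
      Nat.eq_of_mul_eq_mul_left (by omega) hab
    refine (hinj.hasSum_iff ?_).mp ?_
    · intro k hk
      rw [if_neg, zero_mul]
      rintro ⟨m, rfl⟩
      exact hk ⟨m, rfl⟩
    · refine hx.congr_fun fun m => ?_
      simp only [Function.comp]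
      rw [if_pos (dvd_mul_right s m), Nat.mul_div_cancel_left _ (by omega), pow_mul]
  have h2 : ∀ᶠ x in 𝓝 (0 : ℂ),
      HasSum (fun k => PowerSeries.coeff k (taylorSeries e ζ ^ p) * x ^ k)
        (branchU e ζ x ^ p) := by
    have hlt : ∀ᶠ x in 𝓝 (0 : ℂ), ‖x‖ₑ < rhoStar e ζ := by
      have : Tendsto (fun x : ℂ => ‖x‖ₑ) (𝓝 0) (𝓝 ‖(0 : ℂ)‖ₑ) := continuous_enorm.tendsto 0
      rw [enorm_zero] at this
      exact this.eventually_lt_const hpos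
    filter_upwards [hlt] with x hx
    exact ((absEval_branchU e ζ hx).pow p).hasSum
  have h3 := eq_of_eventually_hasSum h1 h2
  have h4 : B = coeffR e ζ p := by
    ext m
    have := congrFun h3 (m * s)
    rw [if_pos (dvd_mul_left s m), Nat.mul_div_cancel _ (by omega)] at this
    exact this
  rwa [h4] at hB

/-- A bound for the branch on the circle of radius `ρ > 1` holds for `F` on the unit disk. -/
theorem norm_le_of_branchU_bound {N : ℕ} {e : Fin N → ℕ} {ζ : Fin N → ℂ} {xs : ℂ} {F : ℂ → ℂ}
    {ρ M₀ : ℝ} (hs : 1 ≤ symIndex e) (hxs : 0 < ‖xs‖) (h : ‖xs‖ₑ = rhoStar e ζ)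
    (hF : DifferentiableOn ℂ F (Metric.ball 0 (‖xs‖ ^ symIndex e)))
    (hrep : ∀ᶠ x in 𝓝 (0 : ℂ), F (x ^ symIndex e) = branchU e ζ x)
    (hρ : 1 < ρ) (hρxs : ρ < ‖xs‖) (hM : ∀ x : ℂ, ‖x‖ = ρ → ‖branchU e ζ x‖ ≤ M₀) {z : ℂ}
    (hz : ‖z‖ ≤ 1) : ‖F z‖ ≤ M₀ := by
  obtain ⟨x, rfl⟩ := IsAlgClosed.exists_pow_nat_eq z (n := symIndex e) (by omega)
  have hx : ‖x‖ ≤ 1 := by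
    rw [norm_pow] at hz
    by_contra! hlt
    exact absurd hz (not_le.mpr (one_lt_pow₀ hlt (by omega)))
  rw [branchU_eq_of_eventually hs hxs h hF hrep (by linarith)]
  have han := analyticOnNhd_branchU e ζ hxs h
  have hρ0 : ρ ≠ 0 := by linarith
  have hdc : DiffContOnCl ℂ (branchU e ζ) (Metric.ball 0 ρ) := by
    refine DifferentiableOn.diffContOnCl ?_
    rw [closure_ball _ hρ0]
    exact han.differentiableOn.mono (Metric.closedBall_subset_ball hρxs)
  refine Complex.norm_le_of_forall_mem_frontier_norm_le Metric.isBounded_ball hdc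
    (fun y hy => ?_) (subset_closure ?_)
  · rw [frontier_ball _ hρ0] at hy
    exact hM y (by simpa using hy)
  · rw [mem_ball_zero_iff]; linarith

/-! ### Uniform data along a transversal path -/

/-- The estimates at one point of the path: `F` is the branch in the variable `z = x ^ s`, with
branch point `xs ^ s` outside the closed unit disk and square-root expansion
`lam + kap' δ^{1/2} + c δ + d δ^{3/2} + O(δ²)` there, where `kap' = s^{-1/2} κ`. -/
structure BranchData {N : ℕ} (e : Fin N → ℕ) (ζ : Fin N → ℂ) (xs lam kap' c d : ℂ) (F : ℂ → ℂ)
    (φ η₀ M M₀ L₀ C₀ : ℝ) : Prop where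
  one_lt : 1 < ‖xs‖
  pow_le : ‖xs‖ ^ symIndex e ≤ 2
  radius : ‖xs‖ₑ = rhoStar e ζ
  rep : ∀ᶠ x in 𝓝 (0 : ℂ), F (x ^ symIndex e) = branchU e ζ x
  diff : DiffContOnCl ℂ F (indentedDisk (xs ^ symIndex e) φ (η₀ / 2))
  frontier_le : ∀ z ∈ frontier (indentedDisk (xs ^ symIndex e) φ (η₀ / 2)), ‖F z‖ ≤ M
  disk_le : ∀ z : ℂ, ‖z‖ ≤ 1 → ‖F z‖ ≤ M₀
  expansion : ∀ z ∈ indentedDisk (xs ^ symIndex e) φ (η₀ / 2), ∀ δ : ℂ,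
    δ = 1 - z / xs ^ symIndex e → ‖δ‖ < η₀ →
    ‖F z - (lam + kap' * δ ^ (1 / 2 : ℂ) + c * δ + d * δ ^ (3 / 2 : ℂ))‖ ≤ C₀ * ‖δ‖ ^ 2
  simple : IsSimpleBranchPoint e ζ xs lam
  lam_le : ‖lam‖ ≤ L₀
  kap_le : ‖kap'‖ ≤ C₀
  c_le : ‖c‖ ≤ C₀
  d_le : ‖d‖ ≤ C₀

theorem differentiableOn_ball_of_indentedDisk {F : ℂ → ℂ} {ξ : ℂ} {φ η : ℝ} (hφ0 : 0 ≤ φ)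
    (hφ : φ ≤ Real.pi / 2) (hη : 0 ≤ η) (h : DiffContOnCl ℂ F (indentedDisk ξ φ η)) :
    DifferentiableOn ℂ F (Metric.ball 0 ‖ξ‖) :=
  h.differentiableOn.mono fun _ hz =>
    mem_indentedDisk_of_norm_lt hφ hη (mem_ball_zero_iff.mp hz) hφ0

theorem norm_xs_eq {N : ℕ} {e : Fin N → ℕ} {ζ : ℝ → Fin N → ℂ} {xs lam kap : ℝ → ℂ} {ε₁ : ℝ}
    (hyp : StandingHypotheses e ζ xs lam kap ε₁) {ε : ℝ} (h0 : 0 ≤ ε) (h1 : ε ≤ ε₁) :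
    ‖xs ε‖ₑ = rhoStar e (ζ ε) := by
  rcases h0.eq_or_lt with rfl | h
  · exact hyp.simple_critical.2.1.1
  · exact (hyp.dominant ε h h1).1

theorem toReal_rhoStar {N : ℕ} {e : Fin N → ℕ} {ζ : Fin N → ℂ} {x : ℂ}
    (h : ‖x‖ₑ = rhoStar e ζ) : (rhoStar e ζ).toReal = ‖x‖ := by
  rw [← h]; exact toReal_enorm x

theorem norm_xs_zero {N : ℕ} {e : Fin N → ℕ} {ζ : ℝ → Fin N → ℂ} {xs lam kap : ℝ → ℂ} {ε₁ : ℝ}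
    (hyp : StandingHypotheses e ζ xs lam kap ε₁) : ‖xs 0‖ = 1 := by
  have h1 := norm_xs_eq hyp le_rfl hyp.pos.le
  rw [← toReal_rhoStar h1, hyp.simple_critical.1.1]
  rfl

theorem one_lt_norm_xs {N : ℕ} {e : Fin N → ℕ} {ζ : ℝ → Fin N → ℂ} {xs lam kap : ℝ → ℂ} {ε₁ : ℝ}
    (hyp : StandingHypotheses e ζ xs lam kap ε₁) {ε : ℝ} (h0 : 0 < ε) (h1 : ε ≤ ε₁) :
    1 < ‖xs ε‖ := by
  have h := hyp.subcritical ε h0 h1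
  rw [← norm_xs_eq hyp h0.le h1] at h
  have h2 : ‖(1 : ℂ)‖ₑ < ‖xs ε‖ₑ := by simpa using h
  simpa using enorm_lt_enorm_iff.mp h2

theorem nhdsGT_zero_le {ε₁ : ℝ} (h : 0 < ε₁) : 𝓝[>] (0 : ℝ) ≤ 𝓝[Set.Icc 0 ε₁] 0 := by
  rw [← nhdsWithin_Ioc_eq_nhdsGT h]
  exact nhdsWithin_mono _ Set.Ioc_subset_Icc_self

theorem tendsto_of_contDiffOn {E : Type*} [NormedAddCommGroup E] [NormedSpace ℝ E] {g : ℝ → E}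
    {ε₁ : ℝ} (h0 : 0 < ε₁) (h : ContDiffOn ℝ 1 g (Set.Icc 0 ε₁)) :
    Tendsto g (𝓝[>] 0) (𝓝 (g 0)) :=
  (h.continuousOn 0 ⟨le_rfl, h0.le⟩).mono_left (nhdsGT_zero_le h0)

theorem isBigO_of_contDiffOn {E : Type*} [NormedAddCommGroup E] [NormedSpace ℝ E] {g : ℝ → E}
    {ε₁ : ℝ} (h0 : 0 < ε₁) (h : ContDiffOn ℝ 1 g (Set.Icc 0 ε₁)) :
    (fun ε => g ε - g 0) =O[𝓝[>] 0] fun ε : ℝ => ε := by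
  have hd := (h.differentiableOn (by norm_num) 0 ⟨le_rfl, h0.le⟩).hasFDerivWithinAt
  have := hd.isBigO_sub.mono (nhdsGT_zero_le h0)
  simpa using this

theorem exists_branchData {N : ℕ} {e : Fin N → ℕ} {ζ : ℝ → Fin N → ℂ} {xs lam kap : ℝ → ℂ}
    {ε₁ : ℝ} (hyp : StandingHypotheses e ζ xs lam kap ε₁) {α : ℝ}
    (hα : IsAdmissibleWeight e ζ lam α) (hs : 1 ≤ symIndex e) :
    ∃ (F : ℝ → ℂ → ℂ) (c d : ℝ → ℂ) (ε₀ φ η₀ M M₀ L₀ C₀ c₀ : ℝ),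
      0 < ε₀ ∧ ε₀ ≤ ε₁ ∧ 0 < φ ∧ φ < Real.pi / 2 ∧ 0 < η₀ ∧ 0 < C₀ ∧ 0 < c₀ ∧ M₀ < α ∧ L₀ < α ∧
      0 ≤ L₀ ∧ ∀ ε, 0 < ε → ε < ε₀ →
        BranchData e (ζ ε) (xs ε) (lam ε) (((Real.sqrt (symIndex e))⁻¹ : ℝ) * kap ε) (c ε) (d ε)
          (F ε) φ η₀ M M₀ L₀ C₀ ∧ c₀ ≤ ‖lam ε‖ ∧ c₀ ≤ ‖kap ε‖ ∧ ‖kap ε‖ ≤ C₀ := by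
  obtain ⟨F, c, d, εu, φ, η₀, M, C₀, c₀, hεu, hφ, hφ2, hη, hC, hc, hu⟩ := hyp.uniform
  obtain ⟨εa, M₀, L₀, hεa, hmax, ha⟩ := hα
  have hcont : Tendsto (fun ε => ‖xs ε‖ ^ symIndex e) (𝓝[>] 0) (𝓝 1) := by
    have := ((tendsto_of_contDiffOn hyp.pos hyp.transversal.1).norm).pow (symIndex e)
    rwa [norm_xs_zero hyp, one_pow] at this
  have hev := hcont.eventually_lt_const (by norm_num : (1 : ℝ) < 2)
  obtain ⟨εb, hεb, hb⟩ := mem_nhdsGT_iff_exists_Ioo_subset.mp hev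
  have hεb' : 0 < εb := hεb
  have hε1 := hyp.pos
  have key : ∀ ε, 0 < ε → ε < min (min εu εa) (min εb ε₁) →
      BranchData e (ζ ε) (xs ε) (lam ε) (((Real.sqrt (symIndex e))⁻¹ : ℝ) * kap ε) (c ε) (d ε)
          (F ε) φ η₀ M M₀ L₀ C₀ ∧ c₀ ≤ ‖lam ε‖ ∧ c₀ ≤ ‖kap ε‖ ∧ ‖kap ε‖ ≤ C₀ := by
    intro ε h0 hε
    simp only [lt_min_iff] at hε
    obtain ⟨⟨h1, h2⟩, h3, h4⟩ := hε
    obtain ⟨u1, u2, u3, u4, u5, u6, u7, u8⟩ := hu ε h0 h1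
    obtain ⟨a1, a2⟩ := ha ε h0 h2
    have hone := one_lt_norm_xs hyp h0 h4.le
    have hrad := norm_xs_eq hyp h0.le h4.le
    have hmid : rhoMid e (ζ ε) = (1 + ‖xs ε‖) / 2 := by rw [rhoMid, toReal_rhoStar hrad]
    have n1 := norm_nonneg (lam ε)
    have n2 := norm_nonneg (kap ε)
    have n3 := norm_nonneg (c ε)
    have n4 := norm_nonneg (d ε)
    have hF := differentiableOn_ball_of_indentedDisk hφ.le hφ2.le (by positivity) u2
    rw [norm_pow] at hF
    have hsq : (Real.sqrt (symIndex e))⁻¹ ≤ 1 :=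
      inv_le_one_of_one_le₀ (Real.one_le_sqrt.mpr (by exact_mod_cast hs))
    refine ⟨⟨hone, le_of_lt (hb ⟨h0, h3⟩), hrad, u1, u2, u4, fun z hz => ?_, u5,
      hyp.simple_branch ε h0 h4.le, a2, ?_, by linarith, by linarith⟩, u6, u7, by linarith⟩
    · exact norm_le_of_branchU_bound hs (by linarith) hrad hF u1 (ρ := rhoMid e (ζ ε))
        (by rw [hmid]; linarith) (by rw [hmid]; linarith) a1 hz
    · rw [norm_mul, Complex.norm_real, Real.norm_eq_abs, abs_of_nonneg (by positivity)]
      have := mul_le_of_le_one_left n2 hsq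
      linarith
  refine ⟨F, c, d, min (min εu εa) (min εb ε₁), φ, η₀, M, M₀, L₀, C₀, c₀, by positivity,
    (min_le_right _ _).trans (min_le_right _ _), hφ, hφ2, hη, hC, hc,
    (le_max_left _ _).trans_lt hmax, (le_max_right _ _).trans_lt hmax, ?_, key⟩
  have hpos : 0 < min (min εu εa) (min εb ε₁) := by positivity
  exact (norm_nonneg _).trans (key (min (min εu εa) (min εb ε₁) / 2) (by linarith)
    (by linarith)).1.lam_le

namespace BranchData

variable {N : ℕ} {e : Fin N → ℕ} {ζ : Fin N → ℂ} {xs lam kap' c d : ℂ} {F : ℂ → ℂ}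
  {φ η₀ M M₀ L₀ C₀ : ℝ}

theorem differentiableOn_ball (h : BranchData e ζ xs lam kap' c d F φ η₀ M M₀ L₀ C₀)
    (hφ : 0 < φ) (hφ2 : φ < Real.pi / 2) (hη : 0 < η₀) :
    DifferentiableOn ℂ F (Metric.ball 0 (‖xs‖ ^ symIndex e)) := by
  rw [← norm_pow]
  exact differentiableOn_ball_of_indentedDisk hφ.le hφ2.le (by positivity) h.diff

theorem eq_branchU (h : BranchData e ζ xs lam kap' c d F φ η₀ M M₀ L₀ C₀)
    (hs : 1 ≤ symIndex e) (hφ : 0 < φ) (hφ2 : φ < Real.pi / 2) (hη : 0 < η₀) {x : ℂ}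
    (hx : ‖x‖ < ‖xs‖) : F (x ^ symIndex e) = branchU e ζ x :=
  branchU_eq_of_eventually hs (by linarith [h.one_lt]) h.radius
    (h.differentiableOn_ball hφ hφ2 hη) h.rep hx

theorem rhoStar_pos (h : BranchData e ζ xs lam kap' c d F φ η₀ M M₀ L₀ C₀) :
    0 < rhoStar e ζ := by
  rw [← h.radius]
  have := h.one_lt
  simp only [enorm_pos, ne_eq]
  rintro rfl
  simp at this
  linarith

/-- Cauchy's estimate for the Taylor coefficients of the branch on the unit circle. -/
theorem norm_coeff_taylorSeries_le (h : BranchData e ζ xs lam kap' c d F φ η₀ M M₀ L₀ C₀)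
    (hs : 1 ≤ symIndex e) (hφ : 0 < φ) (hφ2 : φ < Real.pi / 2) (hη : 0 < η₀) (k : ℕ) :
    ‖PowerSeries.coeff k (taylorSeries e ζ)‖ ≤ M₀ := by
  have h1 := h.one_lt
  refine norm_coeff_le (f := branchU e ζ) (c := fun k => PowerSeries.coeff k (taylorSeries e ζ))
    ?_ (fun z hz => ?_) (fun z hz => ?_) k
  · have hlt : ∀ᶠ x in 𝓝 (0 : ℂ), ‖x‖ₑ < rhoStar e ζ := by
      have : Tendsto (fun x : ℂ => ‖x‖ₑ) (𝓝 0) (𝓝 ‖(0 : ℂ)‖ₑ) := continuous_enorm.tendsto 0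
      rw [enorm_zero] at this
      exact this.eventually_lt_const h.rhoStar_pos
    filter_upwards [hlt] with x hx
    exact (absEval_branchU e ζ hx).hasSum
  · exact analyticOnNhd_branchU e ζ (by linarith) h.radius z
      (mem_ball_zero_iff.mpr (by linarith))
  · rw [← h.eq_branchU hs hφ hφ2 hη (by linarith)]
    exact h.disk_le _ (by rw [norm_pow]; exact pow_le_one₀ (norm_nonneg _) hz)

end BranchData

/-! ### Radial values of the branch -/

/-- The value of the branch at the radial point with `1 - z / z_* = δ`. -/
noncomputable def radialValue {N : ℕ} (e : Fin N → ℕ) (ζ : Fin N → ℂ) (xs : ℂ) (δ : ℝ) : ℂ :=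
  branchU e ζ (((1 - δ) ^ (1 / (symIndex e : ℝ)) : ℝ) * xs)

theorem radial_pow {s : ℕ} (hs : 1 ≤ s) {δ : ℝ} (hδ : δ < 1) :
    ((1 - δ) ^ (1 / (s : ℝ))) ^ s = 1 - δ := by
  rw [one_div, Real.rpow_inv_natCast_pow (by linarith) (by omega)]

theorem radial_pos {s : ℕ} {δ : ℝ} (hδ : δ < 1) : 0 < (1 - δ) ^ (1 / (s : ℝ)) :=
  Real.rpow_pos_of_pos (by linarith) _

theorem radial_lt_one {s : ℕ} (hs : 1 ≤ s) {δ : ℝ} (hδ0 : 0 < δ) (hδ : δ < 1) :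
    (1 - δ) ^ (1 / (s : ℝ)) < 1 :=
  Real.rpow_lt_one (by linarith) (by linarith) (by
    have : (0 : ℝ) < s := by exact_mod_cast hs
    positivity)

theorem norm_radial_lt {s : ℕ} (hs : 1 ≤ s) {δ : ℝ} (hδ0 : 0 < δ) (hδ : δ < 1) {xs : ℂ}
    (hxs : 0 < ‖xs‖) : ‖(((1 - δ) ^ (1 / (s : ℝ)) : ℝ) : ℂ) * xs‖ < ‖xs‖ := by
  rw [norm_mul, Complex.norm_real, Real.norm_eq_abs, abs_of_pos (radial_pos hδ)]
  exact mul_lt_of_lt_one_left hxs (radial_lt_one hs hδ0 hδ)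

theorem ofReal_cpow_half {δ : ℝ} (hδ : 0 ≤ δ) : (δ : ℂ) ^ (1 / 2 : ℂ) = (Real.sqrt δ : ℂ) := by
  rw [Real.sqrt_eq_rpow, Complex.ofReal_cpow hδ]
  norm_num

theorem BranchData.radialValue_approx {N : ℕ} {e : Fin N → ℕ} {ζ : Fin N → ℂ}
    {xs lam kap' c d : ℂ} {F : ℂ → ℂ} {φ η₀ M M₀ L₀ C₀ : ℝ}
    (h : BranchData e ζ xs lam kap' c d F φ η₀ M M₀ L₀ C₀)
    (hs : 1 ≤ symIndex e) (hφ : 0 < φ) (hφ2 : φ < Real.pi / 2) (hη : 0 < η₀) (hC : 0 < C₀)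
    {δ : ℝ} (hδ0 : 0 < δ) (hδ1 : δ < 1) (hδη : δ < η₀) :
    ‖radialValue e ζ xs δ - lam - kap' * Real.sqrt δ‖ ≤ 3 * C₀ * δ := by
  have hxs : 0 < ‖xs‖ := by linarith [h.one_lt]
  have hne : xs ^ symIndex e ≠ 0 := pow_ne_zero _ (norm_pos_iff.mp hxs)
  have e1 : radialValue e ζ xs δ = F ((1 - δ : ℝ) * xs ^ symIndex e) := by
    rw [radialValue, ← h.eq_branchU hs hφ hφ2 hη (norm_radial_lt hs hδ0 hδ1 hxs), mul_pow,
      ← Complex.ofReal_pow, radial_pow hs hδ1]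
  have hmem : ((1 - δ : ℝ) : ℂ) * xs ^ symIndex e
      ∈ indentedDisk (xs ^ symIndex e) φ (η₀ / 2) := by
    refine mem_indentedDisk_of_norm_lt hφ2.le (by positivity) ?_ hφ.le
    rw [norm_mul, Complex.norm_real, Real.norm_eq_abs, abs_of_pos (by linarith)]
    exact mul_lt_of_lt_one_left (norm_pos_iff.mpr hne) (by linarith)
  have hδn : ‖(δ : ℂ)‖ = δ := by rw [Complex.norm_real, Real.norm_eq_abs, abs_of_pos hδ0]
  have h1 := h.expansion _ hmem (δ : ℂ) (by rw [mul_div_cancel_right₀ _ hne]; push_cast; ring)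
    (by rwa [hδn])
  rw [← e1, hδn] at h1
  have h3 : ‖(δ : ℂ) ^ (3 / 2 : ℂ)‖ ≤ δ := by
    have e3 : (δ : ℂ) ^ (3 / 2 : ℂ) = ((Real.sqrt δ : ℝ) : ℂ) ^ 3 := by
      rw [← ofReal_cpow_half hδ0.le, ← Complex.cpow_nat_mul]; norm_num
    rw [e3, norm_pow, Complex.norm_real, Real.norm_eq_abs, abs_of_nonneg (Real.sqrt_nonneg _)]
    calc Real.sqrt δ ^ 3 = Real.sqrt δ ^ 2 * Real.sqrt δ := by ring
      _ = δ * Real.sqrt δ := by rw [Real.sq_sqrt hδ0.le]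
      _ ≤ δ * 1 := by gcongr; exact Real.sqrt_le_one.mpr hδ1.le
      _ = δ := mul_one δ
  rw [ofReal_cpow_half hδ0.le] at h1
  have e2 : radialValue e ζ xs δ - lam - kap' * Real.sqrt δ
      = (radialValue e ζ xs δ - (lam + kap' * Real.sqrt δ + c * δ + d * (δ : ℂ) ^ (3 / 2 : ℂ)))
        + c * δ + d * (δ : ℂ) ^ (3 / 2 : ℂ) := by ring
  rw [e2]
  calc _ ≤ C₀ * δ ^ 2 + C₀ * δ + C₀ * δ := by
        refine (norm_add₃_le).trans (add_le_add (add_le_add h1 ?_) ?_)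
        · rw [norm_mul, hδn]; gcongr; exact h.c_le
        · rw [norm_mul]; gcongr; exact h.d_le
    _ ≤ 3 * C₀ * δ := by nlinarith [mul_pos hC hδ0]

theorem continuous_coeff_mul {X : Type*} [TopologicalSpace X] {f g : X → PowerSeries ℂ}
    (hf : ∀ k, Continuous fun x => PowerSeries.coeff k (f x))
    (hg : ∀ k, Continuous fun x => PowerSeries.coeff k (g x)) (k : ℕ) :
    Continuous fun x => PowerSeries.coeff k (f x * g x) := by
  simp only [PowerSeries.coeff_mul]
  exact continuous_finsetSum _ fun i _ => (hf _).mul (hg _)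

/-- The Taylor coefficients of the branch are polynomials in `ζ`. -/
theorem continuous_coeff_taylorSeries {N : ℕ} (e : Fin N → ℕ) (k : ℕ) :
    Continuous fun ζ => PowerSeries.coeff k (taylorSeries e ζ) := by
  have key : ∀ n k, Continuous fun ζ => PowerSeries.coeff k ((inverseStep e ζ)^[n] 1) := by
    intro n
    induction n with
    | zero => intro k; exact continuous_const
    | succ n ih =>
      intro k
      simp only [Function.iterate_succ_apply']
      have hpow : ∀ p k, Continuous fun ζ =>
          PowerSeries.coeff k (((inverseStep e ζ)^[n] 1) ^ p) := by
        intro p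
        induction p with
        | zero => intro k; simp only [pow_zero]; exact continuous_const
        | succ p ihp => intro k; simp only [pow_succ]; exact continuous_coeff_mul ihp ih k
      conv => enter [1, ζ]; rw [inverseStep, map_add, map_sum]
      refine continuous_const.add (continuous_finsetSum _ fun i _ => ?_)
      refine continuous_coeff_mul (fun k => ?_) (hpow (e i)) k
      simp only [PowerSeries.coeff_C_mul]
      fun_prop
  simp only [taylorSeries, PowerSeries.coeff_mk]
  exact key k k

theorem tendsto_radialValue {N : ℕ} {e : Fin N → ℕ} {ζ : ℝ → Fin N → ℂ} {xs lam kap' c d : ℝ → ℂ}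
    {F : ℝ → ℂ → ℂ} {φ η₀ M M₀ L₀ C₀ : ℝ} (hs : 1 ≤ symIndex e) (hφ : 0 < φ)
    (hφ2 : φ < Real.pi / 2) (hη : 0 < η₀)
    (h : ∀ᶠ ε in 𝓝[>] (0 : ℝ), BranchData e (ζ ε) (xs ε) (lam ε) (kap' ε) (c ε) (d ε) (F ε)
      φ η₀ M M₀ L₀ C₀)
    (hζ : Tendsto ζ (𝓝[>] 0) (𝓝 (ζ 0))) (hxs : Tendsto xs (𝓝[>] 0) (𝓝 (xs 0)))
    (hx0 : ‖xs 0‖ = 1) {δ : ℝ} (hδ0 : 0 < δ) (hδ1 : δ < 1) :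
    Tendsto (fun ε => radialValue e (ζ ε) (xs ε) δ) (𝓝[>] 0)
      (𝓝 (radialValue e (ζ 0) (xs 0) δ)) := by
  set r : ℝ := (1 - δ) ^ (1 / (symIndex e : ℝ)) with hr
  have hr1 : r < 1 := radial_lt_one hs hδ0 hδ1
  have hr0 : 0 < r := radial_pos hδ1
  unfold radialValue branchU
  rw [← hr]
  have hx : Tendsto (fun ε => (r : ℂ) * xs ε) (𝓝[>] 0) (𝓝 ((r : ℂ) * xs 0)) := hxs.const_mul _
  have hn : Tendsto (fun ε => ‖(r : ℂ) * xs ε‖) (𝓝[>] 0) (𝓝 r) := by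
    have h1 := hx.norm
    rw [norm_mul, hx0, mul_one, Complex.norm_real, Real.norm_eq_abs, abs_of_pos hr0] at h1
    exact h1
  have hlt := hn.eventually_lt_const (show r < (1 + r) / 2 by linarith)
  refine tendsto_tsum_of_dominated_convergence (bound := fun k => M₀ * ((1 + r) / 2) ^ k)
    ((summable_geometric_of_lt_one (by linarith) (by linarith)).mul_left _) (fun k => ?_) ?_
  · exact ((continuous_coeff_taylorSeries e k).continuousAt.tendsto.comp hζ).mul (hx.pow k)
  · filter_upwards [h, hlt] with ε hε hlt k
    have hM := hε.norm_coeff_taylorSeries_le hs hφ hφ2 hη k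
    rw [norm_mul, norm_pow]
    have : 0 ≤ M₀ := (norm_nonneg _).trans hM
    gcongr

/-! ### Limits of the branch value and of the square-root coefficient -/

theorem tendsto_radial (s : ℕ) :
    Tendsto (fun δ : ℝ => (1 - δ) ^ (1 / (s : ℝ))) (𝓝[>] 0) (𝓝 1) := by
  have h : ContinuousAt (fun δ : ℝ => (1 - δ) ^ (1 / (s : ℝ))) 0 :=
    ContinuousAt.rpow_const (by fun_prop) (Or.inl (by norm_num))
  have h1 := h.tendsto
  simp only [sub_zero, Real.one_rpow] at h1
  exact h1.mono_left nhdsWithin_le_nhds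

theorem tendsto_radialValue_zero {N : ℕ} {e : Fin N → ℕ} {ζ : Fin N → ℂ} {xs lam : ℂ}
    (hs : 1 ≤ symIndex e) (hxs : 0 < ‖xs‖) (hrad : ‖xs‖ₑ = rhoStar e ζ)
    (h : IsSimpleBranchPoint e ζ xs lam) :
    Tendsto (radialValue e ζ xs) (𝓝[>] 0) (𝓝 lam) := by
  refine h.1.comp (tendsto_nhdsWithin_iff.mpr ⟨?_, ?_⟩)
  · have h1 := (Complex.continuous_ofReal.tendsto 1).comp (tendsto_radial (symIndex e))
    simpa using h1.mul_const xs
  · filter_upwards [Ioo_mem_nhdsGT (show (0 : ℝ) < 1 by norm_num)] with δ hδ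
    simp only [analyticDisk, Set.mem_ofPred_eq]
    rw [← hrad, enorm_lt_enorm_iff]
    exact norm_radial_lt hs hδ.1 hδ.2 hxs

section Limits

variable {N : ℕ} {e : Fin N → ℕ} {ζ : ℝ → Fin N → ℂ} {xs lam kap' c d : ℝ → ℂ}
    {F : ℝ → ℂ → ℂ} {φ η₀ M M₀ L₀ C₀ : ℝ}

/-- The branch value is continuous at the critical point: it is uniformly approximated by radial
values inside the disk, which are continuous in the path parameter. -/
theorem tendsto_branchValue (hs : 1 ≤ symIndex e) (hφ : 0 < φ)
    (hφ2 : φ < Real.pi / 2) (hη : 0 < η₀) (hC : 0 < C₀)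
    (h : ∀ᶠ ε in 𝓝[>] (0 : ℝ), BranchData e (ζ ε) (xs ε) (lam ε) (kap' ε) (c ε) (d ε) (F ε)
      φ η₀ M M₀ L₀ C₀)
    (hζ : Tendsto ζ (𝓝[>] 0) (𝓝 (ζ 0))) (hxs : Tendsto xs (𝓝[>] 0) (𝓝 (xs 0)))
    (hx0 : ‖xs 0‖ = 1) (hrad : ‖xs 0‖ₑ = rhoStar e (ζ 0))
    (hsb : IsSimpleBranchPoint e (ζ 0) (xs 0) (lam 0)) :
    Tendsto lam (𝓝[>] 0) (𝓝 (lam 0)) := by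
  rw [Metric.tendsto_nhds]
  intro τ hτ
  have h1 : ∀ᶠ δ in 𝓝[>] (0 : ℝ), dist (radialValue e (ζ 0) (xs 0) δ) (lam 0) < τ / 3 :=
    Metric.tendsto_nhds.mp (tendsto_radialValue_zero hs (by rw [hx0]; norm_num) hrad hsb) _
      (by linarith)
  have h2 : ∀ᶠ δ in 𝓝[>] (0 : ℝ), 3 * C₀ * δ + C₀ * Real.sqrt δ < τ / 3 := by
    have hc : Continuous fun δ : ℝ => 3 * C₀ * δ + C₀ * Real.sqrt δ := by fun_prop
    have ht := hc.tendsto 0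
    simp only [mul_zero, Real.sqrt_zero, add_zero] at ht
    exact (ht.mono_left nhdsWithin_le_nhds).eventually_lt_const (by linarith)
  obtain ⟨δ, hd1, hd2, hδ0, hδm⟩ := (h1.and (h2.and
    (Ioo_mem_nhdsGT (show (0 : ℝ) < min 1 η₀ by positivity)))).exists
  have hδ1 : δ < 1 := hδm.trans_le (min_le_left _ _)
  have hδη : δ < η₀ := hδm.trans_le (min_le_right _ _)
  have h3 := Metric.tendsto_nhds.mp
    (tendsto_radialValue hs hφ hφ2 hη h hζ hxs hx0 hδ0 hδ1) (τ / 3) (by linarith)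
  filter_upwards [h, h3] with ε hε hε3
  have h4 := hε.radialValue_approx hs hφ hφ2 hη hC hδ0 hδ1 hδη
  rw [dist_eq_norm] at *
  set u := radialValue e (ζ ε) (xs ε) δ
  set u0 := radialValue e (ζ 0) (xs 0) δ
  have h5 : ‖kap' ε * Real.sqrt δ‖ ≤ C₀ * Real.sqrt δ := by
    rw [norm_mul, Complex.norm_real, Real.norm_eq_abs, abs_of_nonneg (Real.sqrt_nonneg _)]
    gcongr
    exact hε.kap_le
  have e1 : lam ε - lam 0 = (u - u0) + (u0 - lam 0)
      - (u - lam ε - kap' ε * Real.sqrt δ) - kap' ε * Real.sqrt δ := by ring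
  rw [e1]
  calc _ ≤ ‖u - u0‖ + ‖u0 - lam 0‖ + ‖u - lam ε - kap' ε * Real.sqrt δ‖
        + ‖kap' ε * Real.sqrt δ‖ :=
        (norm_sub_le _ _).trans (by gcongr; exact (norm_sub_le _ _).trans (by
          gcongr; exact norm_add_le _ _))
    _ < τ := by linarith

/-- A function uniformly approximated by functions with a limit has a limit. -/
theorem exists_tendsto_of_approx {f : ℝ → ℂ} {l : Filter ℝ} [l.NeBot]
    (h : ∀ τ > 0, ∃ (g : ℝ → ℂ) (a : ℂ), Tendsto g l (𝓝 a) ∧ ∀ᶠ ε in l, ‖f ε - g ε‖ ≤ τ) :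
    ∃ a, Tendsto f l (𝓝 a) := by
  rw [← cauchy_map_iff_exists_tendsto, Metric.cauchy_iff]
  refine ⟨inferInstance, fun τ hτ => ?_⟩
  obtain ⟨g, a, hg, hfg⟩ := h (τ / 4) (by linarith)
  have hev : ∀ᶠ ε in l, ‖f ε - a‖ < τ / 2 := by
    filter_upwards [hfg, Metric.tendsto_nhds.mp hg (τ / 4) (by linarith)] with ε h1 h2
    rw [dist_eq_norm] at h2
    have := norm_sub_le_norm_sub_add_norm_sub (f ε) (g ε) a
    linarith
  refine ⟨_, image_mem_map hev, ?_⟩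
  rintro _ ⟨ε, hε, rfl⟩ _ ⟨ε', hε', rfl⟩
  have h1 : ‖f ε - a‖ < τ / 2 := hε
  have h2 : ‖f ε' - a‖ < τ / 2 := hε'
  have := dist_triangle_right (f ε) (f ε') a
  rw [dist_eq_norm (f ε) a, dist_eq_norm (f ε') a] at this
  linarith

theorem exists_tendsto_sqrtCoeff (hs : 1 ≤ symIndex e) (hφ : 0 < φ)
    (hφ2 : φ < Real.pi / 2) (hη : 0 < η₀) (hC : 0 < C₀)
    (h : ∀ᶠ ε in 𝓝[>] (0 : ℝ), BranchData e (ζ ε) (xs ε) (lam ε) (kap' ε) (c ε) (d ε) (F ε)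
      φ η₀ M M₀ L₀ C₀)
    (hζ : Tendsto ζ (𝓝[>] 0) (𝓝 (ζ 0))) (hxs : Tendsto xs (𝓝[>] 0) (𝓝 (xs 0)))
    (hx0 : ‖xs 0‖ = 1) (hlam : Tendsto lam (𝓝[>] 0) (𝓝 (lam 0))) :
    ∃ a, Tendsto kap' (𝓝[>] 0) (𝓝 a) := by
  refine exists_tendsto_of_approx fun τ hτ => ?_
  have h2 : ∀ᶠ δ in 𝓝[>] (0 : ℝ), 3 * C₀ * Real.sqrt δ < τ := by
    have hc : Continuous fun δ : ℝ => 3 * C₀ * Real.sqrt δ := by fun_prop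
    have ht := hc.tendsto 0
    simp only [mul_zero, Real.sqrt_zero] at ht
    exact (ht.mono_left nhdsWithin_le_nhds).eventually_lt_const hτ
  obtain ⟨δ, hd2, hδ0, hδm⟩ := (h2.and
    (Ioo_mem_nhdsGT (show (0 : ℝ) < min 1 η₀ by positivity))).exists
  have hδ1 : δ < 1 := hδm.trans_le (min_le_left _ _)
  have hδη : δ < η₀ := hδm.trans_le (min_le_right _ _)
  have hq : 0 < Real.sqrt δ := Real.sqrt_pos.mpr hδ0
  refine ⟨fun ε => (radialValue e (ζ ε) (xs ε) δ - lam ε) / Real.sqrt δ,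
    (radialValue e (ζ 0) (xs 0) δ - lam 0) / Real.sqrt δ,
    ((tendsto_radialValue hs hφ hφ2 hη h hζ hxs hx0 hδ0 hδ1).sub hlam).div_const _, ?_⟩
  filter_upwards [h] with ε hε
  have h4 := hε.radialValue_approx hs hφ hφ2 hη hC hδ0 hδ1 hδη
  have hqc : (Real.sqrt δ : ℂ) ≠ 0 := by exact_mod_cast hq.ne'
  have e1 : kap' ε - (radialValue e (ζ ε) (xs ε) δ - lam ε) / Real.sqrt δ
      = -((radialValue e (ζ ε) (xs ε) δ - lam ε - kap' ε * Real.sqrt δ) / Real.sqrt δ) := by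
    field_simp
    ring
  rw [e1, norm_neg, norm_div, Complex.norm_real, Real.norm_eq_abs, abs_of_pos hq,
    div_le_iff₀ hq]
  refine h4.trans ?_
  calc 3 * C₀ * δ = 3 * C₀ * Real.sqrt δ * Real.sqrt δ := by
        rw [mul_assoc (3 * C₀), Real.mul_self_sqrt hδ0.le]
    _ ≤ τ * Real.sqrt δ := by gcongr

end Limits

/-! ### The branch-point equations -/

/-- `∂_y F`. -/
noncomputable def charFy {N : ℕ} (e : Fin N → ℕ) (q : (Fin N → ℂ) × ℂ × ℂ) : ℂ :=
  1 - ∑ n, q.1 n * q.2.1 ^ e n * (e n * q.2.2 ^ (e n - 1))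

/-- `∂_y² F`. -/
noncomputable def charFyy {N : ℕ} (e : Fin N → ℕ) (q : (Fin N → ℂ) × ℂ × ℂ) : ℂ :=
  -∑ n, q.1 n * q.2.1 ^ e n * (e n * ((e n - 1 : ℕ) * q.2.2 ^ (e n - 1 - 1)))

/-- `-(x ∂_x F) / s = ∑ (sₙ / s) ζₙ xˢⁿ yˢⁿ`. -/
noncomputable def charFx {N : ℕ} (e : Fin N → ℕ) (q : (Fin N → ℂ) × ℂ × ℂ) : ℂ :=
  ∑ n, q.1 n * q.2.1 ^ e n * q.2.2 ^ e n * ((e n / symIndex e : ℕ) : ℂ)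

theorem hasDerivAt_charF {N : ℕ} (e : Fin N → ℕ) (ζ : Fin N → ℂ) (x y : ℂ) :
    HasDerivAt (fun y => charF e ζ y x) (charFy e (ζ, x, y)) y := by
  have h1 : ∀ n, HasDerivAt (fun y : ℂ => ζ n * x ^ e n * y ^ e n)
      (ζ n * x ^ e n * (e n * y ^ (e n - 1))) y := fun n => (hasDerivAt_pow (e n) y).const_mul _
  have h2 := HasDerivAt.fun_sum (u := Finset.univ) fun n _ => h1 n
  exact ((hasDerivAt_id y).sub_const 1).sub h2

theorem hasDerivAt_charFy {N : ℕ} (e : Fin N → ℕ) (ζ : Fin N → ℂ) (x y : ℂ) :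
    HasDerivAt (fun y => charFy e (ζ, x, y)) (charFyy e (ζ, x, y)) y := by
  have h1 : ∀ n, HasDerivAt (fun y : ℂ => ζ n * x ^ e n * (e n * y ^ (e n - 1)))
      (ζ n * x ^ e n * (e n * ((e n - 1 : ℕ) * y ^ (e n - 1 - 1)))) y := fun n =>
    ((hasDerivAt_pow (e n - 1) y).const_mul _).const_mul _
  have h2 := HasDerivAt.fun_sum (u := Finset.univ) fun n _ => h1 n
  exact h2.const_sub 1

theorem charFy_eq_zero_of_simple {N : ℕ} {e : Fin N → ℕ} {ζ : Fin N → ℂ} {xs lam : ℂ}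
    (h : IsSimpleBranchPoint e ζ xs lam) : charFy e (ζ, xs, lam) = 0 := by
  rw [← (hasDerivAt_charF e ζ xs lam).deriv]; exact h.2.2.1

theorem charFyy_ne_zero_of_simple {N : ℕ} {e : Fin N → ℕ} {ζ : Fin N → ℂ}
    {xs lam : ℂ} (h : IsSimpleBranchPoint e ζ xs lam) : charFyy e (ζ, xs, lam) ≠ 0 := by
  have h1 := h.2.2.2
  have e1 : deriv (fun y => charF e ζ y xs) = fun y => charFy e (ζ, xs, y) :=
    funext fun y => (hasDerivAt_charF e ζ xs y).deriv
  rwa [iteratedDeriv_succ, iteratedDeriv_one, e1, (hasDerivAt_charFy e ζ xs lam).deriv] at h1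

/-- The second-order Taylor remainder of a monomial. -/
theorem exists_pow_remainder (a : ℂ) (n : ℕ) :
    ∃ S : ℂ → ℂ, Continuous S ∧ 2 * S a = n * ((n - 1 : ℕ) * a ^ (n - 1 - 1)) ∧
      ∀ y, y ^ n = a ^ n + n * a ^ (n - 1) * (y - a) + (y - a) ^ 2 * S y := by
  induction n with
  | zero => exact ⟨fun _ => 0, continuous_const, by simp, fun y => by simp⟩
  | succ n ih =>
    obtain ⟨S, hS, hSa, hSy⟩ := ih
    refine ⟨fun y => y * S y + n * a ^ (n - 1), by fun_prop, ?_, fun y => ?_⟩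
    · rw [mul_add, mul_left_comm, hSa]
      rcases n with _ | _ | n
      · simp
      · simp
      · simp only [Nat.add_sub_cancel]
        push_cast
        ring
    · rw [pow_succ, hSy y]
      rcases n with _ | n
      · simp
        ring
      · simp only [Nat.add_sub_cancel]
        push_cast
        ring

theorem exists_charF_remainder {N : ℕ} (e : Fin N → ℕ) (ζ : Fin N → ℂ) (x a : ℂ) :
    ∃ S : ℂ → ℂ, Continuous S ∧ 2 * S a = charFyy e (ζ, x, a) ∧
      ∀ y, charF e ζ y x
        = charF e ζ a x + charFy e (ζ, x, a) * (y - a) + (y - a) ^ 2 * S y := by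
  choose S hS hSa hSy using exists_pow_remainder a
  refine ⟨fun y => -∑ n, ζ n * x ^ e n * S (e n) y, by fun_prop, ?_, fun y => ?_⟩
  · simp only [charFyy, mul_neg, Finset.mul_sum]
    congr 1
    refine Finset.sum_congr rfl fun n _ => ?_
    rw [← hSa]; ring
  · have h1 : ∑ n, ζ n * x ^ e n * y ^ e n = ∑ n, ζ n * x ^ e n * a ^ e n
        + (∑ n, ζ n * x ^ e n * (e n * a ^ (e n - 1))) * (y - a)
        + (y - a) ^ 2 * ∑ n, ζ n * x ^ e n * S (e n) y := by
      rw [Finset.sum_mul, Finset.mul_sum, ← Finset.sum_add_distrib, ← Finset.sum_add_distrib]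
      refine Finset.sum_congr rfl fun n _ => ?_
      rw [hSy (e n) y]; ring
    simp only [charF, charFy, h1]
    ring

/-- The square of the square-root coefficient, from the expansion of `F(U(x), x) = 0` to first
order in `δ` along the radius. -/
theorem BranchData.sqrtCoeff_sq {N : ℕ} {e : Fin N → ℕ} {ζ : Fin N → ℂ}
    {xs lam kap' c d : ℂ} {F : ℂ → ℂ} {φ η₀ M M₀ L₀ C₀ : ℝ}
    (h : BranchData e ζ xs lam kap' c d F φ η₀ M M₀ L₀ C₀) (he : ∀ n, 1 ≤ e n)
    (hs : 1 ≤ symIndex e) (hφ : 0 < φ) (hφ2 : φ < Real.pi / 2) (hη : 0 < η₀) (hC : 0 < C₀) :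
    kap' ^ 2 * charFyy e (ζ, xs, lam) + 2 * charFx e (ζ, xs, lam) = 0 := by
  have hxs : 0 < ‖xs‖ := by linarith [h.one_lt]
  set u : ℝ → ℂ := radialValue e ζ xs with hu
  have hulam : Tendsto u (𝓝[>] 0) (𝓝 lam) :=
    tendsto_radialValue_zero hs hxs h.radius h.simple
  have hsmall : ∀ᶠ δ in 𝓝[>] (0 : ℝ), δ ∈ Set.Ioo 0 (min 1 η₀) :=
    Ioo_mem_nhdsGT (show (0 : ℝ) < min 1 η₀ by positivity)
  have hquot : Tendsto (fun δ : ℝ => (u δ - lam) / Real.sqrt δ) (𝓝[>] 0) (𝓝 kap') := by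
    rw [tendsto_iff_norm_sub_tendsto_zero]
    have ht : Tendsto (fun δ : ℝ => 3 * C₀ * Real.sqrt δ) (𝓝[>] 0) (𝓝 0) := by
      have hc : Continuous fun δ : ℝ => 3 * C₀ * Real.sqrt δ := by fun_prop
      have ht := hc.tendsto 0
      simp only [mul_zero, Real.sqrt_zero] at ht
      exact ht.mono_left nhdsWithin_le_nhds
    refine tendsto_of_tendsto_of_tendsto_of_le_of_le' tendsto_const_nhds ht
      (Eventually.of_forall fun _ => norm_nonneg _) ?_
    filter_upwards [hsmall] with δ hδ
    have hq : 0 < Real.sqrt δ := Real.sqrt_pos.mpr hδ.1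
    have hqc : (Real.sqrt δ : ℂ) ≠ 0 := by exact_mod_cast hq.ne'
    have h4 := h.radialValue_approx hs hφ hφ2 hη hC hδ.1 (hδ.2.trans_le (min_le_left _ _))
      (hδ.2.trans_le (min_le_right _ _))
    have e1 : (u δ - lam) / Real.sqrt δ - kap'
        = (u δ - lam - kap' * Real.sqrt δ) / Real.sqrt δ := by field_simp
    rw [e1, norm_div, Complex.norm_real, Real.norm_eq_abs, abs_of_pos hq, div_le_iff₀ hq,
      mul_assoc, Real.mul_self_sqrt hδ.1.le]
    exact h4
  obtain ⟨S, hS, hSa, hSy⟩ := exists_charF_remainder e ζ xs lam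
  rw [h.simple.2.1, charFy_eq_zero_of_simple h.simple] at hSy
  have hslope : ∀ n : ℕ, Tendsto (fun δ : ℝ => ((1 - (1 - δ) ^ n) / δ : ℝ)) (𝓝[>] 0) (𝓝 n) := by
    intro n
    have hd : HasDerivAt (fun δ : ℝ => 1 - (1 - δ) ^ n) n 0 := by
      have := (((hasDerivAt_id (0 : ℝ)).const_sub 1).pow n).const_sub 1
      simpa using this
    have h1 := hd.tendsto_slope.mono_left (nhdsWithin_mono _ (fun x hx => ne_of_gt hx))
    refine h1.congr fun δ => ?_
    simp [slope_def_field]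
  -- the equation `F(U(x), x) = 0` divided by `δ`
  have hzero : ∀ᶠ δ in 𝓝[>] (0 : ℝ), ((u δ - lam) / Real.sqrt δ) ^ 2 * S (u δ)
      + ∑ n, ζ n * xs ^ e n * u δ ^ e n
        * (((1 - (1 - δ) ^ (e n / symIndex e)) / δ : ℝ) : ℂ) = 0 := by
    filter_upwards [hsmall] with δ hδ
    have hδ1 : δ < 1 := hδ.2.trans_le (min_le_left _ _)
    set r : ℝ := (1 - δ) ^ (1 / (symIndex e : ℝ)) with hr
    have hF : charF e ζ (u δ) (r * xs) = 0 := by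
      refine charF_branchU he ζ ?_
      rw [← h.radius, enorm_lt_enorm_iff]
      exact norm_radial_lt hs hδ.1 hδ1 hxs
    have hre : ∀ n, (r : ℂ) ^ e n = (((1 - δ) ^ (e n / symIndex e) : ℝ) : ℂ) := by
      intro n
      have hdvd : symIndex e ∣ e n := Finset.gcd_dvd (Finset.mem_univ n)
      rw [← Complex.ofReal_pow]
      congr 1
      conv_lhs => rw [← Nat.mul_div_cancel' hdvd, pow_mul, hr, radial_pow hs hδ1]
    have e1 : charF e ζ (u δ) (r * xs) = charF e ζ (u δ) xs
        + ∑ n, ζ n * xs ^ e n * u δ ^ e n * (1 - (r : ℂ) ^ e n) := by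
      have : ∑ n, ζ n * xs ^ e n * u δ ^ e n * (1 - (r : ℂ) ^ e n)
          = ∑ n, ζ n * xs ^ e n * u δ ^ e n - ∑ n, ζ n * (r * xs) ^ e n * u δ ^ e n := by
        rw [← Finset.sum_sub_distrib]
        refine Finset.sum_congr rfl fun n _ => ?_
        rw [mul_pow]; ring
      rw [this]
      simp only [charF]
      ring
    rw [hF, hSy] at e1
    have hδc : (δ : ℂ) ≠ 0 := by exact_mod_cast hδ.1.ne'
    have hsq : ((Real.sqrt δ : ℝ) : ℂ) ^ 2 = δ := by
      rw [← Complex.ofReal_pow, Real.sq_sqrt hδ.1.le]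
    have e2 : ∑ n, ζ n * xs ^ e n * u δ ^ e n
        * (((1 - (1 - δ) ^ (e n / symIndex e)) / δ : ℝ) : ℂ)
        = (∑ n, ζ n * xs ^ e n * u δ ^ e n * (1 - (r : ℂ) ^ e n)) / δ := by
      rw [Finset.sum_div]
      refine Finset.sum_congr rfl fun n _ => ?_
      rw [hre n]
      push_cast
      ring
    rw [e2, div_pow, hsq]
    field_simp
    linear_combination -e1
  have hlim := ((hquot.pow 2).mul ((hS.tendsto lam).comp hulam)).add
    (tendsto_finsetSum Finset.univ fun n _ => ((hulam.pow (e n)).const_mul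
      (ζ n * xs ^ e n)).mul ((Complex.continuous_ofReal.tendsto _).comp
        (hslope (e n / symIndex e))))
  have hfin := tendsto_nhds_unique (hlim.congr' hzero) tendsto_const_nhds
  rw [← hSa, charFx]
  simp only [Complex.ofReal_natCast] at hfin
  linear_combination 2 * hfin

/-! ### Linear rates along the path -/

theorem isBigO_comp_of_contDiffAt {E : Type*} [NormedAddCommGroup E] [NormedSpace ℂ E]
    {G : E → ℂ} {p₀ : E} {p q : ℝ → E} {l : Filter ℝ} (hG : ContDiffAt ℂ 1 G p₀)
    (hp : Tendsto p l (𝓝 p₀)) (hq : Tendsto q l (𝓝 p₀))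
    (h : (fun ε => p ε - q ε) =O[l] fun ε : ℝ => ε) :
    (fun ε => G (p ε) - G (q ε)) =O[l] fun ε : ℝ => ε := by
  have h1 := (hG.hasStrictFDerivAt (by norm_num)).isBigO_sub
  have h2 : Tendsto (fun ε => (p ε, q ε)) l (𝓝 (p₀, p₀)) := hp.prodMk_nhds hq
  exact (h1.comp_tendsto h2).trans h

theorem contDiff_charFy {N : ℕ} (e : Fin N → ℕ) : ContDiff ℂ 1 (charFy e) := by
  unfold charFy
  fun_prop

theorem contDiff_charFyy {N : ℕ} (e : Fin N → ℕ) : ContDiff ℂ 1 (charFyy e) := by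
  unfold charFyy
  fun_prop

theorem contDiff_charFx {N : ℕ} (e : Fin N → ℕ) : ContDiff ℂ 1 (charFx e) := by
  unfold charFx
  fun_prop

/-- The branch value depends Lipschitz-continuously on the path parameter at `0`, by the implicit
equation `∂_y F = 0` with `∂_y² F ≠ 0`. -/
theorem isBigO_branchValue {N : ℕ} {e : Fin N → ℕ} {ζ : ℝ → Fin N → ℂ} {xs lam : ℝ → ℂ}
    (hζ : Tendsto ζ (𝓝[>] 0) (𝓝 (ζ 0))) (hxs : Tendsto xs (𝓝[>] 0) (𝓝 (xs 0)))
    (hlam : Tendsto lam (𝓝[>] 0) (𝓝 (lam 0)))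
    (hζ' : (fun ε => ζ ε - ζ 0) =O[𝓝[>] 0] fun ε : ℝ => ε)
    (hxs' : (fun ε => xs ε - xs 0) =O[𝓝[>] 0] fun ε : ℝ => ε)
    (h0 : IsSimpleBranchPoint e (ζ 0) (xs 0) (lam 0))
    (h : ∀ᶠ ε in 𝓝[>] (0 : ℝ), IsSimpleBranchPoint e (ζ ε) (xs ε) (lam ε)) :
    (fun ε => lam ε - lam 0) =O[𝓝[>] 0] fun ε : ℝ => ε := by
  have h1 : (fun ε => charFy e (ζ ε, xs ε, lam ε) - charFy e (ζ 0, xs 0, lam ε))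
      =O[𝓝[>] 0] fun ε : ℝ => ε := by
    refine isBigO_comp_of_contDiffAt (contDiff_charFy e).contDiffAt
      (hζ.prodMk_nhds (hxs.prodMk_nhds hlam))
      (tendsto_const_nhds.prodMk_nhds (tendsto_const_nhds.prodMk_nhds hlam)) ?_
    refine IsBigO.prod_left hζ' (IsBigO.prod_left hxs' ?_)
    simp only [sub_self]
    exact isBigO_zero _ _
  have h2 : (fun ε => charFy e (ζ 0, xs 0, lam ε) - charFy e (ζ 0, xs 0, lam 0))
      =O[𝓝[>] 0] fun ε : ℝ => ε := by
    refine h1.neg_left.congr' ?_ EventuallyEq.rfl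
    filter_upwards [h] with ε hε
    rw [charFy_eq_zero_of_simple hε, charFy_eq_zero_of_simple h0]
    ring
  have h3 := ((hasDerivAt_charFy e (ζ 0) (xs 0) (lam 0)).isTheta_sub
    (charFyy_ne_zero_of_simple h0)).isBigO_symm
  have h4 : Tendsto (fun ε => (lam ε, lam 0)) (𝓝[>] (0 : ℝ)) (𝓝 (lam 0) ×ˢ pure (lam 0)) :=
    hlam.prodMk (tendsto_const_pure)
  exact (h3.comp_tendsto h4).trans h2

theorem isBigO_of_sq {f : ℝ → ℂ} {a : ℂ} {l : Filter ℝ} (ha : a ≠ 0) (hf : Tendsto f l (𝓝 a))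
    (h : (fun ε => f ε ^ 2 - a ^ 2) =O[l] fun ε : ℝ => ε) :
    (fun ε => f ε - a) =O[l] fun ε : ℝ => ε := by
  have h1 : Tendsto (fun ε => (f ε + a)⁻¹) l (𝓝 (a + a)⁻¹) :=
    (hf.add_const a).inv₀ (by rw [← two_mul]; exact mul_ne_zero two_ne_zero ha)
  have hne : ∀ᶠ ε in l, f ε + a ≠ 0 :=
    (hf.add_const a).eventually_ne (by rw [← two_mul]; exact mul_ne_zero two_ne_zero ha)
  have h2 := h.mul (h1.isBigO_one ℝ)
  simp only [mul_one] at h2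
  refine h2.congr' ?_ EventuallyEq.rfl
  filter_upwards [hne] with ε hε
  field_simp
  ring

/-- Along a transversal path, `λ` and `κ` converge at a linear rate. -/
theorem exists_limits {N : ℕ} {e : Fin N → ℕ} (he : ∀ n, 1 ≤ e n) {ζ : ℝ → Fin N → ℂ}
    {xs lam kap : ℝ → ℂ} {ε₁ : ℝ} (hyp : StandingHypotheses e ζ xs lam kap ε₁) {α : ℝ}
    (hα : IsAdmissibleWeight e ζ lam α) (hs : 1 ≤ symIndex e) :
    ∃ kapc : ℂ, Tendsto kap (𝓝[>] 0) (𝓝 kapc) ∧ kapc ≠ 0 ∧ lam 0 ≠ 0 ∧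
      (fun ε => lam ε - lam 0) =O[𝓝[>] 0] (fun ε : ℝ => ε) ∧
      (fun ε => kap ε - kapc) =O[𝓝[>] 0] (fun ε : ℝ => ε) := by
  obtain ⟨F, c, d, ε₀, φ, η₀, M, M₀, L₀, C₀, c₀, hε₀, -, hφ, hφ2, hη, hC, hc, -, -, -, h⟩ :=
    exists_branchData hyp hα hs
  have hev : ∀ᶠ ε in 𝓝[>] (0 : ℝ), ε ∈ Set.Ioo 0 ε₀ := Ioo_mem_nhdsGT hε₀
  set q : ℂ := (((Real.sqrt (symIndex e))⁻¹ : ℝ) : ℂ) with hq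
  have hq0 : q ≠ 0 := by
    have : 0 < Real.sqrt (symIndex e) := Real.sqrt_pos.mpr (by exact_mod_cast hs)
    rw [hq]
    exact_mod_cast (inv_pos.mpr this).ne'
  have hB : ∀ᶠ ε in 𝓝[>] (0 : ℝ), BranchData e (ζ ε) (xs ε) (lam ε) (q * kap ε) (c ε) (d ε) (F ε)
      φ η₀ M M₀ L₀ C₀ := by
    filter_upwards [hev] with ε hε using (h ε hε.1 hε.2).1
  have hζ := tendsto_of_contDiffOn hyp.pos hyp.path_C1
  have hxs := tendsto_of_contDiffOn hyp.pos hyp.transversal.1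
  have hζ' := isBigO_of_contDiffOn hyp.pos hyp.path_C1
  have hxs' := isBigO_of_contDiffOn hyp.pos hyp.transversal.1
  have hx0 := norm_xs_zero hyp
  have hrad := norm_xs_eq hyp le_rfl hyp.pos.le
  have hsb := hyp.simple_critical.2.2
  have hlam := tendsto_branchValue hs hφ hφ2 hη hC hB hζ hxs hx0 hrad hsb
  obtain ⟨a, ha⟩ := exists_tendsto_sqrtCoeff hs hφ hφ2 hη hC hB hζ hxs hx0 hlam
  have hkap : Tendsto kap (𝓝[>] 0) (𝓝 (q⁻¹ * a)) := by
    refine (ha.const_mul q⁻¹).congr fun ε => ?_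
    rw [inv_mul_cancel_left₀ hq0]
  have hlam0 : lam 0 ≠ 0 := by
    have h1 : c₀ ≤ ‖lam 0‖ := ge_of_tendsto hlam.norm (by
      filter_upwards [hev] with ε hε using (h ε hε.1 hε.2).2.1)
    exact norm_pos_iff.mp (hc.trans_le h1)
  have hkap0 : q⁻¹ * a ≠ 0 := by
    have h1 : c₀ ≤ ‖q⁻¹ * a‖ := ge_of_tendsto hkap.norm (by
      filter_upwards [hev] with ε hε using (h ε hε.1 hε.2).2.2.1)
    exact norm_pos_iff.mp (hc.trans_le h1)
  have ha0 : a ≠ 0 := right_ne_zero_of_mul hkap0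
  have hlam' := isBigO_branchValue hζ hxs hlam hζ' hxs' hsb (hB.mono fun ε hε => hε.simple)
  refine ⟨q⁻¹ * a, hkap, hkap0, hlam0, hlam', ?_⟩
  -- `κ²` is a smooth function of `(ζ, x_*, λ)`
  set R : (Fin N → ℂ) × ℂ × ℂ → ℂ := fun p => -(2 * charFx e p) / charFyy e p with hR
  have hp : Tendsto (fun ε => (ζ ε, xs ε, lam ε)) (𝓝[>] 0) (𝓝 (ζ 0, xs 0, lam 0)) :=
    hζ.prodMk_nhds (hxs.prodMk_nhds hlam)
  have hR1 : ContDiffAt ℂ 1 R (ζ 0, xs 0, lam 0) :=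
    (contDiffAt_const.mul (contDiff_charFx e).contDiffAt).neg.div
      (contDiff_charFyy e).contDiffAt (charFyy_ne_zero_of_simple hsb)
  have hR2 := isBigO_comp_of_contDiffAt hR1 hp tendsto_const_nhds
    (IsBigO.prod_left hζ' (IsBigO.prod_left hxs' hlam'))
  have hsq : ∀ᶠ ε in 𝓝[>] (0 : ℝ), R (ζ ε, xs ε, lam ε) = (q * kap ε) ^ 2 := by
    filter_upwards [hB] with ε hε
    have h1 := hε.sqrtCoeff_sq he hs hφ hφ2 hη hC
    have h2 := charFyy_ne_zero_of_simple hε.simple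
    simp only [hR]
    rw [div_eq_iff h2]
    linear_combination -h1
  have ha2 : R (ζ 0, xs 0, lam 0) = a ^ 2 :=
    tendsto_nhds_unique (((hR1.continuousAt.tendsto.comp hp)).congr' hsq) (ha.pow 2)
  have h5 : (fun ε => q * kap ε - a) =O[𝓝[>] 0] fun ε : ℝ => ε := by
    refine isBigO_of_sq ha0 ha (hR2.congr' ?_ EventuallyEq.rfl)
    filter_upwards [hsq] with ε hε
    rw [hε, ha2]
  refine (h5.const_mul_left q⁻¹).congr_left fun ε => ?_
  rw [mul_sub, inv_mul_cancel_left₀ hq0]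

/-! ### Matrices of the form `ξ⁻ʲ (j + 1)^{-1/2} b_k + O(1 / j)` -/

theorem exists_ell2_of_summable {f : ℕ → ℂ} {g : ℕ → ℝ} (h : ∀ j, ‖f j‖ ≤ g j)
    (hg : Summable g) : ∃ x : Ell2, (∀ j, (x : ℕ → ℂ) j = f j) ∧ ‖x‖ ≤ ∑' j, g j := by
  have hn : ∀ j, ‖f j • (lp.single 2 j (1 : ℂ) : Ell2)‖ ≤ g j := fun j => by
    rw [norm_smul, lp.norm_single (by norm_num)]
    simpa using h j
  have hs : Summable fun j => f j • (lp.single 2 j (1 : ℂ) : Ell2) :=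
    Summable.of_norm_bounded hg hn
  refine ⟨∑' j, f j • (lp.single 2 j (1 : ℂ) : Ell2), fun j => ?_,
    tsum_of_norm_bounded hg.hasSum hn⟩
  have h1 := hs.hasSum.mapL (innerSL ℂ (lp.single 2 j (1 : ℂ) : Ell2))
  simp only [innerSL_apply_apply, inner_smul_right, inner_single_left] at h1
  refine h1.unique ?_
  convert hasSum_single j ?_ using 1
  · simp
  · intro i hi
    simp [lp.single_apply, hi.symm]

theorem exists_ell2_of_sq_summable {f : ℕ → ℂ} (h : Summable fun j => ‖f j‖ ^ 2) :
    ∃ x : Ell2, (∀ j, (x : ℕ → ℂ) j = f j) ∧ ‖x‖ ^ 2 = ∑' j, ‖f j‖ ^ 2 := by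
  have hm : Memℓp f 2 := memℓp_gen (by simpa using h)
  refine ⟨⟨f, hm⟩, fun j => rfl, ?_⟩
  have := lp.norm_rpow_eq_tsum (p := 2) (by norm_num) (⟨f, hm⟩ : Ell2)
  simpa using this

theorem summable_inv_sq : Summable fun j : ℕ => 1 / ((j : ℝ) + 1) ^ 2 := by
  have h := (summable_nat_add_iff 1).mpr (Real.summable_one_div_nat_pow.mpr (by norm_num : 1 < 2))
  simpa using h

theorem summable_inv_mul_sqrt :
    Summable fun j : ℕ => 1 / (((j : ℝ) + 1) * Real.sqrt (j + 1)) := by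
  have h := (summable_nat_add_iff 1).mpr
    (Real.summable_one_div_nat_rpow.mpr (by norm_num : (1 : ℝ) < 3 / 2))
  refine h.congr fun j => ?_
  have hj : (0 : ℝ) < (j : ℝ) + 1 := by positivity
  push_cast
  rw [Real.sqrt_eq_rpow, show (3 / 2 : ℝ) = 1 + 1 / 2 by norm_num, Real.rpow_add hj, Real.rpow_one]

theorem summable_sq_mul_geometric {σ : ℝ} (h0 : 0 < σ) (h1 : σ < 1) :
    Summable fun k : ℕ => ((k : ℝ) + 1) ^ 2 * σ ^ k := by
  have h := (summable_nat_add_iff 1).mpr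
    (summable_pow_mul_geometric_of_norm_lt_one 2 (r := σ) (by
      rwa [Real.norm_eq_abs, abs_of_pos h0]))
  refine (h.mul_left σ⁻¹).congr fun k => ?_
  push_cast
  field_simp
  ring

/-- A matrix which is the rank-one matrix `a ⊗ b`, `a_j = ξ⁻ʲ (j + 1)^{-1/2}`, up to entries
`O((k + 1)² σᵏ / (j + 1))` defines a bounded operator whose Gram operator is
`‖a‖² b ⊗ b`, `‖a‖² = ∑ ‖ξ‖^{-2j} / (j + 1)`, up to an operator bounded independently of `ξ`. -/
theorem exists_operator_of_approx {σ B₀ B₁ K₁ : ℝ} (hσ0 : 0 < σ) (hσ1 : σ < 1) :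
    ∃ K : ℝ, ∀ (ξ : ℂ) (v : ℕ → ℕ → ℂ) (b : ℕ → ℂ) (L : ℝ), 1 < ‖ξ‖ →
      (∀ k j, ‖v k j - (ξ⁻¹) ^ j / (Real.sqrt (j + 1) : ℂ) * b k‖
        ≤ B₀ * (((k : ℝ) + 1) ^ 2 * σ ^ k) / (j + 1)) →
      (∀ k, ‖b k‖ ≤ B₁ * σ ^ k) → |logSeries ((‖ξ‖ ^ 2)⁻¹) - L| ≤ K₁ →
      ∃ (V : Ell2 →L[ℂ] Ell2) (d : Ell2),
        (∀ k j, (V (lp.single 2 k (1 : ℂ)) : ℕ → ℂ) j = v k j) ∧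
        (∀ k, (d : ℕ → ℂ) k = (starRingEnd ℂ) (b k)) ∧ ‖d‖ ≤ ∑' k, B₁ * σ ^ k ∧
        ‖gramBlock V - (L : ℂ) • InnerProductSpace.rankOne ℂ d d‖ ≤ K := by
  set S₂ := ∑' j : ℕ, 1 / ((j : ℝ) + 1) ^ 2 with hS₂
  set S₃ := ∑' j : ℕ, 1 / (((j : ℝ) + 1) * Real.sqrt (j + 1)) with hS₃
  set Bk : ℕ → ℝ := fun k => B₀ * (((k : ℝ) + 1) ^ 2 * σ ^ k) with hBk
  have hBs : Summable Bk := (summable_sq_mul_geometric hσ0 hσ1).mul_left B₀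
  refine ⟨K₁ * (∑' k, B₁ * σ ^ k) ^ 2 + 2 * ((∑' k, B₁ * σ ^ k) * ∑' k, Bk k * S₃)
    + (∑' k, Bk k * Real.sqrt S₂) ^ 2, ?_⟩
  intro ξ v b L hξ hv hb hL
  have ht1 : (‖ξ‖ ^ 2)⁻¹ < 1 := inv_lt_one_of_one_lt₀ (one_lt_pow₀ hξ (by norm_num))
  have ha2 : ∀ j : ℕ, ‖(ξ⁻¹) ^ j / (Real.sqrt (j + 1) : ℂ)‖ ^ 2
      = ((‖ξ‖ ^ 2)⁻¹) ^ j / ((j : ℝ) + 1) := by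
    intro j
    rw [norm_div, Complex.norm_real, Real.norm_eq_abs, abs_of_nonneg (Real.sqrt_nonneg _), div_pow,
      Real.sq_sqrt (by positivity), norm_pow, norm_inv]
    congr 1
    rw [← inv_pow, ← pow_mul, ← pow_mul, mul_comm]
  obtain ⟨a, ha, han⟩ := exists_ell2_of_sq_summable
    (f := fun j => (ξ⁻¹) ^ j / (Real.sqrt (j + 1) : ℂ))
    ((summable_logSeries (by positivity) ht1).congr fun j => (ha2 j).symm)
  have han' : ‖a‖ ^ 2 = logSeries ((‖ξ‖ ^ 2)⁻¹) := by
    rw [han, logSeries]; exact tsum_congr ha2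
  have hale : ∀ j : ℕ, ‖(a : ℕ → ℂ) j‖ ≤ 1 / Real.sqrt (j + 1) := by
    intro j
    rw [ha, norm_div, Complex.norm_real, Real.norm_eq_abs, abs_of_nonneg (Real.sqrt_nonneg _),
      norm_pow, norm_inv]
    gcongr
    exact pow_le_one₀ (by positivity) (inv_le_one_of_one_le₀ hξ.le)
  obtain ⟨d, hd, hdn⟩ := exists_ell2_of_summable (f := fun k => (starRingEnd ℂ) (b k))
    (g := fun k => B₁ * σ ^ k) (fun k => by rw [RCLike.norm_conj]; exact hb k)
    ((summable_geometric_of_lt_one hσ0.le hσ1).mul_left B₁)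
  have hcolex : ∀ k, ∃ x : Ell2,
      (∀ j, (x : ℕ → ℂ) j = v k j - (ξ⁻¹) ^ j / (Real.sqrt (j + 1) : ℂ) * b k) ∧
      ‖x‖ ≤ Bk k * Real.sqrt S₂ := by
    intro k
    have hBk0 : 0 ≤ Bk k := by
      have h0 := (norm_nonneg _).trans (hv k 0)
      simpa [hBk] using h0
    have hsq : ∀ j, ‖v k j - (ξ⁻¹) ^ j / (Real.sqrt (j + 1) : ℂ) * b k‖ ^ 2
        ≤ Bk k ^ 2 * (1 / ((j : ℝ) + 1) ^ 2) := by
      intro j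
      calc _ ≤ (Bk k / ((j : ℝ) + 1)) ^ 2 := by gcongr; exact hv k j
        _ = _ := by rw [div_pow]; ring
    have hsum := summable_inv_sq.mul_left (Bk k ^ 2)
    obtain ⟨x, hx, hxn⟩ := exists_ell2_of_sq_summable
      (Summable.of_nonneg_of_le (fun j => by positivity) hsq hsum)
    refine ⟨x, hx, ?_⟩
    have hS0 : 0 ≤ S₂ := tsum_nonneg fun j => by positivity
    refine le_of_sq_le_sq ?_ (by positivity)
    rw [hxn, mul_pow, Real.sq_sqrt hS0, hS₂, ← tsum_mul_left]
    exact (Summable.of_nonneg_of_le (fun j => by positivity) hsq hsum).tsum_le_tsum hsq hsum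
  choose col hcol hcoln using hcolex
  obtain ⟨E, hE1, hEn, hE⟩ := exists_operator_of_summable_columns col hcoln
    (hBs.mul_right (Real.sqrt S₂))
  have hinner : ∀ k, ‖inner ℂ a (col k)‖ ≤ Bk k * S₃ := by
    intro k
    rw [lp.inner_eq_tsum, hS₃, ← tsum_mul_left]
    refine tsum_of_norm_bounded (summable_inv_mul_sqrt.mul_left (Bk k)).hasSum fun j => ?_
    refine (norm_inner_le_norm _ _).trans ?_
    rw [hcol]
    calc _ ≤ 1 / Real.sqrt (j + 1) * (Bk k / ((j : ℝ) + 1)) :=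
          mul_le_mul (hale j) (hv k j) (norm_nonneg _) (by positivity)
      _ = _ := by rw [div_mul_div_comm, one_mul, mul_one_div, mul_comm (Real.sqrt _)]
  refine ⟨InnerProductSpace.rankOne ℂ a d + E, d, fun k j => ?_, hd, hdn, ?_⟩
  · have h1 : inner ℂ d (lp.single 2 k (1 : ℂ) : Ell2) = b k := by
      rw [← inner_conj_symm, inner_single_left, hd, Complex.conj_conj]
    have h2 : (InnerProductSpace.rankOne ℂ a d + E) (lp.single 2 k (1 : ℂ) : Ell2)
        = b k • a + col k := by
      rw [add_apply, InnerProductSpace.rankOne_apply, h1, hE1]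
    rw [h2, lp.coeFn_add, Pi.add_apply, lp.coeFn_smul, Pi.smul_apply, hcol, ha, smul_eq_mul]
    ring
  · exact gramBlock_rankOne_add a d E L (by rwa [han']) hdn hEn
      (norm_adjoint_apply_le hE a hinner (hBs.mul_right S₃))

/-! ### The scale `L` against `ρ_*` -/

theorem logScale_eq {N : ℕ} (e : Fin N → ℕ) (ζ : Fin N → ℂ) :
    logScale e ζ = logSeries (etaScale e ζ) := rfl

theorem abs_logScale_add_log {N : ℕ} {e : Fin N → ℕ} {ζ : Fin N → ℂ} {x : ℝ}
    (hs : 1 ≤ symIndex e) (hx : (rhoStar e ζ).toReal = x) (h1 : 1 < x) (h2 : x ≤ 2) :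
    |logScale e ζ + Real.log (x - 1)|
      ≤ 1 + Real.log 4 + Real.log (2 * symIndex e : ℕ) + Real.log 2 := by
  have hy : rhoMid e ζ * (rhoStar e ζ).toReal = (1 + x) / 2 * x := by rw [rhoMid, hx]
  have hy1 : 1 < (1 + x) / 2 * x := by nlinarith
  have hy4 : (1 + x) / 2 * x ≤ 4 := by nlinarith
  have h := logSeries_inv_pow (n := 2 * symIndex e) (by omega) hy1 hy4
  have e1 : logScale e ζ = logSeries (((1 + x) / 2 * x) ^ (2 * symIndex e))⁻¹ := by
    rw [logScale_eq, etaScale, hy]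
  have e2 : Real.log ((1 + x) / 2 * x - 1) = Real.log (x - 1) + Real.log ((x + 2) / 2) := by
    rw [← Real.log_mul (by linarith) (by linarith)]
    congr 1
    ring
  have h3 : 0 ≤ Real.log ((x + 2) / 2) := Real.log_nonneg (by linarith)
  have h4 : Real.log ((x + 2) / 2) ≤ Real.log 2 := Real.log_le_log (by linarith) (by linarith)
  rw [← e1, e2] at h
  have := abs_le.mp h
  rw [abs_le]
  constructor <;> linarith

theorem abs_logSeries_sub_logScale {N : ℕ} {e : Fin N → ℕ} {ζ : Fin N → ℂ} {x : ℝ}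
    (hs : 1 ≤ symIndex e) (hx : (rhoStar e ζ).toReal = x) (h1 : 1 < x) (h2 : x ≤ 2) :
    |logSeries (((x ^ symIndex e) ^ 2)⁻¹) - logScale e ζ|
      ≤ 2 * (1 + Real.log 4 + Real.log (2 * symIndex e : ℕ) + Real.log 2) := by
  have ha := abs_le.mp (abs_logScale_add_log hs hx h1 h2)
  have hb := abs_le.mp
    (logSeries_inv_pow (n := 2 * symIndex e) (by omega) h1 (by linarith : x ≤ 4))
  have : 0 ≤ Real.log 2 := Real.log_nonneg (by norm_num)
  rw [← pow_mul, mul_comm (symIndex e) 2, abs_le]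
  constructor <;> linarith

theorem logScale_nonneg {N : ℕ} (e : Fin N → ℕ) (ζ : Fin N → ℂ) : 0 ≤ logScale e ζ := by
  refine tsum_nonneg fun m => ?_
  have : 0 ≤ etaScale e ζ := by unfold etaScale; rw [pow_mul]; positivity
  positivity

/-! ### Entries of the renormalized synthesis matrix -/

theorem blockIndex_pos {N : ℕ} (e : Fin N → ℕ) {q : ℕ} (hq : 1 ≤ q) (k : ℕ) :
    1 ≤ blockIndex e q k := by unfold blockIndex; omega

theorem le_blockIndex {N : ℕ} {e : Fin N → ℕ} (hs : 1 ≤ symIndex e) (q k : ℕ) :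
    k ≤ blockIndex e q k := by unfold blockIndex; nlinarith

theorem sq_mul_pow_le_sqrt_mul_weight {N : ℕ} (e : Fin N → ℕ) {q : ℕ} (hq : 1 ≤ q) {α β : ℝ}
    (hα : 0 < α) (hβ : 0 < β) (k : ℕ) :
    (blockIndex e q k : ℝ) ^ 2 * α ^ blockIndex e q k
      ≤ Real.sqrt (blockIndex e q k) * weight e q α β k := by
  have hp : (1 : ℝ) ≤ blockIndex e q k := by exact_mod_cast blockIndex_pos e hq k
  rw [weight, ← mul_assoc]
  gcongr
  rw [Real.sqrt_eq_rpow, ← Real.rpow_add (by linarith), ← Real.rpow_natCast]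
  exact Real.rpow_le_rpow_of_exponent_le hp (by norm_num; linarith)

theorem weight_pos {N : ℕ} (e : Fin N → ℕ) {q : ℕ} (hq : 1 ≤ q) {α : ℝ} (β : ℝ)
    (hα : 0 < α) (k : ℕ) : 0 < weight e q α β k := by
  have hp : (0 : ℝ) < blockIndex e q k := by exact_mod_cast blockIndex_pos e hq k
  unfold weight
  positivity

/-- The factor `b_k = s p_k^{-1/2} A_{p_k} ξᵏ / w_k` of the rank-one part
`ξ⁻ʲ (j + 1)^{-1/2} b_k` of the synthesis matrix; its conjugate is the spike `d`. -/
noncomputable def spikeFactor {N : ℕ} (e : Fin N → ℕ) (q : ℕ) (α β : ℝ) (ξ lam kap : ℂ)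
    (k : ℕ) : ℂ :=
  ((symIndex e / Real.sqrt (blockIndex e q k) : ℝ) : ℂ)
    * critAmplitude (symIndex e) kap lam (blockIndex e q k) * ξ ^ k / (weight e q α β k : ℂ)

theorem norm_amplitude_factor_le {s : ℕ} (hs : 1 ≤ s) :
    ‖-(((Real.sqrt s)⁻¹ / (2 * Real.sqrt Real.pi) : ℝ) : ℂ)‖ ≤ 1 := by
  rw [norm_neg, Complex.norm_real, Real.norm_eq_abs, abs_of_nonneg (by positivity)]
  have h1 : (Real.sqrt s)⁻¹ ≤ 1 :=
    inv_le_one_of_one_le₀ (Real.one_le_sqrt.mpr (by exact_mod_cast hs))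
  have h2 : 1 ≤ Real.sqrt Real.pi := Real.one_le_sqrt.mpr (by linarith [Real.pi_gt_three])
  rw [div_le_one (by positivity)]
  linarith

theorem norm_pow_pred_le {lam : ℂ} {A : ℝ} (hA : 0 < A) (h : ‖lam‖ ≤ A) {p : ℕ} (hp : 1 ≤ p) :
    ‖lam ^ (p - 1)‖ ≤ A ^ p / A := by
  obtain ⟨n, rfl⟩ := Nat.exists_eq_add_of_le' hp
  rw [norm_pow, Nat.add_sub_cancel, pow_succ, mul_div_cancel_right₀ _ hA.ne']
  gcongr

theorem norm_critAmplitude_le {s : ℕ} (hs : 1 ≤ s) {kap lam : ℂ} {A C : ℝ} (hA : 0 < A)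
    (hlam : ‖lam‖ ≤ A) (hkap : ‖kap‖ ≤ C) {p : ℕ} (hp : 1 ≤ p) :
    ‖critAmplitude s kap lam p‖ ≤ C / A * (p * A ^ p) := by
  have hC : 0 ≤ C := (norm_nonneg _).trans hkap
  rw [critAmplitude, norm_mul, norm_mul, norm_mul, Complex.norm_natCast]
  calc _ ≤ 1 * p * C * (A ^ p / A) := by
        gcongr
        · exact norm_amplitude_factor_le hs
        · exact norm_pow_pred_le hA hlam hp
    _ = _ := by ring

/-- Replacing the binomial coefficient by its leading term. -/
theorem coeff_approx {s : ℕ} (hs : 1 ≤ s) {R kap lam ξ : ℂ} {A K C : ℝ} (hA : 0 < A)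
    (hlam : ‖lam‖ ≤ A) (hkap : ‖kap‖ ≤ C) (hξ : 1 < ‖ξ‖) {p : ℕ} (hp : 1 ≤ p) (m : ℕ)
    (h : ‖R - p * lam ^ (p - 1) * (((Real.sqrt s)⁻¹ : ℝ) * kap) * binomCoeff (1 / 2) m
      * (ξ⁻¹) ^ m‖ ≤ K * ((p + 1) * A ^ p) / (m + 1) ^ 2) :
    ‖R - critAmplitude s kap lam p * (ξ⁻¹) ^ m * (((m + 1) * Real.sqrt (m + 1))⁻¹ : ℝ)‖
      ≤ (K + 7 * C / A) * ((p + 1) * A ^ p) / (m + 1) ^ 2 := by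
  set T : ℂ := p * lam ^ (p - 1) * (((Real.sqrt s)⁻¹ : ℝ) * kap) with hT
  have hC : 0 ≤ C := (norm_nonneg _).trans hkap
  have e : R - critAmplitude s kap lam p * (ξ⁻¹) ^ m * (((m + 1) * Real.sqrt (m + 1))⁻¹ : ℝ)
      = (R - T * binomCoeff (1 / 2) m * (ξ⁻¹) ^ m) + T * (ξ⁻¹) ^ m
        * ((binomCoeff (1 / 2) m
          + (2 * Real.sqrt Real.pi)⁻¹ * ((m + 1) * Real.sqrt (m + 1))⁻¹ : ℝ) : ℂ) := by
    rw [hT, critAmplitude]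
    push_cast
    rw [div_eq_mul_inv]
    ring
  have hinv : ‖(ξ⁻¹) ^ m‖ ≤ 1 := by
    rw [norm_pow, norm_inv]
    exact pow_le_one₀ (by positivity) (inv_le_one_of_one_le₀ hξ.le)
  have hsq : (Real.sqrt s)⁻¹ ≤ 1 :=
    inv_le_one_of_one_le₀ (Real.one_le_sqrt.mpr (by exact_mod_cast hs))
  have hTn : ‖T‖ ≤ C / A * ((p + 1) * A ^ p) := by
    rw [hT, norm_mul, norm_mul, norm_mul, Complex.norm_natCast, Complex.norm_real,
      Real.norm_eq_abs, abs_of_nonneg (by positivity)]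
    calc _ ≤ p * (A ^ p / A) * (1 * C) := by
          gcongr
          exact norm_pow_pred_le hA hlam hp
      _ = C / A * (p * A ^ p) := by ring
      _ ≤ _ := by gcongr; linarith
  rw [e]
  refine (norm_add_le _ _).trans ?_
  have h2 : ‖T * (ξ⁻¹) ^ m * ((binomCoeff (1 / 2) m
          + (2 * Real.sqrt Real.pi)⁻¹ * ((m + 1) * Real.sqrt (m + 1))⁻¹ : ℝ) : ℂ)‖
      ≤ C / A * ((p + 1) * A ^ p) * 1 * (7 / (m + 1) ^ 2) := by
    rw [norm_mul, norm_mul, Complex.norm_real, Real.norm_eq_abs]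
    gcongr
    exact binomCoeff_half_approx m
  calc _ ≤ K * ((p + 1) * A ^ p) / (m + 1) ^ 2
        + C / A * ((p + 1) * A ^ p) * 1 * (7 / (m + 1) ^ 2) := add_le_add h h2
    _ = _ := by ring

theorem abs_ratio_sub_le {s q : ℕ} (hqs : q ≤ s) (k m : ℕ) :
    |((q + (k + m) * s : ℕ) : ℝ) * (((m : ℝ) + 1) * Real.sqrt (m + 1))⁻¹
      - s / Real.sqrt ((k + m : ℕ) + 1)| ≤ 2 * s * (((k : ℝ) + 1) ^ 2 / ((k + m : ℕ) + 1)) := by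
  have hk : (0 : ℝ) ≤ k := Nat.cast_nonneg k
  have hm : (0 : ℝ) ≤ m := Nat.cast_nonneg m
  have hs : (0 : ℝ) ≤ s := Nat.cast_nonneg s
  have hq : (0 : ℝ) ≤ q := Nat.cast_nonneg q
  have hqs' : (q : ℝ) ≤ s := by exact_mod_cast hqs
  set u := Real.sqrt ((m : ℝ) + 1) with hu
  set w := Real.sqrt (((k + m : ℕ) : ℝ) + 1) with hw
  have hu2 : u ^ 2 = m + 1 := Real.sq_sqrt (by positivity)
  have hw2 : w ^ 2 = k + m + 1 := by rw [hw, Real.sq_sqrt (by positivity)]; push_cast; ring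
  have hu1 : 1 ≤ u := Real.one_le_sqrt.mpr (by linarith)
  have huw : u ≤ w := Real.sqrt_le_sqrt (by push_cast; linarith)
  have hw1 : 1 ≤ w := hu1.trans huw
  have t1 : |((q : ℝ) + k * s - s) / (u ^ 2 * u)| ≤ s * ((k + 1) ^ 2 / w ^ 2) := by
    rw [abs_div, abs_of_pos (by positivity : 0 < u ^ 2 * u)]
    have h1 : |(q : ℝ) + k * s - s| ≤ s * (k + 1) := by
      rw [abs_le]; constructor <;> nlinarith
    calc _ ≤ s * (k + 1) / (u ^ 2 * 1) := by gcongr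
      _ ≤ s * ((k + 1) ^ 2 / w ^ 2) := by
        rw [mul_one, ← mul_div_assoc, div_le_div_iff₀ (by positivity) (by positivity), hu2, hw2]
        have : (k : ℝ) + m + 1 ≤ (k + 1) * (m + 1) := by nlinarith
        calc (s : ℝ) * (k + 1) * (k + m + 1) ≤ s * (k + 1) * ((k + 1) * (m + 1)) := by gcongr
          _ = _ := by ring
  have t2 : |s / u - s / w| ≤ s * ((k + 1) ^ 2 / w ^ 2) := by
    have e2 : s / u - s / w = s * ((w - u) / (u * w)) := by field_simp
    rw [e2, abs_of_nonneg (mul_nonneg hs (div_nonneg (by linarith) (by positivity)))]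
    gcongr s * ?_
    rw [div_le_div_iff₀ (by positivity) (by positivity)]
    have h1 : (w - u) * w ≤ k := by nlinarith
    have h2 : (k : ℝ) ≤ (k + 1) ^ 2 := by nlinarith
    calc (w - u) * w ^ 2 = (w - u) * w * w := by ring
      _ ≤ k * w := by gcongr
      _ ≤ (k + 1) ^ 2 * (u * w) := by
        gcongr
        exact le_mul_of_one_le_left (by positivity) hu1
  have e : ((q + (k + m) * s : ℕ) : ℝ) * (((m : ℝ) + 1) * u)⁻¹ - s / w
      = ((q : ℝ) + k * s - s) / (u ^ 2 * u) + (s / u - s / w) := by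
    rw [← hu2]
    have : ((q + (k + m) * s : ℕ) : ℝ) = (q + k * s - s) + s * u ^ 2 := by
      rw [hu2]; push_cast; ring
    rw [this]
    field_simp
    ring
  have e3 : ((k + m : ℕ) : ℝ) + 1 = w ^ 2 := by rw [hw2]; push_cast; ring
  rw [e, e3]
  calc _ ≤ _ := abs_add_le _ _
    _ ≤ s * ((k + 1) ^ 2 / w ^ 2) + s * ((k + 1) ^ 2 / w ^ 2) := add_le_add t1 t2
    _ = _ := by ring

theorem div_weight_le {N : ℕ} {e : Fin N → ℕ} (hs : 1 ≤ symIndex e) {q : ℕ} (hq : 1 ≤ q)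
    {α β σ : ℝ} (hα : 0 < α) (hβ : 0 < β) (hσ0 : 0 < σ) (hσ1 : σ < 1) (k : ℕ) :
    (blockIndex e q k : ℝ) ^ 2 * (σ ^ 2 * α) ^ blockIndex e q k
      / (Real.sqrt (blockIndex e q k) * weight e q α β k) ≤ (σ ^ 2) ^ k := by
  have h1 := sq_mul_pow_le_sqrt_mul_weight e hq hα hβ k
  have hp : (0 : ℝ) < blockIndex e q k := by exact_mod_cast blockIndex_pos e hq k
  have hσ2 : σ ^ 2 ≤ 1 := pow_le_one₀ hσ0.le hσ1.le
  rw [div_le_iff₀ ((by positivity : (0 : ℝ) < _).trans_le h1)]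
  calc (blockIndex e q k : ℝ) ^ 2 * (σ ^ 2 * α) ^ blockIndex e q k
      = (σ ^ 2) ^ blockIndex e q k * ((blockIndex e q k : ℝ) ^ 2 * α ^ blockIndex e q k) := by
        rw [mul_pow]; ring
    _ ≤ (σ ^ 2) ^ k * (Real.sqrt (blockIndex e q k) * weight e q α β k) := by
        gcongr ?_ * ?_
        exact pow_le_pow_of_le_one (by positivity) hσ2 (le_blockIndex hs q k)

theorem mul_inv_pow_eq {σ : ℝ} (hσ0 : 0 < σ) (k : ℕ) : (σ ^ 2) ^ k * (σ⁻¹) ^ k = σ ^ k := by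
  rw [← mul_pow]
  congr 1
  field_simp

theorem norm_spikeFactor_le {N : ℕ} {e : Fin N → ℕ} (hs : 1 ≤ symIndex e) {q : ℕ} (hq : 1 ≤ q)
    {α β σ C : ℝ} (hα : 0 < α) (hβ : 0 < β) (hσ0 : 0 < σ) (hσ1 : σ < 1) {ξ lam kap : ℂ}
    (hξ : ‖ξ‖ ≤ σ⁻¹) (hlam : ‖lam‖ ≤ σ ^ 2 * α) (hkap : ‖kap‖ ≤ C) (k : ℕ) :
    ‖spikeFactor e q α β ξ lam kap k‖ ≤ symIndex e * (C / (σ ^ 2 * α)) * σ ^ k := by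
  have hw := weight_pos e hq β hα k
  have hp : (1 : ℝ) ≤ blockIndex e q k := by exact_mod_cast blockIndex_pos e hq k
  have hC : 0 ≤ C := (norm_nonneg _).trans hkap
  have hA : 0 < σ ^ 2 * α := by positivity
  have hamp := norm_critAmplitude_le hs hA hlam hkap (blockIndex_pos e hq k)
  rw [spikeFactor, norm_div, norm_mul, norm_mul, Complex.norm_real, Complex.norm_real,
    Real.norm_eq_abs, Real.norm_eq_abs, abs_of_pos hw, abs_of_nonneg (by positivity), norm_pow]
  set p := blockIndex e q k
  calc symIndex e / Real.sqrt p * ‖critAmplitude (symIndex e) kap lam p‖ * ‖ξ‖ ^ k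
        / weight e q α β k
      ≤ symIndex e / Real.sqrt p * (C / (σ ^ 2 * α) * (p ^ 2 * (σ ^ 2 * α) ^ p)) * (σ⁻¹) ^ k
        / weight e q α β k := by
        gcongr
        refine hamp.trans ?_
        gcongr
        exact le_self_pow₀ hp (by norm_num)
    _ = symIndex e * (C / (σ ^ 2 * α)) * (p ^ 2 * (σ ^ 2 * α) ^ p
        / (Real.sqrt p * weight e q α β k)) * (σ⁻¹) ^ k := by
        field_simp
    _ ≤ symIndex e * (C / (σ ^ 2 * α)) * (σ ^ 2) ^ k * (σ⁻¹) ^ k := by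
        gcongr
        exact div_weight_le hs hq hα hβ hσ0 hσ1 k
    _ = _ := by rw [mul_assoc _ ((σ ^ 2) ^ k), mul_inv_pow_eq hσ0]

/-- The synthesis matrix is `a ⊗ b` up to entries `O((k + 1)² σᵏ / (j + 1))`: below the diagonal
by the coefficient asymptotics, above it because `a_j b_k` is itself that small for `j < k`. -/
theorem gramVector_approx {N : ℕ} {e : Fin N → ℕ} {ζ : Fin N → ℂ} (hs : 1 ≤ symIndex e) {q : ℕ}
    (hq : 1 ≤ q) (hqs : q ≤ symIndex e) {α β σ C K : ℝ} (hα : 0 < α) (hβ : 0 < β) (hσ0 : 0 < σ)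
    (hσ1 : σ < 1) (hK : 0 ≤ K) {ξ lam kap : ℂ} (hξ1 : 1 < ‖ξ‖)
    (hξ : ‖ξ‖ ≤ σ⁻¹) (hlam : ‖lam‖ ≤ σ ^ 2 * α) (hkap : ‖kap‖ ≤ C)
    (h : ∀ p m : ℕ, 1 ≤ p → ‖coeffR e ζ p m - critAmplitude (symIndex e) kap lam p * (ξ⁻¹) ^ m
      * (((m + 1) * Real.sqrt (m + 1))⁻¹ : ℝ)‖ ≤ K * ((p + 1) * (σ ^ 2 * α) ^ p) / (m + 1) ^ 2)
    (k j : ℕ) :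
    ‖gramVector e ζ q k j / (weight e q α β k : ℂ)
        - (ξ⁻¹) ^ j / (Real.sqrt (j + 1) : ℂ) * spikeFactor e q α β ξ lam kap k‖
      ≤ symIndex e * (2 * K + 2 * (C / (σ ^ 2 * α))) * (((k : ℝ) + 1) ^ 2 * σ ^ k) / (j + 1) := by
  have hw := weight_pos e hq β hα k
  have hwc : (weight e q α β k : ℂ) ≠ 0 := by exact_mod_cast hw.ne'
  have hp : (1 : ℝ) ≤ blockIndex e q k := by exact_mod_cast blockIndex_pos e hq k
  have hC : 0 ≤ C := (norm_nonneg _).trans hkap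
  have hA : 0 < σ ^ 2 * α := by positivity
  have hξ0 : ξ ≠ 0 := by rintro rfl; simp at hξ1; linarith
  have hs0 : (0 : ℝ) ≤ symIndex e := Nat.cast_nonneg _
  by_cases hkj : k ≤ j
  · obtain ⟨m, rfl⟩ := Nat.exists_eq_add_of_le hkj
    have hR := h (blockIndex e q k) m (blockIndex_pos e hq k)
    have hamp := norm_critAmplitude_le hs hA hlam hkap (blockIndex_pos e hq k)
    have hdiv := div_weight_le hs hq hα hβ hσ0 hσ1 (β := β) k
    have hratio := abs_ratio_sub_le hqs k m
    have hblock : blockIndex e q (k + m) = q + (k + m) * symIndex e := rfl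
    rw [← hblock] at hratio
    set p := blockIndex e q k with hpdef
    set P := blockIndex e q (k + m) with hPdef
    set T := critAmplitude (symIndex e) kap lam p with hT
    have hinv : ‖(ξ⁻¹) ^ m‖ ≤ 1 := by
      rw [norm_pow, norm_inv]
      exact pow_le_one₀ (by positivity) (inv_le_one_of_one_le₀ hξ1.le)
    have hsqp : 0 < Real.sqrt p := Real.sqrt_pos.mpr (by linarith)
    have hsqpc : (Real.sqrt p : ℂ) ≠ 0 := by exact_mod_cast hsqp.ne'
    have e1 : gramVector e ζ q k (k + m) / (weight e q α β k : ℂ)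
        - (ξ⁻¹) ^ (k + m) / (Real.sqrt ((k + m : ℕ) + 1) : ℂ) * spikeFactor e q α β ξ lam kap k
        = (P * (coeffR e ζ p m - T * (ξ⁻¹) ^ m * (((m + 1) * Real.sqrt (m + 1))⁻¹ : ℝ))
          + T * (ξ⁻¹) ^ m * ((P * ((m + 1) * Real.sqrt (m + 1))⁻¹
            - symIndex e / Real.sqrt ((k + m : ℕ) + 1) : ℝ) : ℂ))
          / (Real.sqrt p * weight e q α β k : ℝ) := by
      have hx : (ξ⁻¹) ^ (k + m) * ξ ^ k = (ξ⁻¹) ^ m := by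
        rw [pow_add, inv_pow ξ k]; field_simp
      rw [gramVector, if_pos (Nat.le_add_right k m), Nat.add_sub_cancel_left, spikeFactor, ← hx,
        ← hpdef, ← hPdef, ← hT]
      push_cast
      field_simp
      ring
    have hP : (P : ℝ) ≤ symIndex e * (((k : ℝ) + 1) * (m + 1)) := by
      have hqs' : (q : ℝ) ≤ symIndex e := by exact_mod_cast hqs
      have hk0 : (0 : ℝ) ≤ k := Nat.cast_nonneg k
      have hm0 : (0 : ℝ) ≤ m := Nat.cast_nonneg m
      rw [hblock]
      push_cast
      nlinarith [mul_nonneg hs0 (mul_nonneg hk0 hm0)]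
    have hkm : 1 / ((m : ℝ) + 1) ≤ (k + 1) / ((k + m : ℕ) + 1) := by
      rw [div_le_div_iff₀ (by positivity) (by positivity)]
      push_cast
      nlinarith [mul_nonneg (Nat.cast_nonneg k : (0 : ℝ) ≤ k) (Nat.cast_nonneg m : (0 : ℝ) ≤ m)]
    have hpp : ((p : ℝ) + 1) * (σ ^ 2 * α) ^ p ≤ 2 * (p ^ 2 * (σ ^ 2 * α) ^ p) := by
      have : (p : ℝ) + 1 ≤ 2 * p ^ 2 := by nlinarith
      calc _ ≤ 2 * (p : ℝ) ^ 2 * (σ ^ 2 * α) ^ p := by gcongr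
        _ = _ := by ring
    have hpp1 : (p : ℝ) * (σ ^ 2 * α) ^ p ≤ p ^ 2 * (σ ^ 2 * α) ^ p := by
      gcongr
      exact le_self_pow₀ hp (by norm_num)
    set X := (p : ℝ) ^ 2 * (σ ^ 2 * α) ^ p with hX
    have hX0 : 0 ≤ X := by positivity
    set Y := ((k : ℝ) + 1) ^ 2 / ((k + m : ℕ) + 1) with hY
    have hY0 : 0 ≤ Y := by positivity
    have n1 : ‖(P : ℂ) * (coeffR e ζ p m - T * (ξ⁻¹) ^ m
        * (((m + 1) * Real.sqrt (m + 1))⁻¹ : ℝ))‖ ≤ symIndex e * (2 * K) * X * Y := by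
      rw [norm_mul, Complex.norm_natCast]
      calc _ ≤ symIndex e * (((k : ℝ) + 1) * (m + 1)) * (K * (2 * X) / (m + 1) ^ 2) := by
            gcongr
            refine hR.trans ?_
            gcongr
        _ = symIndex e * (2 * K) * X * ((k + 1) * (1 / (m + 1))) := by field_simp
        _ ≤ symIndex e * (2 * K) * X * ((k + 1) * ((k + 1) / ((k + m : ℕ) + 1))) := by gcongr
        _ = _ := by rw [hY]; ring
    have n2 : ‖T * (ξ⁻¹) ^ m * ((P * ((m + 1) * Real.sqrt (m + 1))⁻¹
            - symIndex e / Real.sqrt ((k + m : ℕ) + 1) : ℝ) : ℂ)‖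
        ≤ symIndex e * (2 * (C / (σ ^ 2 * α))) * X * Y := by
      rw [norm_mul, norm_mul, Complex.norm_real, Real.norm_eq_abs]
      calc _ ≤ C / (σ ^ 2 * α) * X * 1 * (2 * symIndex e * Y) := by
            gcongr
            refine hamp.trans ?_
            gcongr
        _ = _ := by ring
    have hσk : (σ ^ 2) ^ k ≤ σ ^ k := by
      gcongr
      exact pow_le_of_le_one hσ0.le hσ1.le (by norm_num)
    rw [e1, norm_div, Complex.norm_real, Real.norm_eq_abs, abs_of_pos (by positivity)]
    calc _ ≤ (symIndex e * (2 * K) * X * Y + symIndex e * (2 * (C / (σ ^ 2 * α))) * X * Y)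
          / (Real.sqrt p * weight e q α β k) := by
          gcongr
          exact (norm_add_le _ _).trans (add_le_add n1 n2)
      _ = symIndex e * (2 * K + 2 * (C / (σ ^ 2 * α))) * Y
          * (X / (Real.sqrt p * weight e q α β k)) := by ring
      _ ≤ symIndex e * (2 * K + 2 * (C / (σ ^ 2 * α))) * Y * σ ^ k := by
          gcongr
          exact hdiv.trans hσk
      _ = _ := by rw [hY]; ring
  · have hb := norm_spikeFactor_le hs hq hα hβ hσ0 hσ1 hξ hlam hkap k
    rw [gramVector, if_neg hkj, zero_div, zero_sub, norm_neg, norm_mul, norm_div,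
      Complex.norm_real, Real.norm_eq_abs, abs_of_nonneg (Real.sqrt_nonneg _)]
    have hinv : ‖(ξ⁻¹) ^ j‖ ≤ 1 := by
      rw [norm_pow, norm_inv]
      exact pow_le_one₀ (by positivity) (inv_le_one_of_one_le₀ hξ1.le)
    have hj1 : (1 : ℝ) ≤ Real.sqrt (j + 1) :=
      Real.one_le_sqrt.mpr (by linarith [(Nat.cast_nonneg j : (0 : ℝ) ≤ j)])
    have hjk : (1 : ℝ) ≤ ((k : ℝ) + 1) ^ 2 / (j + 1) := by
      rw [one_le_div (by positivity)]
      have : (j : ℝ) ≤ k := by exact_mod_cast (not_le.mp hkj).le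
      nlinarith [(Nat.cast_nonneg j : (0 : ℝ) ≤ j)]
    calc _ ≤ 1 / 1 * (symIndex e * (C / (σ ^ 2 * α)) * σ ^ k) := by gcongr
      _ = symIndex e * (0 + 1 * (C / (σ ^ 2 * α))) * σ ^ k * 1 := by ring
      _ ≤ symIndex e * (2 * K + 2 * (C / (σ ^ 2 * α))) * σ ^ k * (((k : ℝ) + 1) ^ 2 / (j + 1)) := by
          gcongr
          · positivity
          · norm_num
      _ = _ := by ring

/-! ### The limiting spike -/

/-- The spike depends on the branch point, the branch value and the square-root coefficient in a
Lipschitz way, uniformly on the range where its entries decay geometrically. -/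
theorem norm_spikeFactor_sub_le {N : ℕ} {e : Fin N → ℕ} (hs : 1 ≤ symIndex e) {q : ℕ} (hq : 1 ≤ q)
    {α β σ C D : ℝ} (hα : 0 < α) (hβ : 0 < β) (hσ0 : 0 < σ) (hσ1 : σ < 1)
    {ξ lam kap ξ₀ lam₀ kap₀ : ℂ} (hξ : ‖ξ‖ ≤ σ⁻¹) (hlam : ‖lam‖ ≤ σ ^ 2 * α)
    (hξ₀ : ‖ξ₀‖ ≤ σ⁻¹) (hlam₀ : ‖lam₀‖ ≤ σ ^ 2 * α) (hkap₀ : ‖kap₀‖ ≤ C)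
    (h1 : ‖ξ - ξ₀‖ ≤ D) (h2 : ‖lam - lam₀‖ ≤ D) (h3 : ‖kap - kap₀‖ ≤ D) (k : ℕ) :
    ‖spikeFactor e q α β ξ lam kap k - spikeFactor e q α β ξ₀ lam₀ kap₀ k‖
      ≤ symIndex e * (1 / (σ ^ 2 * α) + C / (σ ^ 2 * α) ^ 2 + C / (σ ^ 2 * α)) * D * σ ^ k := by
  have hw := weight_pos e hq β hα k
  have hwc : (weight e q α β k : ℂ) ≠ 0 := by exact_mod_cast hw.ne'
  have hp := blockIndex_pos e hq k
  have hpR : (1 : ℝ) ≤ blockIndex e q k := by exact_mod_cast hp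
  have hkp : (k : ℝ) ≤ blockIndex e q k := by exact_mod_cast le_blockIndex hs q k
  have hC : 0 ≤ C := (norm_nonneg _).trans hkap₀
  have hD : 0 ≤ D := (norm_nonneg _).trans h1
  have hA : 0 < σ ^ 2 * α := by positivity
  have hdiv := div_weight_le hs hq hα hβ hσ0 hσ1 (β := β) k
  have hτ1 : 1 ≤ σ⁻¹ := (one_le_inv₀ hσ0).mpr hσ1.le
  set p := blockIndex e q k
  set A := σ ^ 2 * α
  set τ := σ⁻¹
  have hlp := norm_pow_pred_le hA hlam hp
  have hlp₀ := norm_pow_pred_le hA hlam₀ hp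
  have hξk : ‖ξ ^ k‖ ≤ τ ^ k := by rw [norm_pow]; gcongr
  have dl : ‖lam ^ (p - 1) - lam₀ ^ (p - 1)‖ ≤ p * A ^ p / A ^ 2 * D := by
    have h := norm_pow_sub_pow_mul_le hlam hlam₀ (p - 1)
    have hpe : A ^ p = A ^ (p - 1) * A := by rw [← pow_succ, Nat.sub_add_cancel hp]
    have hcast : ((p - 1 : ℕ) : ℝ) ≤ p := by exact_mod_cast Nat.sub_le p 1
    rw [← le_div_iff₀ hA] at h
    calc _ ≤ _ := h
      _ ≤ p * A ^ (p - 1) * D / A := by gcongr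
      _ = _ := by rw [hpe]; field_simp
  have dx : ‖ξ ^ k - ξ₀ ^ k‖ ≤ p * τ ^ k * D := by
    have h := norm_pow_sub_pow_mul_le hξ hξ₀ k
    calc _ ≤ ‖ξ ^ k - ξ₀ ^ k‖ * τ := le_mul_of_one_le_right (norm_nonneg _) hτ1
      _ ≤ _ := h
      _ ≤ _ := by gcongr
  have main : ‖kap * lam ^ (p - 1) * ξ ^ k - kap₀ * lam₀ ^ (p - 1) * ξ₀ ^ k‖
      ≤ (1 / A + C / A ^ 2 + C / A) * D * (p * A ^ p) * τ ^ k := by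
    have e1 : kap * lam ^ (p - 1) * ξ ^ k - kap₀ * lam₀ ^ (p - 1) * ξ₀ ^ k
        = (kap - kap₀) * lam ^ (p - 1) * ξ ^ k
          + kap₀ * (lam ^ (p - 1) - lam₀ ^ (p - 1)) * ξ ^ k
          + kap₀ * lam₀ ^ (p - 1) * (ξ ^ k - ξ₀ ^ k) := by ring
    rw [e1]
    refine (norm_add₃_le).trans ?_
    rw [norm_mul, norm_mul, norm_mul, norm_mul, norm_mul, norm_mul]
    calc _ ≤ D * (p * A ^ p / A) * τ ^ k + C * (p * A ^ p / A ^ 2 * D) * τ ^ k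
          + C * (A ^ p / A) * (p * τ ^ k * D) := by
          gcongr
          refine hlp.trans ?_
          gcongr
          exact le_mul_of_one_le_left (by positivity) hpR
      _ = _ := by field_simp
  have e2 : spikeFactor e q α β ξ lam kap k - spikeFactor e q α β ξ₀ lam₀ kap₀ k
      = -(((Real.sqrt (symIndex e))⁻¹ / (2 * Real.sqrt Real.pi) : ℝ) : ℂ)
        * ((symIndex e / Real.sqrt p * p / weight e q α β k : ℝ) : ℂ)
        * (kap * lam ^ (p - 1) * ξ ^ k - kap₀ * lam₀ ^ (p - 1) * ξ₀ ^ k) := by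
    simp only [spikeFactor, critAmplitude]
    push_cast
    ring
  have hsp : 0 < Real.sqrt p := Real.sqrt_pos.mpr (by linarith)
  rw [e2, norm_mul, norm_mul, Complex.norm_real (symIndex e / _ * _ / _), Real.norm_eq_abs,
    abs_of_nonneg (by positivity)]
  calc _ ≤ 1 * (symIndex e / Real.sqrt p * p / weight e q α β k)
        * ((1 / A + C / A ^ 2 + C / A) * D * (p * A ^ p) * τ ^ k) := by
        gcongr
        exact norm_amplitude_factor_le hs
    _ = symIndex e * (1 / A + C / A ^ 2 + C / A) * D
        * (p ^ 2 * A ^ p / (Real.sqrt p * weight e q α β k)) * τ ^ k := by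
        field_simp
    _ ≤ symIndex e * (1 / A + C / A ^ 2 + C / A) * D * (σ ^ 2) ^ k * τ ^ k := by
        gcongr
    _ = _ := by rw [mul_assoc _ ((σ ^ 2) ^ k), mul_inv_pow_eq hσ0]

theorem spikeFactor_ne_zero {N : ℕ} {e : Fin N → ℕ} (hs : 1 ≤ symIndex e) {q : ℕ} (hq : 1 ≤ q)
    {α : ℝ} (β : ℝ) (hα : 0 < α) {ξ lam kap : ℂ} (hξ : ξ ≠ 0) (hlam : lam ≠ 0) (hkap : kap ≠ 0)
    (k : ℕ) : spikeFactor e q α β ξ lam kap k ≠ 0 := by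
  have hw : (weight e q α β k : ℂ) ≠ 0 := by exact_mod_cast (weight_pos e hq β hα k).ne'
  have hp : (0 : ℝ) < blockIndex e q k := by exact_mod_cast blockIndex_pos e hq k
  have hs0 : (0 : ℝ) < symIndex e := by exact_mod_cast hs
  have h1 : ((symIndex e / Real.sqrt (blockIndex e q k) : ℝ) : ℂ) ≠ 0 := by
    exact_mod_cast (by positivity : (0 : ℝ) < symIndex e / Real.sqrt (blockIndex e q k)).ne'
  have h2 : (((Real.sqrt (symIndex e))⁻¹ / (2 * Real.sqrt Real.pi) : ℝ) : ℂ) ≠ 0 := by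
    exact_mod_cast
      (by positivity : (0 : ℝ) < (Real.sqrt (symIndex e))⁻¹ / (2 * Real.sqrt Real.pi)).ne'
  have h3 : ((blockIndex e q k : ℕ) : ℂ) ≠ 0 := by exact_mod_cast hp.ne'
  unfold spikeFactor critAmplitude
  exact div_ne_zero (mul_ne_zero (mul_ne_zero h1 (mul_ne_zero (mul_ne_zero
    (mul_ne_zero (neg_ne_zero.mpr h2) h3) hkap) (pow_ne_zero _ hlam))) (pow_ne_zero _ hξ)) hw

/-- On the unit circle the phase `e^{-ikφ}` is the conjugate of the `k`-th power. -/
theorem conj_pow_of_norm_one {ξ : ℂ} (h : ‖ξ‖ = 1) (k : ℕ) :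
    (starRingEnd ℂ) (ξ ^ k) = Complex.exp (-(Complex.I * k * Complex.arg ξ)) := by
  have hξ : ξ = Complex.exp (Complex.arg ξ * Complex.I) := by
    conv_lhs => rw [← Complex.norm_mul_exp_arg_mul_I ξ, h]
    simp
  rw [map_pow]
  conv_lhs => rw [hξ]
  rw [← Complex.exp_conj, ← Complex.exp_nat_mul]
  congr 1
  rw [map_mul, Complex.conj_I, Complex.conj_ofReal]
  ring

theorem conj_spikeFactor {N : ℕ} (e : Fin N → ℕ) (q : ℕ) (α β : ℝ) {xc : ℂ} (hxc : ‖xc‖ = 1)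
    (lam kap : ℂ) (k : ℕ) :
    (starRingEnd ℂ) (spikeFactor e q α β (xc ^ symIndex e) lam kap k)
      = spikeEntry e q α β xc lam kap k := by
  rw [spikeFactor, spikeEntry, map_div₀, map_mul, map_mul, Complex.conj_ofReal,
    Complex.conj_ofReal, conj_pow_of_norm_one (by rw [norm_pow, hxc, one_pow])]
  ring

/-! ### Rank-one extraction along the path -/

/-- For all small `ε` the synthesis operator exists and its Gram operator is `L d ⊗ d` up to a
bounded operator; the spike `d` tends to its limit at a linear rate. -/
theorem exists_rankOne_extraction {N : ℕ} {e : Fin N → ℕ} (he : ∀ n, 1 ≤ e n)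
    {ζ : ℝ → Fin N → ℂ} {xs lam kap : ℝ → ℂ} {ε₁ : ℝ}
    (hyp : StandingHypotheses e ζ xs lam kap ε₁) {α β : ℝ} (hβ : 0 < β)
    (hα : IsAdmissibleWeight e ζ lam α) {q : ℕ} (hq : 1 ≤ q) (hqs : q ≤ symIndex e) :
    ∃ (kapc : ℂ) (dc : Ell2) (ε₀ K K₁ K₂ : ℝ), 0 < ε₀ ∧ ε₀ ≤ ε₁ ∧
      Tendsto kap (𝓝[>] 0) (𝓝 kapc) ∧
      (∀ j, (dc : ℕ → ℂ) j = spikeEntry e q α β (xs 0) (lam 0) kapc j) ∧ dc ≠ 0 ∧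
      ∀ ε, 0 < ε → ε < ε₀ → ‖xs ε‖ ≤ 2 ∧ ∃ (V : Ell2 →L[ℂ] Ell2) (d : Ell2),
        IsSynthesis e (ζ ε) q α β V ∧
        ‖gramBlock V - (logScale e (ζ ε) : ℂ) • InnerProductSpace.rankOne ℂ d d‖ ≤ K ∧
        d ≠ 0 ∧ ‖d‖ ≤ K₁ ∧ ‖d - dc‖ ≤ K₂ * ε := by
  have hs : 1 ≤ symIndex e := hq.trans hqs
  obtain ⟨kapc, hkapc, hkapc0, hlam0, hlamO, hkapO⟩ := exists_limits he hyp hα hs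
  obtain ⟨F, c, d, ε₂, φ, η₀, M, M₀, L₀, C₀, c₀, hε₂, hε₂1, hφ, hφ2, hη, hC, hc, hM₀, hL₀, hL₀0,
    hB⟩ := exists_branchData hyp hα hs
  have hα0 : 0 < α := hL₀0.trans_lt hL₀
  -- `A = σ² α` lies strictly between the bounds on the branch and the weight `α`
  obtain ⟨A, hA1, hAα⟩ := exists_between (max_lt hM₀ hL₀)
  have hMA : M₀ < A := (le_max_left _ _).trans_lt hA1
  have hLA : L₀ < A := (le_max_right _ _).trans_lt hA1
  have hA : 0 < A := hL₀0.trans_lt hLA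
  obtain ⟨σ, hσ0, hσ1, hσA⟩ : ∃ σ : ℝ, 0 < σ ∧ σ < 1 ∧ A = σ ^ 2 * α := by
    refine ⟨Real.sqrt (A / α), Real.sqrt_pos.mpr (by positivity), ?_, ?_⟩
    · rw [Real.sqrt_lt' one_pos, one_pow, div_lt_one hα0]
      exact hAα
    · rw [Real.sq_sqrt (by positivity), div_mul_cancel₀ _ hα0.ne']
  have hτ : 1 < σ⁻¹ := (one_lt_inv₀ hσ0).mpr hσ1
  obtain ⟨K, hK, htransfer⟩ :=
    exists_transfer_constant (M := M) hφ hφ2 hη hC hMA hLA hA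
  have hx0 := norm_xs_zero hyp
  have hξ0 : ‖xs 0 ^ symIndex e‖ = 1 := by rw [norm_pow, hx0, one_pow]
  have hxs := tendsto_of_contDiffOn hyp.pos hyp.transversal.1
  have hxsO := isBigO_of_contDiffOn hyp.pos hyp.transversal.1
  have hξO : (fun ε => xs ε ^ symIndex e - xs 0 ^ symIndex e) =O[𝓝[>] 0] fun ε : ℝ => ε :=
    isBigO_comp_of_contDiffAt (G := fun x : ℂ => x ^ symIndex e) (p₀ := xs 0)
      (by fun_prop) hxs tendsto_const_nhds hxsO
  have hξt : Tendsto (fun ε => ‖xs ε ^ symIndex e‖) (𝓝[>] 0) (𝓝 1) := by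
    rw [← hξ0]; exact (hxs.pow _).norm
  have hid : Tendsto (fun ε : ℝ => ε) (𝓝[>] 0) (𝓝 0) := tendsto_nhdsWithin_of_tendsto_nhds tendsto_id
  have hlamt : Tendsto lam (𝓝[>] 0) (𝓝 (lam 0)) :=
    tendsto_sub_nhds_zero_iff.mp (hlamO.trans_tendsto hid)
  have hpos : ∀ᶠ ε in 𝓝[>] (0 : ℝ), 0 < ε := eventually_mem_nhdsWithin
  have hlt : ∀ᶠ ε in 𝓝[>] (0 : ℝ), ε < ε₂ := nhdsWithin_le_nhds (Iio_mem_nhds hε₂)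
  have hlam0A : ‖lam 0‖ ≤ A := by
    refine le_of_tendsto hlamt.norm ?_
    filter_upwards [hpos, hlt] with ε h0 h1
    exact (hB ε h0 h1).1.lam_le.trans hLA.le
  have hkapcC : ‖kapc‖ ≤ C₀ := by
    refine le_of_tendsto hkapc.norm ?_
    filter_upwards [hpos, hlt] with ε h0 h1
    exact (hB ε h0 h1).2.2.2
  obtain ⟨D₁, hD₁⟩ := hξO.bound
  obtain ⟨D₂, hD₂⟩ := hlamO.bound
  obtain ⟨D₃, hD₃⟩ := hkapO.bound
  have hall : ∀ᶠ ε in 𝓝[>] (0 : ℝ), ε < ε₂ ∧ ‖xs ε ^ symIndex e‖ ≤ σ⁻¹ ∧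
      ‖xs ε ^ symIndex e - xs 0 ^ symIndex e‖ ≤ D₁ * ε ∧ ‖lam ε - lam 0‖ ≤ D₂ * ε ∧
      ‖kap ε - kapc‖ ≤ D₃ * ε := by
    filter_upwards [hpos, hlt, hξt.eventually_le_const hτ, hD₁, hD₂, hD₃] with ε h0 h1 h2 h3 h4 h5
    rw [Real.norm_of_nonneg h0.le] at h3 h4 h5
    exact ⟨h1, h2, h3, h4, h5⟩
  obtain ⟨ε₀, hε₀, hsub⟩ := mem_nhdsGT_iff_exists_Ioo_subset.mp hall
  set D := max D₁ (max D₂ D₃) with hD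
  have hgeo : Summable fun k : ℕ => σ ^ k := summable_geometric_of_lt_one hσ0.le hσ1
  obtain ⟨dc, hdc, -⟩ := exists_ell2_of_summable
    (f := fun k => (starRingEnd ℂ) (spikeFactor e q α β (xs 0 ^ symIndex e) (lam 0) kapc k))
    (g := fun k => symIndex e * (C₀ / (σ ^ 2 * α)) * σ ^ k)
    (fun k => by
      rw [RCLike.norm_conj]
      exact norm_spikeFactor_le hs hq hα0 hβ hσ0 hσ1 (hξ0.le.trans hτ.le) (hσA ▸ hlam0A) hkapcC k)
    (hgeo.mul_left _)
  obtain ⟨K', hK'⟩ := exists_operator_of_approx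
    (B₀ := symIndex e * (2 * (K + 7 * C₀ / A) + 2 * (C₀ / (σ ^ 2 * α))))
    (B₁ := symIndex e * (C₀ / (σ ^ 2 * α)))
    (K₁ := 2 * (1 + Real.log 4 + Real.log (2 * symIndex e : ℕ) + Real.log 2)) hσ0 hσ1
  have hξ00 : xs 0 ^ symIndex e ≠ 0 := norm_ne_zero_iff.mp (by rw [hξ0]; exact one_ne_zero)
  refine ⟨kapc, dc, ε₀, K', ∑' k, symIndex e * (C₀ / (σ ^ 2 * α)) * σ ^ k,
    ∑' k, symIndex e * (1 / (σ ^ 2 * α) + C₀ / (σ ^ 2 * α) ^ 2 + C₀ / (σ ^ 2 * α)) * D * σ ^ k,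
    hε₀, ?_, hkapc, fun j => (hdc j).trans (conj_spikeFactor e q α β hx0 _ _ j), ?_, ?_⟩
  · by_contra! hcon
    have hm := (hsub (a := (max ε₁ (ε₀ / 2))) ⟨lt_max_of_lt_left hyp.pos,
      max_lt hcon (half_lt_self hε₀)⟩).1
    exact absurd ((le_max_left ε₁ (ε₀ / 2)).trans_lt hm) (not_lt.mpr hε₂1)
  · intro h
    have h0 := hdc 0
    rw [h] at h0
    exact spikeFactor_ne_zero hs hq β hα0 hξ00 hlam0 hkapc0 0
      ((map_eq_zero (starRingEnd ℂ)).mp h0.symm)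
  · intro ε h0 h1
    obtain ⟨hε2, hξσ, e1, e2, e3⟩ := hsub ⟨h0, h1⟩
    obtain ⟨hb, hlc, hkc, hkC⟩ := hB ε h0 hε2
    have hξ1 : 1 < ‖xs ε ^ symIndex e‖ := by
      rw [norm_pow]; exact one_lt_pow₀ hb.one_lt (by omega)
    have hxs2 : ‖xs ε‖ ≤ 2 := (le_self_pow₀ hb.one_lt.le (by omega)).trans hb.pow_le
    have hlamA : ‖lam ε‖ ≤ A := hb.lam_le.trans hLA.le
    have hcoeff : ∀ p m : ℕ, 1 ≤ p → ‖coeffR e (ζ ε) p m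
        - critAmplitude (symIndex e) (kap ε) (lam ε) p * ((xs ε ^ symIndex e)⁻¹) ^ m
          * (((m + 1) * Real.sqrt (m + 1))⁻¹ : ℝ)‖
        ≤ (K + 7 * C₀ / A) * ((p + 1) * (σ ^ 2 * α) ^ p) / (m + 1) ^ 2 := by
      intro p m hp
      rw [← hσA]
      refine coeff_approx hs hA hlamA hkC hξ1 hp m ?_
      refine htransfer _ (F ε) _ _ _ _ hξ1 (by rw [norm_pow]; exact hb.pow_le) hb.diff
        hb.frontier_le hb.disk_le hb.expansion hb.lam_le hb.kap_le hb.c_le hb.d_le p _ ?_ m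
      refine hasSum_coeffR hs hb.rhoStar_pos ?_ hb.rep p
      exact (hb.differentiableOn_ball hφ hφ2 hη).analyticAt
        (Metric.ball_mem_nhds _ (pow_pos (one_pos.trans hb.one_lt) _))
    obtain ⟨V, d', hV, hd', hdn, hG⟩ := hK' (xs ε ^ symIndex e)
      (fun k j => gramVector e (ζ ε) q k j / (weight e q α β k : ℂ))
      (spikeFactor e q α β (xs ε ^ symIndex e) (lam ε) (kap ε)) (logScale e (ζ ε)) hξ1
      (gramVector_approx hs hq hqs hα0 hβ hσ0 hσ1 (by positivity) hξ1 hξσ (hσA ▸ hlamA) hkC hcoeff)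
      (norm_spikeFactor_le hs hq hα0 hβ hσ0 hσ1 hξσ (hσA ▸ hlamA) hkC)
      (by
        rw [norm_pow]
        exact abs_logSeries_sub_logScale hs (toReal_rhoStar hb.radius) hb.one_lt hxs2)
    refine ⟨hxs2, V, d', hV, hG, ?_, hdn, ?_⟩
    · intro h
      have hz := hd' 0
      rw [h] at hz
      exact spikeFactor_ne_zero hs hq β hα0 (norm_pos_iff.mp (one_pos.trans hξ1))
        (norm_pos_iff.mp (hc.trans_le hlc)) (norm_pos_iff.mp (hc.trans_le hkc)) 0
        ((map_eq_zero (starRingEnd ℂ)).mp hz.symm)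
    · have hDm : D₁ ≤ D ∧ D₂ ≤ D ∧ D₃ ≤ D :=
        ⟨le_max_left _ _, (le_max_left _ _).trans (le_max_right _ _),
          (le_max_right _ _).trans (le_max_right _ _)⟩
      obtain ⟨x, hx, hxn⟩ := exists_ell2_of_summable (f := fun k => (d' : ℕ → ℂ) k - (dc : ℕ → ℂ) k)
        (g := fun k => symIndex e * (1 / (σ ^ 2 * α) + C₀ / (σ ^ 2 * α) ^ 2 + C₀ / (σ ^ 2 * α))
          * D * σ ^ k * ε)
        (fun k => by
          rw [hd', hdc, ← map_sub, RCLike.norm_conj]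
          refine (norm_spikeFactor_sub_le (D := D * ε) hs hq hα0 hβ hσ0 hσ1 hξσ (hσA ▸ hlamA)
            (hξ0.le.trans hτ.le) (hσA ▸ hlam0A) hkapcC (e1.trans ?_) (e2.trans ?_)
            (e3.trans ?_) k).trans_eq (by ring)
          · gcongr; exact hDm.1
          · gcongr; exact hDm.2.1
          · gcongr; exact hDm.2.2)
        ((hgeo.mul_left _).mul_right _)
      have hxe : d' - dc = x := by
        apply lp.ext
        funext k
        rw [hx k]
        rfl
      rw [hxe, ← tsum_mul_right]
      exact hxn

/-! ### The logarithmic scale along the path -/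

/-- The constant controlling `L + log (ρ_* - 1)`. -/
noncomputable def logScaleError (s : ℕ) : ℝ :=
  1 + Real.log 4 + Real.log (2 * s : ℕ) + Real.log 2

theorem abs_logScale_path {N : ℕ} {e : Fin N → ℕ} {ζ : ℝ → Fin N → ℂ} {xs lam kap : ℝ → ℂ}
    {ε₁ : ℝ} (hyp : StandingHypotheses e ζ xs lam kap ε₁) (hs : 1 ≤ symIndex e) {ε : ℝ}
    (h0 : 0 < ε) (h1 : ε ≤ ε₁) (h2 : ‖xs ε‖ ≤ 2) :
    |logScale e (ζ ε) + Real.log ((rhoStar e (ζ ε)).toReal - 1)| ≤ logScaleError (symIndex e) := by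
  have hx := toReal_rhoStar (norm_xs_eq hyp h0.le h1)
  rw [hx]
  exact abs_logScale_add_log hs hx (one_lt_norm_xs hyp h0 h1) h2

theorem tendsto_logScale {N : ℕ} {e : Fin N → ℕ} {ζ : ℝ → Fin N → ℂ} {xs lam kap : ℝ → ℂ}
    {ε₁ : ℝ} (hyp : StandingHypotheses e ζ xs lam kap ε₁) (hs : 1 ≤ symIndex e) {ε₀ : ℝ}
    (hε₀ : 0 < ε₀) (hε₁ : ε₀ ≤ ε₁) (h2 : ∀ ε, 0 < ε → ε < ε₀ → ‖xs ε‖ ≤ 2) :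
    Tendsto (fun ε => logScale e (ζ ε)) (𝓝[>] 0) atTop := by
  have hxs := tendsto_of_contDiffOn hyp.pos hyp.transversal.1
  have hev : ∀ᶠ ε in 𝓝[>] (0 : ℝ), ε ∈ Set.Ioo 0 ε₀ := Ioo_mem_nhdsGT hε₀
  have h1 : Tendsto (fun ε => ‖xs ε‖ - 1) (𝓝[>] 0) (𝓝[>] 0) := by
    refine tendsto_nhdsWithin_iff.mpr ⟨?_, ?_⟩
    · have := hxs.norm.sub_const 1
      rwa [norm_xs_zero hyp, sub_self] at this
    · filter_upwards [hev] with ε hε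
      exact sub_pos.mpr (one_lt_norm_xs hyp hε.1 (hε.2.le.trans hε₁))
  have h3 := tendsto_neg_atBot_atTop.comp (Real.tendsto_log_nhdsGT_zero.comp h1)
  refine tendsto_atTop_mono' _ ?_ (tendsto_atTop_add_const_right _ (-logScaleError (symIndex e)) h3)
  filter_upwards [hev] with ε hε
  have h := abs_logScale_path hyp hs hε.1 (hε.2.le.trans hε₁) (h2 ε hε.1 hε.2)
  rw [toReal_rhoStar (norm_xs_eq hyp hε.1.le (hε.2.le.trans hε₁))] at h
  simp only [Function.comp]
  linarith [(abs_le.mp h).1]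

/-- Transversality makes `ρ_* - 1` comparable to `ε` from below, so `L = O(log (1/ε))`. -/
theorem logScale_mul_bounded {N : ℕ} {e : Fin N → ℕ} {ζ : ℝ → Fin N → ℂ} {xs lam kap : ℝ → ℂ}
    {ε₁ : ℝ} (hyp : StandingHypotheses e ζ xs lam kap ε₁) (hs : 1 ≤ symIndex e) {ε₀ : ℝ}
    (hε₀ : 0 < ε₀) (hε₁ : ε₀ ≤ ε₁) (h2 : ∀ ε, 0 < ε → ε < ε₀ → ‖xs ε‖ ≤ 2) :
    ∃ B : ℝ, ∀ᶠ ε in 𝓝[>] (0 : ℝ), ε * logScale e (ζ ε) ≤ B := by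
  obtain ⟨v, hv0, hv⟩ := hyp.transversal.2
  have hev : ∀ᶠ ε in 𝓝[>] (0 : ℝ), ε ∈ Set.Ioo 0 ε₀ := Ioo_mem_nhdsGT hε₀
  have hr0 : (rhoStar e (ζ 0)).toReal = 1 := by
    rw [toReal_rhoStar (norm_xs_eq hyp le_rfl hyp.pos.le), norm_xs_zero hyp]
  have hslope := hasDerivWithinAt_iff_tendsto_slope.mp hv
  rw [Set.Ici_sdiff_left] at hslope
  have hpos : ∀ ε ∈ Set.Ioo 0 ε₀, 0 < (rhoStar e (ζ ε)).toReal - 1 := fun ε hε => by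
    rw [toReal_rhoStar (norm_xs_eq hyp hε.1.le (hε.2.le.trans hε₁))]
    exact sub_pos.mpr (one_lt_norm_xs hyp hε.1 (hε.2.le.trans hε₁))
  have hvpos : 0 < v := by
    refine lt_of_le_of_ne (ge_of_tendsto hslope ?_) hv0.symm
    filter_upwards [hev] with ε hε
    rw [slope_def_field, hr0, sub_zero]
    exact (div_pos (hpos ε hε) hε.1).le
  refine ⟨|logScaleError (symIndex e) - Real.log (v / 2)| + 1, ?_⟩
  filter_upwards [hev, hslope.eventually_const_le (half_lt_self hvpos), Ioo_mem_nhdsGT one_pos]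
    with ε hε hsl hε1
  rw [slope_def_field, hr0, sub_zero, le_div_iff₀ hε.1] at hsl
  have hlog : Real.log (v / 2) + Real.log ε ≤ Real.log ((rhoStar e (ζ ε)).toReal - 1) := by
    rw [← Real.log_mul (by positivity) hε.1.ne']
    exact Real.log_le_log (mul_pos (by positivity) hε.1) hsl
  have h := (abs_le.mp (abs_logScale_path hyp hs hε.1 (hε.2.le.trans hε₁) (h2 ε hε.1 hε.2))).2
  have hle : -(ε * Real.log ε) ≤ 1 := by
    have h3 := Real.log_le_sub_one_of_pos (inv_pos.mpr hε.1)
    rw [Real.log_inv] at h3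
    have h4 := mul_le_mul_of_nonneg_left h3 hε.1.le
    rw [mul_sub, mul_inv_cancel₀ hε.1.ne'] at h4
    linarith [hε.1]
  calc ε * logScale e (ζ ε)
      ≤ ε * ((logScaleError (symIndex e) - Real.log (v / 2)) - Real.log ε) :=
        mul_le_mul_of_nonneg_left (by linarith) hε.1.le
    _ = ε * (logScaleError (symIndex e) - Real.log (v / 2)) + -(ε * Real.log ε) := by ring
    _ ≤ 1 * |logScaleError (symIndex e) - Real.log (v / 2)| + 1 := by
        refine add_le_add ?_ hle
        exact (mul_le_mul_of_nonneg_left (le_abs_self _) hε.1.le).trans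
          (mul_le_mul_of_nonneg_right hε1.2.le (abs_nonneg _))
    _ = _ := by rw [one_mul]

theorem theorem4 {N : ℕ} (e : Fin N → ℕ) (he : StrictMono e) (he2 : ∀ n, 2 ≤ e n)
    (ζ : ℝ → Fin N → ℂ) (xs lam kap : ℝ → ℂ) (ε₁ : ℝ)
    (hyp : StandingHypotheses e ζ xs lam kap ε₁)
    (α β : ℝ) (hβ : 0 < β) (hα : IsAdmissibleWeight e ζ lam α)
    (q : ℕ) (hq : 1 ≤ q) (hqs : q ≤ symIndex e) :
    -- the logarithmic scale
    (fun ε => logScale e (ζ ε) - Real.log (1 / ((rhoStar e (ζ ε)).toReal - 1)))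
        =O[𝓝[>] 0] (fun _ => (1 : ℝ)) ∧
    ∃ (ε₀ : ℝ) (V : ℝ → Ell2 →L[ℂ] Ell2) (d : ℝ → Ell2) (dc : Ell2) (kapc : ℂ), 0 < ε₀ ∧
      -- the renormalized synthesis map is a bounded operator on `ℓ²`
      (∀ ε, 0 < ε → ε < ε₀ → IsSynthesis e (ζ ε) q α β (V ε)) ∧
      -- the limit vector of the rank-one extraction
      (∃ K : ℝ, ∀ ε, 0 < ε → ε < ε₀ →
        ‖gramBlock (V ε) - (logScale e (ζ ε) : ℂ) • InnerProductSpace.rankOne ℂ (d ε) (d ε)‖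
          ≤ K) ∧
      Tendsto d (𝓝[>] 0) (𝓝 dc) ∧
      Tendsto kap (𝓝[>] 0) (𝓝 kapc) ∧
      (∀ j, (dc : ℕ → ℂ) j = spikeEntry e q α β (xs 0) (lam 0) kapc j) ∧
      0 < ‖dc‖ ^ 2 ∧
      -- the top level diverges logarithmically
      (fun ε => minmaxLevel (gramBlock (V ε)) 1 - ‖dc‖ ^ 2 * logScale e (ζ ε))
        =O[𝓝[>] 0] (fun _ => (1 : ℝ)) ∧
      Tendsto (fun ε => minmaxLevel (gramBlock (V ε)) 1 / logScale e (ζ ε)) (𝓝[>] 0)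
        (𝓝 (‖dc‖ ^ 2)) ∧
      -- all higher levels stay bounded
      (∀ k, 2 ≤ k → ∃ B : ℝ, ∀ ε, 0 < ε → ε < ε₀ → |minmaxLevel (gramBlock (V ε)) k| ≤ B) := by
  have hs : 1 ≤ symIndex e := hq.trans hqs
  obtain ⟨kapc, dc, ε₀, K, K₁, K₂, hε₀, hε₁, hkapc, hdc, hdc0, H⟩ :=
    exists_rankOne_extraction (fun n => one_le_two.trans (he2 n)) hyp hβ hα hq hqs
  have hev : ∀ᶠ ε in 𝓝[>] (0 : ℝ), ε ∈ Set.Ioo 0 ε₀ := Ioo_mem_nhdsGT hε₀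
  have h2 : ∀ ε, 0 < ε → ε < ε₀ → ‖xs ε‖ ≤ 2 := fun ε h0 h1 => (H ε h0 h1).1
  have H' : ∀ ε, ∃ (V : Ell2 →L[ℂ] Ell2) (d : Ell2), 0 < ε → ε < ε₀ →
      IsSynthesis e (ζ ε) q α β V ∧
        ‖gramBlock V - (logScale e (ζ ε) : ℂ) • InnerProductSpace.rankOne ℂ d d‖ ≤ K ∧
        d ≠ 0 ∧ ‖d‖ ≤ K₁ ∧ ‖d - dc‖ ≤ K₂ * ε := by
    intro ε
    by_cases h : 0 < ε ∧ ε < ε₀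
    · obtain ⟨V, d, hVd⟩ := (H ε h.1 h.2).2
      exact ⟨V, d, fun _ _ => hVd⟩
    · exact ⟨0, 0, fun h0 h1 => absurd ⟨h0, h1⟩ h⟩
  choose V d hVd using H'
  obtain ⟨B, hB⟩ := logScale_mul_bounded hyp hs hε₀ hε₁ h2
  have hL := tendsto_logScale hyp hs hε₀ hε₁ h2
  have htop : (fun ε => minmaxLevel (gramBlock (V ε)) 1 - ‖dc‖ ^ 2 * logScale e (ζ ε))
      =O[𝓝[>] 0] (fun _ => (1 : ℝ)) := by
    refine IsBigO.of_bound (K + (K₁ + ‖dc‖) * (|K₂| * |B|)) ?_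
    filter_upwards [hev, hB] with ε hε hεB
    obtain ⟨-, hG, hd0, hdK, hdd⟩ := hVd ε hε.1 hε.2
    have hL0 := logScale_nonneg e (ζ ε)
    have h1 := minmaxLevel_one_approx (V ε) (d ε) hd0 hL0 hG
    -- replacing `‖d‖²` by `‖dc‖²` costs `O(ε) L = O(ε log (1/ε))`
    have h3 : |(‖d ε‖ ^ 2 - ‖dc‖ ^ 2) * logScale e (ζ ε)| ≤ (K₁ + ‖dc‖) * (|K₂| * |B|) := by
      have e1 : (‖d ε‖ ^ 2 - ‖dc‖ ^ 2) * logScale e (ζ ε)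
          = (‖d ε‖ + ‖dc‖) * (‖d ε‖ - ‖dc‖) * logScale e (ζ ε) := by ring
      rw [e1, abs_mul, abs_mul, abs_of_nonneg hL0, abs_of_nonneg (by positivity)]
      have h4 : |‖d ε‖ - ‖dc‖| ≤ |K₂| * ε :=
        ((abs_norm_sub_norm_le _ _).trans hdd).trans
          (mul_le_mul_of_nonneg_right (le_abs_self _) hε.1.le)
      calc _ ≤ (‖d ε‖ + ‖dc‖) * (|K₂| * ε) * logScale e (ζ ε) := by gcongr
        _ = (‖d ε‖ + ‖dc‖) * (|K₂| * (ε * logScale e (ζ ε))) := by ring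
        _ ≤ (K₁ + ‖dc‖) * (|K₂| * |B|) := by
            have h5 := hε.1
            have h6 : 0 ≤ K₁ + ‖dc‖ :=
              add_nonneg ((norm_nonneg _).trans hdK) (norm_nonneg _)
            gcongr
            exact hεB.trans (le_abs_self _)
    rw [norm_one, mul_one, Real.norm_eq_abs]
    calc _ = |(minmaxLevel (gramBlock (V ε)) 1 - ‖d ε‖ ^ 2 * logScale e (ζ ε))
          + (‖d ε‖ ^ 2 - ‖dc‖ ^ 2) * logScale e (ζ ε)| := by congr 1; ring
      _ ≤ _ := (abs_add_le _ _).trans (add_le_add h1 h3)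
  refine ⟨?_, ε₀, V, d, dc, kapc, hε₀, fun ε h0 h1 => (hVd ε h0 h1).1,
    ⟨K, fun ε h0 h1 => (hVd ε h0 h1).2.1⟩, ?_, hkapc, hdc, by positivity, htop, ?_,
    fun k hk => ⟨K, fun ε h0 h1 =>
      minmaxLevel_gramBlock_bounded (V ε) (d ε) (hVd ε h0 h1).2.2.1 (hVd ε h0 h1).2.1 hk⟩⟩
  · refine IsBigO.of_bound (logScaleError (symIndex e)) ?_
    filter_upwards [hev] with ε hε
    rw [norm_one, mul_one, Real.norm_eq_abs, one_div, Real.log_inv, sub_neg_eq_add]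
    exact abs_logScale_path hyp hs hε.1 (hε.2.le.trans hε₁) (h2 ε hε.1 hε.2)
  · refine tendsto_iff_norm_sub_tendsto_zero.mpr ?_
    have hid : Tendsto (fun ε : ℝ => K₂ * ε) (𝓝[>] 0) (𝓝 0) := by
      have : Tendsto (fun ε : ℝ => K₂ * ε) (𝓝 0) (𝓝 (K₂ * 0)) := tendsto_id.const_mul K₂
      rw [mul_zero] at this
      exact tendsto_nhdsWithin_of_tendsto_nhds this
    refine squeeze_zero' (Eventually.of_forall fun _ => norm_nonneg _) ?_ hid
    filter_upwards [hev] with ε hε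
    exact (hVd ε hε.1 hε.2).2.2.2.2
  · have h1 : Tendsto (fun ε => (minmaxLevel (gramBlock (V ε)) 1
        - ‖dc‖ ^ 2 * logScale e (ζ ε)) / logScale e (ζ ε)) (𝓝[>] 0) (𝓝 0) := by
      have hinv : Tendsto (fun ε => (logScale e (ζ ε))⁻¹) (𝓝[>] 0) (𝓝 0) :=
        tendsto_inv_atTop_zero.comp hL
      have h3 := htop.mul (isBigO_refl (fun ε => (logScale e (ζ ε))⁻¹) (𝓝[>] 0))
      simp only [one_mul] at h3
      exact (h3.trans_tendsto hinv).congr fun ε => (div_eq_mul_inv _ _).symm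
    have h3 := h1.add_const (‖dc‖ ^ 2)
    rw [zero_add] at h3
    refine h3.congr' ?_
    filter_upwards [hL.eventually_gt_atTop 0] with ε hε
    field_simp
    ring
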